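/- **Model.** There are $n$ experts and $T$ rounds. An online learning algorithm with $S$ bits of memory is a randomized procedure whose memory state is, at all times, an element of $\{0,1\}^S$. Its initial memory may be random. In round $t\in\{1,\dots,T\}$ it first chooses an expert $i_t\in\{1,\dots,n\}$ (and possibly a new memory state) at random, with a distribution that depends only on its current memory; then the loss vector $\ell_t\in[0,1]^n$ becomes available, and the algorithm performs a fixed number of queries: each queried index is determined by the current memory, and after each answer $\ell_t(i)$ the memory is updated at random, with a distribution that depends only on the current memory and the answer. The adversary is oblivious: the sequence $\ell_1,\dots,\ell_T\in[0,1]^n$ is fixed in advance. The total regret is $$R=\sum_{t=1}^T \ell_t(i_t)-\min_{i^*\in\{1,\dots,n\}}\sum_{t=1}^T\ell_t(i^*).$$ **Theorem 4.1.** For every $a\in\mathbb N$ there are constants $C\in\mathbb{R}$ and $c\in\mathbb N$, depending only on $a$, such that for all positive integers $n,T$ and all $\delta\in(0,1]$ there is an online learning algorithm with $S$ bits of memory (the algorithm may depend on $n,T,\delta,a$), where $$S\le C\,n^{\delta}\log^4(nT),$$ such that for every loss sequence $\ell_1,\dots,\ell_T\in[0,1]^n$, with probability at least $1-T^{-a}$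 over the randomness of the algorithm, $$R\le C\,n^2\,T^{\frac{2}{2+\delta}}\log^{c}(nT).$$ -/

import Mathlib

noncomputable section

/-- A randomized online learning algorithm with `n` experts whose memory takes values in `Mem`.
It has no access to anything that survives from one step to the next except its memory
(in particular it has no clock), and it reads a loss vector only by querying single entries. -/
structure OnlineAlgorithm (n : ℕ) (Mem : Type) where
  /-- (Random) initial memory. -/
  init : PMF Mem
  /-- Given the memory at the start of a round, randomly choose the expert to be played, together
  with the memory that is carried into the update phase of the round. -/
  play : Mem → PMF (Fin n × Mem)
  /-- Number of queries to the loss vector in each round. -/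
  queries : ℕ
  /-- The entry of the loss vector that is queried next, given the current memory. -/
  query : Mem → Fin n
  /-- The (random) new memory, given the current memory and the answer to the query. -/
  step : Mem → ℝ → PMF Mem

namespace OnlineAlgorithm

variable {n : ℕ} {Mem : Type}

/-- The law of the memory after `q` successive queries to the loss vector `v`, starting
from memory `m`. -/
def update (A : OnlineAlgorithm n Mem) (v : Fin n → ℝ) : ℕ → Mem → PMF Mem
  | 0, m => PMF.pure m
  | q + 1, m => (A.step m (v (A.query m))).bind (A.update v q)

/-- The joint law of the memory after `T` rounds and of the experts played in these rounds, on the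
loss sequence `ℓ` (which is fixed in advance: the adversary is oblivious). -/
def run (A : OnlineAlgorithm n Mem) :
    (T : ℕ) → (Fin T → Fin n → ℝ) → PMF (Mem × (Fin T → Fin n))
  | 0, _ => A.init.map fun m => (m, Fin.elim0)
  | T + 1, ℓ =>
    (A.run T fun t => ℓ t.castSucc).bind fun s =>
      (A.play s.1).bind fun a =>
        (A.update (ℓ (Fin.last T)) A.queries a.2).map fun m =>
          (m, Fin.snoc (α := fun _ => Fin n) s.2 a.1)

/-- The law of the sequence `i₁, …, i_T` of experts played on the loss sequence `ℓ`. -/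
def decisions (A : OnlineAlgorithm n Mem) {T : ℕ} (ℓ : Fin T → Fin n → ℝ) :
    PMF (Fin T → Fin n) :=
  (A.run T ℓ).map Prod.snd

end OnlineAlgorithm

/-- The total regret of the decisions `d` on the loss sequence `ℓ`, with respect to the best expert
in hindsight. -/
def totalRegret {n T : ℕ} (ℓ : Fin T → Fin n → ℝ) (d : Fin T → Fin n) : ℝ :=
  ∑ t, ℓ t (d t) - ⨅ i, ∑ t, ℓ t i

end

/-! Each level of a hierarchy improves a weaker strategy, its base, by a small pool of sampled
experts. Time is cut into slots, and `B` slots form a run. In every slot a uniform expert enters the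
pool. It stays only while, on every period since its entry, it beats by an average of `V / g` per
slot the benchmark, that is, the best of the base and of the surviving earlier entrants.

The pool is small: clipping the losses keeps the benchmark within `V` of the base, while a survivor
of age about `2 ^ j` has lowered it by at least `2 ^ j * V / g` in total. Hence every dyadic age
class has at most `2 g` members (`card_survivors_le`, `card_pool_le`).

The benchmark is good (`sum_bench_sub_le`): fix an expert `i`. In a slot where `i` would not survive
until the end of the run, some period starting there costs less than `V / g` per slot against `i`,
and one jumps to its end. A slot where `i` would survive costs at most `V`. As the losses are fixed
in advance, whether a slot is of this kind is independent of the expert drawn in it, so `i` is drawn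
with probability `1 / n`, and `m` misses without a hit have probability at most `exp (-m / n)`
(`PMF.measure_missed_le`). After a hit, `i` is in the pool.

Exponential weights, restarted in each slot, follow the benchmark up to `slotError`. So regret `V k`
in the slots of level `k` becomes `V B / g + V m + B * slotError` in the next, `B` times longer
slots (`Hierarchy.regret_run_le`). For `g = 3 Γ` and `B = 3 m Γ` each term is at most `m V`: the
average regret drops by `Γ` per level. With `m` of order `n log (n T)` and `Γ` of order `(3 m) ^ (δ
/ 2)`, stacking levels until the slots reach length `T` gives the exponent `2 / (2 + δ)`
(`horizon_le`).

The state consists of few pool members per level with bounded integer data, because losses are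
rounded to a grid. It takes few values, and `Strategy.exists_implementation` turns this count into
bits. -/

open Finset

/-! ### The pool and the benchmark of a single run -/

/-- An expert `i` that enters a pool in slot `s` survives until slot `u` if, on every period since
its entry, its losses `v` beat the benchmark `c` by an average of at least `V / g`. -/
def Survives {n : ℕ} (c : ℕ → ℤ) (v : ℕ → Fin n → ℤ) (V g : ℤ) (i : Fin n) (s u : ℕ) : Prop :=
  ∀ e, s < e → e ≤ u → V * ((e : ℤ) - s) ≤ g * ∑ x ∈ Ico s e, (c x - v x i)

open Classical in
/-- `bench b v V g ω s u` is the smallest loss in slot `u` among the base `b` and those of the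
experts entering in slots before `s` which survive until slot `u`. -/
noncomputable def bench {n : ℕ} (b : ℕ → ℤ) (v : ℕ → Fin n → ℤ) (V g : ℤ) (ω : ℕ → Fin n) :
    ℕ → ℕ → ℤ
  | 0 => b
  | s + 1 => fun u =>
    if Survives (bench b v V g ω s) v V g (ω s) s u
    then min (bench b v V g ω s u) (v u (ω s)) else bench b v V g ω s u

section Pool

variable {n : ℕ} {b : ℕ → ℤ} {v : ℕ → Fin n → ℤ} {V g : ℤ} {ω : ℕ → Fin n}

theorem Survives.mono {c : ℕ → ℤ} {i : Fin n} {s u u' : ℕ} (h : Survives c v V g i s u)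
    (hu : u' ≤ u) : Survives c v V g i s u' :=
  fun e h1 h2 => h e h1 (h2.trans hu)

theorem survives_self (c : ℕ → ℤ) (i : Fin n) (s : ℕ) : Survives c v V g i s s :=
  fun _ h1 h2 => absurd h1 (not_lt.2 h2)

theorem survives_succ_iff {c : ℕ → ℤ} {i : Fin n} {s u : ℕ} (hsu : s ≤ u) :
    Survives c v V g i s (u + 1) ↔ Survives c v V g i s u ∧
      V * (((u + 1 : ℕ) : ℤ) - s) ≤ g * ∑ x ∈ Ico s (u + 1), (c x - v x i) := by
  refine ⟨fun h => ⟨h.mono u.le_succ, h _ (by omega) le_rfl⟩, fun h e h1 h2 => ?_⟩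
  rcases Nat.lt_or_ge e (u + 1) with h3 | h3
  · exact h.1 e h1 (by omega)
  · obtain rfl : e = u + 1 := by omega
    exact h.2

open Classical in
theorem bench_succ (s u : ℕ) : bench b v V g ω (s + 1) u =
    if Survives (bench b v V g ω s) v V g (ω s) s u
    then min (bench b v V g ω s u) (v u (ω s)) else bench b v V g ω s u := rfl

theorem bench_succ_le (s u : ℕ) : bench b v V g ω (s + 1) u ≤ bench b v V g ω s u := by
  rw [bench_succ]
  split_ifs
  · exact min_le_left _ _
  · exact le_rfl

theorem bench_antitone (u : ℕ) : Antitone fun s => bench b v V g ω s u :=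
  antitone_nat_of_succ_le fun s => bench_succ_le s u

theorem bench_le_base (s u : ℕ) : bench b v V g ω s u ≤ b u :=
  bench_antitone u (Nat.zero_le s)

theorem bench_succ_le_of_survives {s u : ℕ}
    (h : Survives (bench b v V g ω s) v V g (ω s) s u) :
    bench b v V g ω (s + 1) u ≤ v u (ω s) := by
  rw [bench_succ, if_pos h]
  exact min_le_right _ _

/-- The clipping hypothesis `hv` gives a budget for how far all entrants together can pull the
benchmark down; the pool size is limited by it. -/
theorem le_bench (hV : 0 ≤ V) (hv : ∀ u i, b u - V ≤ v u i) (s u : ℕ) :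
    b u - V ≤ bench b v V g ω s u := by
  induction s with
  | zero => rw [bench]; linarith
  | succ s ih =>
    rw [bench_succ]
    split_ifs
    · exact le_min ih (hv _ _)
    · exact ih

/-- The benchmark is attained by the base or by an expert of the pool. -/
theorem bench_eq_or (s u : ℕ) : bench b v V g ω s u = b u ∨
    ∃ s' < s, Survives (bench b v V g ω s') v V g (ω s') s' u ∧
      bench b v V g ω s u = v u (ω s') := by
  induction s with
  | zero => exact Or.inl rfl
  | succ s ih =>
    rw [bench_succ]
    split_ifs with h
    · rcases min_choice (bench b v V g ω s u) (v u (ω s)) with h1 | h1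
      · rw [h1]
        rcases ih with h2 | ⟨s', h2, h3⟩
        · exact Or.inl h2
        · exact Or.inr ⟨s', by omega, h3⟩
      · exact Or.inr ⟨s, by omega, h, h1⟩
    · rcases ih with h2 | ⟨s', h2, h3⟩
      · exact Or.inl h2
      · exact Or.inr ⟨s', by omega, h3⟩

/-- Survival is tested against earlier entrants only, so later draws never matter. This makes the
badness of a slot independent of the expert drawn in it. -/
theorem bench_congr {ω' : ℕ → Fin n} {s : ℕ} (h : ∀ x < s, ω x = ω' x) :
    bench b v V g ω s = bench b v V g ω' s := by
  induction s with
  | zero => rfl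
  | succ s ih =>
    funext u
    simp only [bench]
    rw [ih fun x hx => h x (by omega), h s (by omega)]

/-- The regret of the benchmark with respect to the expert `i`, when `i` is never missed too often:
`s₀` is the first slot in which `i` enters the pool and stays there. -/
theorem sum_bench_sub_le {B m s₀ : ℕ} (i : Fin n) (hV : 0 ≤ V) (hg : 0 < g)
    (hv : ∀ u i, b u - V ≤ v u i) (bad : Finset ℕ)
    (hbad : ∀ s < B, s < s₀ → s ∉ bad → ¬ Survives (bench b v V g ω s) v V g i s B)
    (hs₀ : s₀ < B → Survives (bench b v V g ω s₀) v V g i s₀ B ∧ ω s₀ = i)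
    (hm : bad.card ≤ m) :
    g * ∑ u ∈ range B, (bench b v V g ω (u + 1) u - v u i) ≤ V * B + g * (V * m) := by
  -- Walk through the run: a bad slot costs at most `V`, a failing slot is skipped together with the
  -- period that witnesses the failure, and from `s₀` on the expert `i` is itself in the pool.
  have key : ∀ d t, t + d = B →
      g * ∑ u ∈ Ico t B, (bench b v V g ω (u + 1) u - v u i) ≤
        V * d + g * (V * (bad.filter (t ≤ ·)).card) := by
    intro d
    induction d using Nat.strong_induction_on with
    | _ d ih =>
      intro t ht
      rcases Nat.eq_zero_or_pos d with hd | hd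
      · subst hd
        obtain rfl : t = B := by omega
        simp only [Ico_self, sum_empty, mul_zero, Nat.cast_zero, zero_add]
        positivity
      by_cases hts : s₀ ≤ t
      · obtain ⟨h1, h2⟩ := hs₀ (by omega)
        have : ∑ u ∈ Ico t B, (bench b v V g ω (u + 1) u - v u i) ≤ 0 := by
          refine sum_nonpos fun u hu => ?_
          rw [mem_Ico] at hu
          have h3 : bench b v V g ω (u + 1) u ≤ bench b v V g ω (s₀ + 1) u :=
            bench_antitone u (by omega)
          have h4 : bench b v V g ω (s₀ + 1) u ≤ v u (ω s₀) :=
            bench_succ_le_of_survives (by rw [h2]; exact h1.mono hu.2.le)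
          rw [h2] at h4
          linarith
        have h5 : (0 : ℤ) ≤ V * d + g * (V * (bad.filter (t ≤ ·)).card) := by positivity
        nlinarith
      by_cases htb : t ∈ bad
      · have h1 := ih (d - 1) (by omega) (t + 1) (by omega)
        rw [sum_eq_sum_Ico_succ_bot (by omega)]
        have h2 : bench b v V g ω (t + 1) t ≤ b t := bench_le_base _ _
        have h3 := hv t i
        have h4 : (bad.filter (t + 1 ≤ ·)).card + 1 ≤ (bad.filter (t ≤ ·)).card := by
          rw [← card_insert_of_notMem (s := bad.filter (t + 1 ≤ ·)) (a := t) (by simp)]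
          refine card_le_card fun x hx => ?_
          simp only [mem_insert, mem_filter] at hx ⊢
          rcases hx with rfl | hx
          · exact ⟨htb, le_rfl⟩
          · exact ⟨hx.1, by omega⟩
        have h4' : ((bad.filter (t + 1 ≤ ·)).card : ℤ) + 1 ≤ (bad.filter (t ≤ ·)).card := by
          exact_mod_cast h4
        have h5 : ((d - 1 : ℕ) : ℤ) ≤ d := by omega
        have h6 : V * ((d - 1 : ℕ) : ℤ) ≤ V * d := mul_le_mul_of_nonneg_left h5 hV
        have h7 : g * (bench b v V g ω (t + 1) t - v t i) ≤ g * V :=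
          mul_le_mul_of_nonneg_left (by linarith) hg.le
        have h8 : g * (V * (((bad.filter (t + 1 ≤ ·)).card : ℤ) + 1)) ≤
            g * (V * (bad.filter (t ≤ ·)).card) :=
          mul_le_mul_of_nonneg_left (mul_le_mul_of_nonneg_left h4' hV) hg.le
        rw [mul_add]
        linarith
      -- The failure is measured against the benchmark at entry time `t`; later entrants only lower
      -- the benchmark that is followed.
      · have h1 := hbad t (by omega) (by omega) htb
        simp only [Survives, not_forall, not_le] at h1
        obtain ⟨e, h2, h3, h4⟩ := h1
        have h5 := ih (B - e) (by omega) e (by omega)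
        rw [← sum_Ico_consecutive _ h2.le h3, mul_add]
        have h6 : ∑ u ∈ Ico t e, (bench b v V g ω (u + 1) u - v u i) ≤
            ∑ u ∈ Ico t e, (bench b v V g ω t u - v u i) := by
          refine sum_le_sum fun u hu => ?_
          rw [mem_Ico] at hu
          have : bench b v V g ω (u + 1) u ≤ bench b v V g ω t u := bench_antitone u (by omega)
          linarith
        have h7 := mul_le_mul_of_nonneg_left h6 hg.le
        have h8 : (bad.filter (e ≤ ·)).card ≤ (bad.filter (t ≤ ·)).card := by
          refine card_le_card fun x hx => ?_
          simp only [mem_filter] at hx ⊢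
          exact ⟨hx.1, by omega⟩
        have h8' : ((bad.filter (e ≤ ·)).card : ℤ) ≤ (bad.filter (t ≤ ·)).card := by
          exact_mod_cast h8
        have h9 : g * (V * ((bad.filter (e ≤ ·)).card : ℤ)) ≤
            g * (V * (bad.filter (t ≤ ·)).card) :=
          mul_le_mul_of_nonneg_left (mul_le_mul_of_nonneg_left h8' hV) hg.le
        have h10 : ((B - e : ℕ) : ℤ) + ((e : ℤ) - t) = d := by omega
        have h11 : V * (((B - e : ℕ) : ℤ) + ((e : ℤ) - t)) = V * d := by rw [h10]
        rw [mul_add] at h11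
        linarith
  have h := key B 0 (by omega)
  rw [range_eq_Ico]
  have h2 : (bad.filter (0 ≤ ·)).card ≤ m := (card_filter_le _ _).trans hm
  have h2' : ((bad.filter (0 ≤ ·)).card : ℤ) ≤ m := by exact_mod_cast h2
  have h3 := mul_le_mul_of_nonneg_left (mul_le_mul_of_nonneg_left h2' hV) hg.le
  linarith

open Classical in
/-- The entry slots of the experts which survive until slot `u`. -/
noncomputable def pool (b : ℕ → ℤ) (v : ℕ → Fin n → ℤ) (V g : ℤ) (ω : ℕ → Fin n) (u : ℕ) :
    Finset ℕ :=
  (range (u + 1)).filter fun s => Survives (bench b v V g ω s) v V g (ω s) s u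

theorem mem_pool {s u : ℕ} : s ∈ pool b v V g ω u ↔
    s ≤ u ∧ Survives (bench b v V g ω s) v V g (ω s) s u := by
  simp [pool]

theorem card_pool_le_succ (u : ℕ) : (pool b v V g ω u).card ≤ u + 1 := by
  classical
  exact (card_filter_le _ _).trans (card_range _).le

/-- Each survivor of age at least `2 ^ j` accounts for a total drop of the benchmark of at least `V
* 2 ^ j / g`. All these drops occur in the last `2 ^ (j + 1)` slots, where at most `V` per slot is
available. -/
theorem card_survivors_le (hV : 0 < V) (hg : 0 ≤ g) (hv : ∀ u i, b u - V ≤ v u i) (e j : ℕ) :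
    (((pool b v V g ω e).filter fun s => 2 ^ j ≤ e - s ∧ e - s < 2 ^ (j + 1)).card : ℤ)
      ≤ 2 * g := by
  set S := (pool b v V g ω e).filter fun s => 2 ^ j ≤ e - s ∧ e - s < 2 ^ (j + 1) with hS
  set w := e - 2 ^ (j + 1) with hw
  have hwe : w ≤ e := Nat.sub_le _ _
  have hpow : 2 ^ (j + 1) = 2 * 2 ^ j := by ring
  -- After exchanging the sums, the drops caused by successive entrants telescope in each slot `u`.
  have h1 : ∑ s ∈ Ico w e, ∑ u ∈ Ico s e, (bench b v V g ω s u - bench b v V g ω (s + 1) u) =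
      ∑ u ∈ Ico w e, (bench b v V g ω w u - bench b v V g ω (u + 1) u) := by
    rw [sum_Ico_Ico_comm]
    refine sum_congr rfl fun u hu => ?_
    rw [mem_Ico] at hu
    have := sum_Ico_sub (fun s => bench b v V g ω s u) (show w ≤ u + 1 by omega)
    simp only [sum_sub_distrib] at this ⊢
    linarith
  have h2 : ∑ u ∈ Ico w e, (bench b v V g ω w u - bench b v V g ω (u + 1) u) ≤
      (2 ^ (j + 1) : ℕ) * V := by
    have : ∑ u ∈ Ico w e, (bench b v V g ω w u - bench b v V g ω (u + 1) u) ≤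
        ∑ u ∈ Ico w e, V := sum_le_sum fun u _ => by
      have := le_bench (ω := ω) (g := g) hV.le hv (u + 1) u
      have := bench_le_base (b := b) (v := v) (V := V) (g := g) (ω := ω) w u
      linarith
    refine this.trans ?_
    rw [sum_const, Nat.card_Ico, nsmul_eq_mul]
    exact mul_le_mul_of_nonneg_right (by exact_mod_cast (by omega)) hV.le
  have hSsub : S ⊆ Ico w e := fun s hs => by
    simp only [hS, mem_filter] at hs
    have : 0 < 2 ^ j := by positivity
    rw [mem_Ico]
    omega
  have h3 : ∑ s ∈ S, ∑ u ∈ Ico s e, (bench b v V g ω s u - bench b v V g ω (s + 1) u) ≤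
      ∑ s ∈ Ico w e, ∑ u ∈ Ico s e, (bench b v V g ω s u - bench b v V g ω (s + 1) u) :=
    sum_le_sum_of_subset_of_nonneg hSsub fun s _ _ => sum_nonneg fun u _ => by
      linarith [bench_succ_le (b := b) (v := v) (V := V) (g := g) (ω := ω) s u]
  have h4 : ∀ s ∈ S, V * (2 ^ j : ℕ) ≤
      g * ∑ u ∈ Ico s e, (bench b v V g ω s u - bench b v V g ω (s + 1) u) := by
    intro s hs
    simp only [hS, mem_filter, mem_pool] at hs
    obtain ⟨⟨h5, h6⟩, h7, h8⟩ := hs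
    have hpos : 0 < 2 ^ j := by positivity
    have h9 := h6 e (by omega) le_rfl
    have h10 : ∑ x ∈ Ico s e, (bench b v V g ω s x - v x (ω s)) ≤
        ∑ u ∈ Ico s e, (bench b v V g ω s u - bench b v V g ω (s + 1) u) := by
      refine sum_le_sum fun u hu => ?_
      rw [mem_Ico] at hu
      have := bench_succ_le_of_survives (h6.mono hu.2.le)
      linarith
    have h11 : V * (2 ^ j : ℕ) ≤ V * ((e : ℤ) - s) :=
      mul_le_mul_of_nonneg_left (by omega) hV.le
    have h12 := mul_le_mul_of_nonneg_left h10 hg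
    linarith
  have h5 := card_nsmul_le_sum S _ _ h4
  rw [← mul_sum, nsmul_eq_mul] at h5
  have h6 := mul_le_mul_of_nonneg_left ((h3.trans h1.le).trans h2) hg
  have hpos : (0 : ℤ) < V * (2 ^ j : ℕ) := by positivity
  refine le_of_mul_le_mul_right ?_ hpos
  calc (S.card : ℤ) * (V * (2 ^ j : ℕ)) ≤ g * ((2 ^ (j + 1) : ℕ) * V) := h5.trans h6
    _ = 2 * g * (V * (2 ^ j : ℕ)) := by rw [hpow]; push_cast; ring

/-- The positive ages fall into `Nat.log 2 B + 1` dyadic classes; the summand `1` is the newest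
entrant, of age zero. -/
theorem card_pool_le {G B e : ℕ} (hV : 0 < V) (hv : ∀ u i, b u - V ≤ v u i) (he : e < B) :
    (pool b v V (G : ℤ) ω e).card ≤ 1 + 2 * G * (Nat.log 2 B + 1) := by
  have hsub : pool b v V (G : ℤ) ω e ⊆ insert e ((range (Nat.log 2 B + 1)).biUnion fun j =>
      (pool b v V (G : ℤ) ω e).filter fun s => 2 ^ j ≤ e - s ∧ e - s < 2 ^ (j + 1)) := by
    intro s hs
    have h1 := (mem_pool.1 hs).1
    rcases h1.eq_or_lt with rfl | h1
    · simp
    refine mem_insert_of_mem (mem_biUnion.2 ⟨Nat.log 2 (e - s), ?_, ?_⟩)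
    · rw [mem_range, Nat.lt_succ_iff]
      exact Nat.log_mono_right (by omega)
    · rw [mem_filter]
      exact ⟨hs, Nat.pow_log_le_self 2 (by omega), Nat.lt_pow_succ_log_self (by norm_num) _⟩
  refine (card_le_card hsub).trans ((card_insert_le _ _).trans ?_)
  rw [add_comm]
  refine Nat.add_le_add_left (card_biUnion_le.trans ?_) 1
  refine (sum_le_card_nsmul _ _ (2 * G) fun j _ => ?_).trans ?_
  · have := card_survivors_le (ω := ω) hV (Int.natCast_nonneg G) hv e j
    exact_mod_cast this
  · rw [card_range, smul_eq_mul, mul_comm]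

end Pool

/-! ### Exponential weights -/

/-- The average of `z` over `S` with exponential weights. -/
noncomputable def hedgeMix {ι : Type*} (S : Finset ι) (η : ℝ) (past z : ι → ℝ) : ℝ :=
  (∑ j ∈ S, Real.exp (-η * past j) * z j) / ∑ j ∈ S, Real.exp (-η * past j)

section Hedge

variable {ι : Type*} {S : Finset ι} {η : ℝ} {past : ι → ℝ}

theorem sum_exp_weights_pos (hS : S.Nonempty) : 0 < ∑ j ∈ S, Real.exp (-η * past j) :=
  sum_pos (fun _ _ => Real.exp_pos _) hS

theorem hedgeMix_mono {z z' : ι → ℝ} (h : ∀ j ∈ S, z j ≤ z' j) :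
    hedgeMix S η past z ≤ hedgeMix S η past z' :=
  div_le_div_of_nonneg_right
    (sum_le_sum fun j hj => mul_le_mul_of_nonneg_left (h j hj) (Real.exp_pos _).le)
    (sum_nonneg fun _ _ => (Real.exp_pos _).le)

theorem hedgeMix_const (hS : S.Nonempty) (c : ℝ) : hedgeMix S η past (fun _ => c) = c := by
  rw [hedgeMix, ← sum_mul, mul_div_cancel_left₀ _ (sum_exp_weights_pos hS).ne']

theorem sum_hedgeMix {κ : Type*} (A : Finset κ) (z : κ → ι → ℝ) :
    ∑ i ∈ A, hedgeMix S η past (z i) = hedgeMix S η past fun j => ∑ i ∈ A, z i j := by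
  simp only [hedgeMix, ← sum_div, mul_sum]
  rw [sum_comm]

theorem hedgeMix_mul (z : ι → ℝ) (c : ℝ) :
    hedgeMix S η past z * c = hedgeMix S η past fun j => z j * c := by
  simp only [hedgeMix, div_mul_eq_mul_div, sum_mul, mul_assoc]

theorem hedgeMix_congr {past' z z' : ι → ℝ} (h : ∀ j ∈ S, past j = past' j)
    (h' : ∀ j ∈ S, z j = z' j) : hedgeMix S η past z = hedgeMix S η past' z' := by
  unfold hedgeMix
  congr 1
  · exact sum_congr rfl fun j hj => by rw [h j hj, h' j hj]
  · exact sum_congr rfl fun j hj => by rw [h j hj]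

theorem exp_neg_le_of_mem_unit {x : ℝ} (h0 : 0 ≤ x) (h1 : x ≤ 1) :
    Real.exp (-x) ≤ 1 - x + x ^ 2 := by
  have h := Real.abs_exp_sub_one_sub_id_le (x := -x) (by rwa [abs_neg, abs_of_nonneg h0])
  have := (abs_le.1 h).2
  nlinarith

/-- The regret bound for exponential weights. -/
theorem sum_hedgeMix_le {N : ℝ} (hη : 0 < η) (hηN : η * N ≤ 1) (y : ℕ → ι → ℝ)
    (hy0 : ∀ t, ∀ j ∈ S, 0 ≤ y t j) (hyN : ∀ t, ∀ j ∈ S, y t j ≤ N) {j₀ : ι} (hj₀ : j₀ ∈ S)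
    (D : ℕ) :
    ∑ t ∈ range D, hedgeMix S η (fun j => ∑ x ∈ range t, y x j) (y t) ≤
      ∑ t ∈ range D, y t j₀ + Real.log S.card / η + η * N ^ 2 * D := by
  have hS : S.Nonempty := ⟨j₀, hj₀⟩
  set W : ℕ → ℝ := fun t => ∑ j ∈ S, Real.exp (-η * ∑ x ∈ range t, y x j) with hW
  set m : ℕ → ℝ := fun t => hedgeMix S η (fun j => ∑ x ∈ range t, y x j) (y t) with hm
  have hWpos : ∀ t, 0 < W t := fun t => sum_exp_weights_pos hS
  -- The total weight is the potential: it shrinks with the loss of the mixture up to a second-order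
  -- factor, and the weight of `j₀` bounds it from below.
  have hstep : ∀ t, W (t + 1) ≤ W t * Real.exp (-η * m t + η ^ 2 * N ^ 2) := by
    intro t
    have h1 : W (t + 1) ≤ ∑ j ∈ S, Real.exp (-η * ∑ x ∈ range t, y x j) *
        (1 - η * y t j + η ^ 2 * N ^ 2) := by
      refine sum_le_sum fun j hj => ?_
      rw [sum_range_succ, mul_add, Real.exp_add]
      refine mul_le_mul_of_nonneg_left ?_ (Real.exp_pos _).le
      have h0 := hy0 t j hj
      have hN := hyN t j hj
      have h2 : η * y t j ≤ η * N := mul_le_mul_of_nonneg_left hN hη.le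
      have h3 := exp_neg_le_of_mem_unit (x := η * y t j) (by positivity) (h2.trans hηN)
      have h4 : (η * y t j) ^ 2 ≤ η ^ 2 * N ^ 2 := by
        rw [← mul_pow]; exact pow_le_pow_left₀ (by positivity) h2 2
      rw [neg_mul]
      linarith
    have h2 : ∑ j ∈ S, Real.exp (-η * ∑ x ∈ range t, y x j) * (1 - η * y t j + η ^ 2 * N ^ 2)
        = W t * (-η * m t + η ^ 2 * N ^ 2 + 1) := by
      have h3 : W t * m t = ∑ j ∈ S, Real.exp (-η * ∑ x ∈ range t, y x j) * y t j := by
        simp only [hm, hedgeMix]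
        exact mul_div_cancel₀ _ (hWpos t).ne'
      have : W t * (-η * m t + η ^ 2 * N ^ 2 + 1) =
          -η * (W t * m t) + W t * (η ^ 2 * N ^ 2 + 1) := by ring
      rw [this, h3, hW, mul_sum, sum_mul, ← sum_add_distrib]
      refine sum_congr rfl fun j _ => by ring
    rw [h2] at h1
    exact h1.trans (mul_le_mul_of_nonneg_left (Real.add_one_le_exp _) (hWpos t).le)
  have hprod : W D ≤ S.card * Real.exp (∑ t ∈ range D, (-η * m t + η ^ 2 * N ^ 2)) := by
    induction D with
    | zero => simp [hW]
    | succ D ih =>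
      rw [sum_range_succ, Real.exp_add, ← mul_assoc]
      exact (hstep D).trans (mul_le_mul_of_nonneg_right ih (Real.exp_pos _).le)
  have hlow : Real.exp (-η * ∑ x ∈ range D, y x j₀) ≤ W D :=
    single_le_sum (f := fun j => Real.exp (-η * ∑ x ∈ range D, y x j))
      (fun _ _ => (Real.exp_pos _).le) hj₀
  have hcard : (0 : ℝ) < S.card := by exact_mod_cast hS.card_pos
  have h1 := Real.log_le_log (Real.exp_pos _) (hlow.trans hprod)
  rw [Real.log_exp, Real.log_mul hcard.ne' (Real.exp_pos _).ne', Real.log_exp,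
    sum_add_distrib, sum_const, card_range, nsmul_eq_mul, ← mul_sum] at h1
  have h2 : η * ∑ t ∈ range D, m t ≤
      η * (∑ t ∈ range D, y t j₀ + Real.log S.card / η + η * N ^ 2 * D) := by
    have : η * (Real.log S.card / η) = Real.log S.card := by field_simp
    rw [mul_add, mul_add, this]
    nlinarith
  exact le_of_mul_le_mul_left h2 hη

end Hedge

/-! ### The hierarchy of levels and its regret -/

/-- The sum of `f` over the `j`-th slot of length `D`. -/
def slotSum (D : ℕ) (f : ℕ → ℤ) (j : ℕ) : ℤ := ∑ x ∈ range D, f (j * D + x)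

/-- The sum of `f` over the part before time `τ` of the slot of `τ`. -/
def partSum (D : ℕ) (f : ℕ → ℤ) (τ : ℕ) : ℤ := ∑ x ∈ range (τ % D), f (τ / D * D + x)

/-- The parameters of the hierarchy of pools. Level `k` has slots of length `D k`; `B` of them form
a run, after which the pool is emptied. -/
structure Hierarchy (n : ℕ) where
  /-- The expert played on the lowest level. -/
  i₀ : Fin n
  /-- The number of slots of a run. -/
  B : ℕ
  /-- The slot lengths. -/
  D : ℕ → ℕ
  /-- The losses of a slot are cut off at this distance below the loss of the base. -/
  V : ℕ → ℤ
  /-- The inverse of the gain of accuracy on each level. -/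
  g : ℕ
  /-- The learning rates. -/
  η : ℕ → ℝ

namespace Hierarchy

variable {n : ℕ} (P : Hierarchy n) (k : ℕ) (b : ℕ → ℤ) (ℓ : ℕ → Fin n → ℤ) (ω : ℕ → Fin n)

/-- The loss of the base in the slots of run `r`. -/
def slotBase (r u : ℕ) : ℤ := slotSum (P.D k) b (r * P.B + u)

/-- The losses of the experts in the slots of run `r`. -/
def slotLoss (r u : ℕ) (i : Fin n) : ℤ :=
  max (slotSum (P.D k) (ℓ · i) (r * P.B + u)) (P.slotBase k b r u - P.V k)

/-- The experts which enter the pool in the slots of run `r`. -/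
def entrant (r u : ℕ) : Fin n := ω ((r * P.B + u) * P.D k)

/-- The benchmark of run `r`. -/
noncomputable def runBench (r : ℕ) : ℕ → ℕ → ℤ :=
  bench (P.slotBase k b r) (P.slotLoss k b ℓ r) (P.V k) P.g (P.entrant k ω r)

/-- The survivors of run `r` in slot `u`. -/
noncomputable def runPool (r u : ℕ) : Finset ℕ :=
  pool (P.slotBase k b r) (P.slotLoss k b ℓ r) (P.V k) P.g (P.entrant k ω r) u

/-- The run to which time `τ` belongs. -/
def runOf (τ : ℕ) : ℕ := τ / P.D k / P.B

/-- The slot (within its run) to which time `τ` belongs. -/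
def slotOf (τ : ℕ) : ℕ := τ / P.D k % P.B

/-- The cumulative losses in the current slot. -/
def past (τ : ℕ) : Option ℕ → ℤ
  | none => partSum (P.D k) b τ
  | some s => partSum (P.D k) (ℓ · (P.entrant k ω (P.runOf k τ) s)) τ

/-- The average over the base and the pool at time `τ`. -/
noncomputable def mix (τ : ℕ) (y : ℝ) (z : Fin n → ℝ) : ℝ :=
  hedgeMix (insertNone (P.runPool k b ℓ ω (P.runOf k τ) (P.slotOf k τ))) (P.η k)
    (fun o => P.past k b ℓ ω τ o)
    fun o => o.elim y fun s => z (P.entrant k ω (P.runOf k τ) s)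

/-- The (rounded) expected loss of level `k`. -/
noncomputable def loss (ω : ℕ → ℕ → Fin n) : ℕ → ℕ → ℤ
  | 0 => fun τ => ℓ τ P.i₀
  | k + 1 => fun τ => ⌈P.mix k (loss ω k) ℓ (fun t => ω t k) τ (loss ω k τ) fun i => ℓ τ i⌉

/-- The probabilities with which level `k` plays the experts. -/
noncomputable def dist (ω : ℕ → ℕ → Fin n) : ℕ → ℕ → Fin n → ℝ
  | 0 => fun _ i => if i = P.i₀ then 1 else 0
  | k + 1 => fun τ i => P.mix k (P.loss ℓ ω k) ℓ (fun t => ω t k) τ (dist ω k τ i)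
      fun j => if i = j then 1 else 0

variable {P k b ℓ ω}

theorem insertNone_nonempty {α : Type*} (s : Finset α) : (insertNone s).Nonempty :=
  ⟨none, by simp⟩

theorem mix_mono {τ : ℕ} {y y' : ℝ} {z z' : Fin n → ℝ} (hy : y ≤ y') (hz : ∀ i, z i ≤ z' i) :
    P.mix k b ℓ ω τ y z ≤ P.mix k b ℓ ω τ y' z' :=
  hedgeMix_mono fun o _ => by
    cases o
    · exact hy
    · exact hz _

theorem mix_const {τ : ℕ} (c : ℝ) : P.mix k b ℓ ω τ c (fun _ => c) = c := by
  have : (fun o : Option ℕ => o.elim c fun _ => c) = fun _ => c := by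
    funext o; cases o <;> rfl
  rw [mix, this, hedgeMix_const (insertNone_nonempty _)]

theorem sum_mix {κ : Type*} (A : Finset κ) (τ : ℕ) (y : κ → ℝ) (z : κ → Fin n → ℝ) :
    ∑ i ∈ A, P.mix k b ℓ ω τ (y i) (z i) =
      P.mix k b ℓ ω τ (∑ i ∈ A, y i) fun j => ∑ i ∈ A, z i j := by
  simp only [mix]
  rw [sum_hedgeMix]
  congr 1
  funext o
  cases o <;> rfl

theorem mix_mul (τ : ℕ) (y : ℝ) (z : Fin n → ℝ) (c : ℝ) :
    P.mix k b ℓ ω τ y z * c = P.mix k b ℓ ω τ (y * c) fun j => z j * c := by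
  simp only [mix, hedgeMix_mul]
  congr 1
  funext o
  cases o <;> rfl

section Bounds

variable {N : ℤ} {ω : ℕ → ℕ → Fin n}

theorem loss_nonneg (h0 : ∀ t i, 0 ≤ ℓ t i) (k τ : ℕ) : 0 ≤ P.loss ℓ ω k τ := by
  induction k with
  | zero => exact h0 _ _
  | succ k ih =>
    rw [loss]
    exact Int.ceil_nonneg ((mix_const 0).symm.le.trans
      (mix_mono (by exact_mod_cast ih) fun i => by exact_mod_cast h0 _ _))

theorem loss_le (hN : ∀ t i, ℓ t i ≤ N) (k τ : ℕ) : P.loss ℓ ω k τ ≤ N := by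
  induction k with
  | zero => exact hN _ _
  | succ k ih =>
    rw [loss, Int.ceil_le]
    exact (mix_mono (by exact_mod_cast ih) fun i => by exact_mod_cast hN _ _).trans
      (mix_const (N : ℝ)).le

theorem dist_nonneg (k τ : ℕ) (i : Fin n) : 0 ≤ P.dist ℓ ω k τ i := by
  induction k with
  | zero => simp only [dist]; split_ifs <;> norm_num
  | succ k ih =>
    calc (0 : ℝ) = P.mix k (P.loss ℓ ω k) ℓ (fun t => ω t k) τ 0 fun _ => 0 :=
        (mix_const 0).symm
      _ ≤ P.mix k (P.loss ℓ ω k) ℓ (fun t => ω t k) τ (P.dist ℓ ω k τ i)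
          fun j => if i = j then 1 else 0 := mix_mono ih fun j => by split_ifs <;> norm_num

theorem sum_dist (k τ : ℕ) : ∑ i, P.dist ℓ ω k τ i = 1 := by
  induction k with
  | zero => simp [dist]
  | succ k ih =>
    simp only [dist]
    rw [sum_mix, ih]
    simp only [sum_ite_eq', mem_univ, if_true, mix_const]

/-- The expected loss of level `k` is at most its rounded value. -/
theorem sum_dist_mul_le (k τ : ℕ) :
    ∑ i, P.dist ℓ ω k τ i * (ℓ τ i : ℝ) ≤ P.loss ℓ ω k τ := by
  induction k with
  | zero => simp [dist, loss]
  | succ k ih =>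
    simp only [dist, mix_mul]
    rw [sum_mix]
    refine le_trans ?_ (Int.le_ceil _)
    refine mix_mono ih fun j => ?_
    simp

end Bounds

theorem slotLoss_ge (r u : ℕ) (i : Fin n) :
    P.slotBase k b r u - P.V k ≤ P.slotLoss k b ℓ r u i := le_max_right _ _

theorem card_runPool_le (hV : 0 < P.V k) {r u : ℕ} (hu : u < P.B) :
    (P.runPool k b ℓ ω r u).card ≤ 1 + 2 * P.g * (Nat.log 2 P.B + 1) :=
  card_pool_le hV (fun _ _ => slotLoss_ge _ _ _) hu

end Hierarchy

namespace Hierarchy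

variable {n : ℕ} {P : Hierarchy n} {k : ℕ} {ℓ : ℕ → Fin n → ℤ} {ω : ℕ → ℕ → Fin n}

theorem mul_add_div {D j x : ℕ} (hx : x < D) : (j * D + x) / D = j := by
  rw [mul_comm, Nat.mul_add_div (by omega), Nat.div_eq_of_lt hx, add_zero]

theorem mul_add_mod {D j x : ℕ} (hx : x < D) : (j * D + x) % D = x := by
  rw [mul_comm, Nat.mul_add_mod, Nat.mod_eq_of_lt hx]

/-- The excess loss in a slot of level `k`, compared to the base and the pool. -/
noncomputable def slotError (P : Hierarchy n) (N : ℤ) (k : ℕ) : ℝ :=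
  Real.log (P.B + 1) / P.η k + P.η k * N ^ 2 * P.D k + P.D k

/-- The weights are restarted in each slot on the base and the current pool, so the level competes
with whichever of them attains the benchmark. The last summand `P.D k` of `slotError` pays for
rounding up once per time step. -/
theorem slotSum_loss_le {N : ℤ} (h0 : ∀ t i, 0 ≤ ℓ t i) (hN : ∀ t i, ℓ t i ≤ N)
    (hη : 0 < P.η k) (hηN : P.η k * N ≤ 1) {r u : ℕ} (hu : u < P.B) :
    (slotSum (P.D k) (P.loss ℓ ω (k + 1)) (r * P.B + u) : ℝ) ≤
      P.runBench k (P.loss ℓ ω k) ℓ (fun t => ω t k) r (u + 1) u + P.slotError N k := by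
  set D := P.D k with hD
  set j := r * P.B + u with hj
  set b := P.loss ℓ ω k with hb
  set e := P.entrant k (fun t => ω t k) r with he
  set S := insertNone (P.runPool k b ℓ (fun t => ω t k) r u) with hS
  let y : ℕ → Option ℕ → ℝ := fun x o =>
    o.elim (b (j * D + x) : ℝ) fun s => (ℓ (j * D + x) (e s) : ℝ)
  have hy0 : ∀ x, ∀ o ∈ S, 0 ≤ y x o := by
    rintro x (_ | s) -
    · exact Int.cast_nonneg (loss_nonneg h0 _ _)
    · exact Int.cast_nonneg (h0 _ _)
  have hyN : ∀ x, ∀ o ∈ S, y x o ≤ N := by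
    rintro x (_ | s) -
    · exact Int.cast_le.2 (loss_le hN _ _)
    · exact Int.cast_le.2 (hN _ _)
  have hmix : ∀ x ∈ range D, (P.loss ℓ ω (k + 1) (j * D + x) : ℝ) ≤
      hedgeMix S (P.η k) (fun o => ∑ x' ∈ range x, y x' o) (y x) + 1 := by
    intro x hx
    rw [mem_range] at hx
    have hrun : P.runOf k (j * D + x) = r := by
      rw [runOf, ← hD, mul_add_div hx, hj, mul_add_div hu]
    have hslot : P.slotOf k (j * D + x) = u := by
      rw [slotOf, ← hD, mul_add_div hx, hj, mul_add_mod hu]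
    rw [loss]
    refine (Int.ceil_lt_add_one _).le.trans (add_le_add_left (le_of_eq ?_) _)
    rw [mix, hrun, hslot]
    refine hedgeMix_congr (fun o _ => ?_) fun o _ => ?_
    · cases o with
      | none => simp only [past, partSum, ← hD, mul_add_div hx, mul_add_mod hx, y,
          Option.elim, Int.cast_sum, hb]
      | some s => simp only [past, partSum, ← hD, mul_add_div hx, mul_add_mod hx, y,
          Option.elim, Int.cast_sum, hrun, ← he]
    · cases o <;> rfl
  have hsum : (slotSum D (P.loss ℓ ω (k + 1)) j : ℝ) ≤
      ∑ x ∈ range D, hedgeMix S (P.η k) (fun o => ∑ x' ∈ range x, y x' o) (y x) + D := by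
    rw [slotSum, Int.cast_sum]
    refine (sum_le_sum hmix).trans (le_of_eq ?_)
    rw [sum_add_distrib]
    simp
  obtain ⟨o, ho, hle⟩ : ∃ o ∈ S, ∑ x ∈ range D, y x o ≤
      (P.runBench k b ℓ (fun t => ω t k) r (u + 1) u : ℝ) := by
    rcases bench_eq_or (b := P.slotBase k b r) (v := P.slotLoss k b ℓ r) (V := P.V k) (g := P.g)
      (ω := P.entrant k (fun t => ω t k) r) (u + 1) u with h | ⟨s, h1, h2, h3⟩
    · refine ⟨none, by simp [hS], ?_⟩
      rw [runBench, h, slotBase, slotSum, Int.cast_sum]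
      exact le_rfl
    · refine ⟨some s, by
        rw [hS, some_mem_insertNone, runPool, mem_pool]
        exact ⟨by omega, h2⟩, ?_⟩
      rw [runBench, h3]
      -- Clipping only raises a loss, so the true loss of this survivor is no larger than the
      -- benchmark.
      have : slotSum D (ℓ · (e s)) j ≤ P.slotLoss k b ℓ r u (e s) := le_max_left _ _
      refine le_trans (le_of_eq ?_) (Int.cast_le.2 this)
      rw [slotSum, Int.cast_sum]
      rfl
  have hreg := sum_hedgeMix_le hη hηN y hy0 hyN ho D
  have hcard : Real.log S.card / P.η k ≤ Real.log (P.B + 1) / P.η k := by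
    refine div_le_div_of_nonneg_right (Real.log_le_log ?_ ?_) hη.le
    · exact_mod_cast (insertNone_nonempty _).card_pos
    · rw [hS, card_insertNone]
      have : (P.runPool k b ℓ (fun t => ω t k) r u).card ≤ u + 1 :=
        card_pool_le_succ u
      exact_mod_cast (by omega)
  rw [slotError]
  linarith

theorem slotSum_slots (D B : ℕ) (f : ℕ → ℤ) (r : ℕ) :
    slotSum (D * B) f r = ∑ u ∈ range B, slotSum D f (r * B + u) := by
  simp only [slotSum]
  induction B with
  | zero => simp
  | succ B ih =>
    clear ih
    have : ∀ m (F : ℕ → ℤ), ∑ x ∈ range (D * m), F x =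
        ∑ u ∈ range m, ∑ x ∈ range D, F (u * D + x) := by
      intro m F
      induction m with
      | zero => simp
      | succ m ih => rw [Nat.mul_succ, sum_range_add, ih, sum_range_succ, mul_comm D m]
    rw [this]
    refine sum_congr rfl fun u _ => sum_congr rfl fun x _ => ?_
    congr 1
    ring

/-- The expert `i` would survive to the end of run `r` of level `k` if it entered in slot `s`. -/
def Bad (P : Hierarchy n) (k : ℕ) (ℓ : ℕ → Fin n → ℤ) (ω : ℕ → ℕ → Fin n) (i : Fin n)
    (r s : ℕ) : Prop :=
  Survives (P.runBench k (P.loss ℓ ω k) ℓ (fun t => ω t k) r s)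
    (P.slotLoss k (P.loss ℓ ω k) ℓ r) (P.V k) P.g i s P.B

/-- The entrant of slot `s` of run `r` of level `k`. -/
def newcomer (P : Hierarchy n) (k : ℕ) (ω : ℕ → ℕ → Fin n) (r s : ℕ) : Fin n :=
  ω ((r * P.B + s) * P.D k) k

open Classical in
/-- In one of the first `H` slots of run `r` of level `k`, the expert `i` has been missed `m` times
in slots in which it would have stayed, and was never hit. -/
def Missed (P : Hierarchy n) (k : ℕ) (ℓ : ℕ → Fin n → ℤ) (i : Fin n) (r m H : ℕ)
    (ω : ℕ → ℕ → Fin n) : Prop :=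
  (∀ s < H, P.Bad k ℓ ω i r s → P.newcomer k ω r s ≠ i) ∧
    m ≤ ((range H).filter fun s => P.Bad k ℓ ω i r s).card

/-- The regret of level `k + 1` in a run, when level `k` has small regret in all of its slots. -/
theorem regret_run_le {N : ℤ} {m : ℕ} (h0 : ∀ t i, 0 ≤ ℓ t i) (hN : ∀ t i, ℓ t i ≤ N)
    (hη : 0 < P.η k) (hηN : P.η k * N ≤ 1) (hV : 0 ≤ P.V k) (hg : 0 < P.g)
    (hD : P.D (k + 1) = P.D k * P.B)
    (hV' : P.V k * P.B / P.g + P.V k * m + P.B * P.slotError N k ≤ (P.V (k + 1) : ℝ))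
    {r : ℕ} {i : Fin n}
    (hreg : ∀ u < P.B, slotSum (P.D k) (P.loss ℓ ω k) (r * P.B + u) ≤
      slotSum (P.D k) (ℓ · i) (r * P.B + u) + P.V k)
    (hmiss : ∀ H ≤ P.B, ¬ P.Missed k ℓ i r (m + 1) H ω) :
    slotSum (P.D (k + 1)) (P.loss ℓ ω (k + 1)) r ≤
      slotSum (P.D (k + 1)) (ℓ · i) r + P.V (k + 1) := by
  classical
  set b := P.loss ℓ ω k with hb
  -- The base has regret at most `V k` in each slot, so clipping leaves the losses of `i` unchanged.
  have hv : ∀ u < P.B, P.slotLoss k b ℓ r u i = slotSum (P.D k) (ℓ · i) (r * P.B + u) :=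
    fun u hu => max_eq_left (by have := hreg u hu; rw [slotBase]; linarith)
  -- `s₀` is the first bad slot in which `i` is drawn, or `P.B` if there is none.
  obtain ⟨s₀, hs₀B, hs₀, hbefore⟩ : ∃ s₀ ≤ P.B,
      (s₀ < P.B → P.Bad k ℓ ω i r s₀ ∧ P.newcomer k ω r s₀ = i) ∧
      ∀ s < s₀, P.Bad k ℓ ω i r s → P.newcomer k ω r s ≠ i := by
    by_cases h : ∃ s, s < P.B ∧ P.Bad k ℓ ω i r s ∧ P.newcomer k ω r s = i
    · refine ⟨Nat.find h, (Nat.find_spec h).1.le, fun _ => (Nat.find_spec h).2,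
        fun s hs h1 h2 => Nat.find_min h hs ⟨hs.trans (Nat.find_spec h).1, h1, h2⟩⟩
    · exact ⟨P.B, le_rfl, fun h1 => absurd h1 (lt_irrefl _), fun s hs h1 h2 => h ⟨s, hs, h1, h2⟩⟩
  -- Before the first hit every bad slot is a miss, so `hmiss` applies with `H = s₀`.
  have hcard : ((range s₀).filter fun s => P.Bad k ℓ ω i r s).card ≤ m := by
    by_contra h
    exact hmiss s₀ hs₀B ⟨hbefore, by omega⟩
  have hmain := sum_bench_sub_le (b := P.slotBase k b r) (v := P.slotLoss k b ℓ r)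
    (V := P.V k) (g := P.g) (ω := P.entrant k (fun t => ω t k) r) (B := P.B) (m := m) (s₀ := s₀)
    i hV (by exact_mod_cast hg) (fun _ _ => slotLoss_ge _ _ _)
    ((range s₀).filter fun s => P.Bad k ℓ ω i r s)
    (fun s _ h1 h2 h3 => h2 (mem_filter.2 ⟨mem_range.2 h1, h3⟩))
    (fun h => by
      obtain ⟨h1, h2⟩ := hs₀ h
      have h2' : P.entrant k (fun t => ω t k) r s₀ = i := h2
      rw [h2']
      exact ⟨h1, rfl⟩)
    hcard
  have hsum : (slotSum (P.D (k + 1)) (P.loss ℓ ω (k + 1)) r : ℝ) ≤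
      ∑ u ∈ range P.B, ((P.runBench k b ℓ (fun t => ω t k) r (u + 1) u : ℝ) +
        P.slotError N k) := by
    rw [hD, slotSum_slots, Int.cast_sum]
    exact sum_le_sum fun u hu => slotSum_loss_le h0 hN hη hηN (mem_range.1 hu)
  have hi : (slotSum (P.D (k + 1)) (ℓ · i) r : ℝ) =
      ∑ u ∈ range P.B, (P.slotLoss k b ℓ r u i : ℝ) := by
    rw [hD, slotSum_slots, Int.cast_sum]
    exact sum_congr rfl fun u hu => by rw [hv u (mem_range.1 hu)]
  have hgR : (0 : ℝ) < P.g := by exact_mod_cast hg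
  have hmainR : (P.g : ℝ) * ∑ u ∈ range P.B,
      ((P.runBench k b ℓ (fun t => ω t k) r (u + 1) u : ℝ) - P.slotLoss k b ℓ r u i) ≤
        P.V k * P.B + P.g * (P.V k * m) := by
    exact_mod_cast hmain
  have hdiv : ∑ u ∈ range P.B,
      ((P.runBench k b ℓ (fun t => ω t k) r (u + 1) u : ℝ) - P.slotLoss k b ℓ r u i) ≤
        P.V k * P.B / P.g + P.V k * m := by
    rw [← mul_le_mul_iff_right₀ hgR]
    refine hmainR.trans (le_of_eq ?_)
    field_simp
  rw [sum_add_distrib, sum_const, card_range, nsmul_eq_mul] at hsum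
  rw [sum_sub_distrib] at hdiv
  have : (slotSum (P.D (k + 1)) (P.loss ℓ ω (k + 1)) r : ℝ) ≤
      (slotSum (P.D (k + 1)) (ℓ · i) r + P.V (k + 1) : ℤ) := by
    push_cast
    rw [hi]
    linarith
  exact_mod_cast this

/-- The regret of all levels in all slots before time `T`. -/
theorem regret_slot_le {N : ℤ} {m K T : ℕ} {i : Fin n} (h0 : ∀ t i, 0 ≤ ℓ t i)
    (hN : ∀ t i, ℓ t i ≤ N) (hη : ∀ k < K, 0 < P.η k) (hηN : ∀ k < K, P.η k * N ≤ 1)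
    (hV : ∀ k < K, 0 ≤ P.V k) (hg : 0 < P.g) (hD : ∀ k, P.D (k + 1) = P.D k * P.B)
    (hV0 : N * P.D 0 ≤ P.V 0)
    (hV' : ∀ k < K,
      P.V k * P.B / P.g + P.V k * m + P.B * P.slotError N k ≤ (P.V (k + 1) : ℝ))
    (hmiss : ∀ k < K, ∀ r, (r + 1) * P.D (k + 1) ≤ T → ∀ H ≤ P.B,
      ¬ P.Missed k ℓ i r (m + 1) H ω) :
    ∀ k ≤ K, ∀ r, (r + 1) * P.D k ≤ T → slotSum (P.D k) (P.loss ℓ ω k) r ≤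
      slotSum (P.D k) (ℓ · i) r + P.V k := by
  intro k
  induction k with
  | zero =>
    intro _ r _
    have h1 : slotSum (P.D 0) (P.loss ℓ ω 0) r ≤ N * P.D 0 := by
      refine (sum_le_card_nsmul _ _ N fun x _ => loss_le hN _ _).trans ?_
      rw [card_range, nsmul_eq_mul, mul_comm]
    have h2 : 0 ≤ slotSum (P.D 0) (ℓ · i) r := sum_nonneg fun x _ => h0 _ _
    linarith
  | succ k ih =>
    intro hk r hr
    refine regret_run_le h0 hN (hη k hk) (hηN k hk) (hV k hk) hg (hD k) (hV' k hk)
      (fun u hu => ih (by omega) _ (le_trans ?_ hr)) (hmiss k hk r hr)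
    rw [hD, mul_comm (P.D k), ← mul_assoc]
    refine Nat.mul_le_mul_right _ ?_
    rw [add_mul]
    omega

end Hierarchy

/-! ### Expectations, independent sequences and the probability of missing an expert -/

open scoped ENNReal

namespace PMF

variable {α β γ : Type*}

/-- The expectation of a nonnegative function. -/
noncomputable def ex (p : PMF α) (f : α → ℝ≥0∞) : ℝ≥0∞ := ∑' a, p a * f a

theorem ex_mono (p : PMF α) {f g : α → ℝ≥0∞} (h : ∀ a, f a ≤ g a) : p.ex f ≤ p.ex g :=
  ENNReal.tsum_le_tsum fun a => mul_le_mul_right (h a) _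

theorem ex_const (p : PMF α) (c : ℝ≥0∞) : (p.ex fun _ => c) = c := by
  rw [ex, ENNReal.tsum_mul_right, p.tsum_coe, one_mul]

theorem ex_const_mul (p : PMF α) (c : ℝ≥0∞) (f : α → ℝ≥0∞) :
    (p.ex fun a => c * f a) = c * p.ex f := by
  simp only [ex, ← ENNReal.tsum_mul_left]
  exact tsum_congr fun a => by ring

theorem ex_add (p : PMF α) (f g : α → ℝ≥0∞) :
    (p.ex fun a => f a + g a) = p.ex f + p.ex g := by
  simp only [ex, ← ENNReal.tsum_add, mul_add]

theorem ex_pure (a : α) (f : α → ℝ≥0∞) : (PMF.pure a).ex f = f a := by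
  classical
  rw [ex, tsum_eq_single a]
  · simp
  · intro b hb
    simp [PMF.pure_apply, hb]

theorem ex_bind (p : PMF α) (q : α → PMF β) (f : β → ℝ≥0∞) :
    (p.bind q).ex f = p.ex fun a => (q a).ex f := by
  simp only [ex, PMF.bind_apply, ← ENNReal.tsum_mul_right, ← ENNReal.tsum_mul_left]
  rw [ENNReal.tsum_comm]
  exact tsum_congr fun a => tsum_congr fun b => by ring

theorem ex_map (p : PMF α) (q : α → β) (f : β → ℝ≥0∞) :
    (p.map q).ex f = p.ex fun a => f (q a) := by
  rw [← PMF.bind_pure_comp, ex_bind]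
  simp only [Function.comp, ex_pure]

theorem toOuterMeasure_eq_ex (p : PMF α) (s : Set α) :
    p.toOuterMeasure s = p.ex (s.indicator 1) := by
  classical
  rw [PMF.toOuterMeasure_apply, ex]
  refine tsum_congr fun a => ?_
  by_cases h : a ∈ s <;> simp [h]

theorem ex_fintype [Fintype α] (p : PMF α) (f : α → ℝ≥0∞) : p.ex f = ∑ a, p a * f a :=
  tsum_fintype _

/-- The law of a sequence whose first `T` entries are independent with law `μ`, and whose other
entries are `d`. -/
noncomputable def prodSeq (d : α) (μ : PMF α) : ℕ → PMF (ℕ → α)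
  | 0 => PMF.pure fun _ => d
  | T + 1 => (prodSeq d μ T).bind fun ω => μ.map (Function.update ω T)

/-- Resampling an entry with a kernel that leaves `μ` invariant. -/
theorem prodSeq_resample (d : α) (μ : PMF α) (R : α → PMF α) (hR : μ.bind R = μ) {t T : ℕ}
    (ht : t < T) :
    ((prodSeq d μ T).bind fun ω => (R (ω t)).map (Function.update ω t)) = prodSeq d μ T := by
  induction T with
  | zero => omega
  | succ T ih =>
    rw [prodSeq, PMF.bind_bind]
    rcases Nat.lt_succ_iff_lt_or_eq.1 ht with h | rfl
    · have h1 : ∀ ω : ℕ → α, ((μ.map (Function.update ω T)).bind fun ω' =>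
          (R (ω' t)).map (Function.update ω' t)) =
          ((R (ω t)).map (Function.update ω t)).bind fun ω' =>
            μ.map (Function.update ω' T) := by
        intro ω
        rw [PMF.bind_map, PMF.bind_map]
        simp only [Function.comp_def, Function.update_of_ne h.ne]
        simp only [← PMF.bind_pure_comp, Function.comp_def]
        rw [PMF.bind_comm]
        simp only [Function.update_comm h.ne]
      simp only [h1]
      rw [← PMF.bind_bind, ih h]
    · have h1 : ∀ ω : ℕ → α, ((μ.map (Function.update ω t)).bind fun ω' =>
          (R (ω' t)).map (Function.update ω' t)) = μ.map (Function.update ω t) := by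
        intro ω
        rw [PMF.bind_map]
        have h2 : ∀ x, Function.update (Function.update ω t x) t = Function.update ω t :=
          fun x => funext fun y => Function.update_idem ..
        simp only [Function.comp_def, Function.update_self, h2]
        rw [← PMF.map_bind, hR]
      simp only [h1]

theorem prodSeq_update (d : α) (μ : PMF α) {t T : ℕ} (ht : t < T) :
    ((prodSeq d μ T).bind fun ω => μ.map (Function.update ω t)) = prodSeq d μ T :=
  prodSeq_resample d μ (fun _ => μ) (by rw [PMF.bind_const]) ht

/-- A function that does not depend on the entries from `T` on has the same law for all longer
sequences. -/
theorem prodSeq_bind_eq (d : α) (μ : PMF α) {T T' : ℕ} (hT : T ≤ T') (F : (ℕ → α) → PMF β)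
    (hF : ∀ ω t x, T ≤ t → F (Function.update ω t x) = F ω) :
    (prodSeq d μ T').bind F = (prodSeq d μ T).bind F := by
  induction T', hT using Nat.le_induction with
  | base => rfl
  | succ T' hT ih =>
    rw [prodSeq, PMF.bind_bind, ← ih]
    congr 1
    funext ω
    rw [PMF.bind_map]
    simp only [Function.comp_def, hF ω T' _ hT, PMF.bind_const]

section Missed

variable {Ω : Type*} {n : ℕ}

/-- The factor `exp (1 / n)` compensates the probability `1 - 1 / n ≤ exp (-1 / n)` of missing `i`.
-/
theorem ex_uniform_le [NeZero n] (i : Fin n) :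
    (PMF.uniformOfFintype (Fin n)).ex
      (fun x => if x = i then 0 else ENNReal.ofReal (Real.exp (1 / n))) ≤ 1 := by
  rw [ex_fintype]
  simp only [PMF.uniformOfFintype_apply, Fintype.card_fin]
  rw [← mul_sum, sum_ite, sum_const_zero, zero_add, sum_const, filter_ne', card_erase_of_mem
    (mem_univ _), card_univ, Fintype.card_fin, nsmul_eq_mul, ENNReal.inv_mul_le_iff
    (by exact_mod_cast NeZero.ne n) (ENNReal.natCast_ne_top n), mul_one,
    ← ENNReal.ofReal_natCast, ← ENNReal.ofReal_natCast, ← ENNReal.ofReal_mul (by positivity)]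
  refine ENNReal.ofReal_le_ofReal ?_
  have hn : (0 : ℝ) < n := by exact_mod_cast Nat.pos_of_neZero n
  rw [Nat.cast_sub (Nat.pos_of_neZero n), Nat.cast_one]
  have h1 : 1 - 1 / (n : ℝ) ≤ Real.exp (-(1 / n)) := by
    have := Real.add_one_le_exp (-(1 / (n : ℝ)))
    linarith
  have h2 : ((n : ℝ) - 1) = n * (1 - 1 / n) := by field_simp
  have h3 := mul_le_mul_of_nonneg_right (mul_le_mul_of_nonneg_left h1 hn.le)
    (Real.exp_pos (1 / (n : ℝ))).le
  rw [h2]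
  refine h3.trans (le_of_eq ?_)
  rw [mul_assoc, ← Real.exp_add, neg_add_cancel, Real.exp_zero, mul_one]

open Classical in
/-- When in each slot `s` a uniform expert `hit s` is drawn, independently of whether the slot is
bad, then it is unlikely that the expert `i` is missed in `m` bad slots. -/
theorem measure_missed_le [NeZero n] (p : PMF Ω) (R : ℕ → Ω → Fin n → Ω) (bad : ℕ → Ω → Prop)
    (hit : ℕ → Ω → Fin n) (i : Fin n) (m H : ℕ)
    (hinv : ∀ s < H,
      (p.bind fun ω => (PMF.uniformOfFintype (Fin n)).map (R s ω)) = p)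
    (hbad : ∀ s < H, ∀ s' ≤ s, ∀ ω x, bad s' (R s ω x) ↔ bad s' ω)
    (hhit : ∀ s < H, ∀ s' < s, ∀ ω x, hit s' (R s ω x) = hit s' ω)
    (hhit' : ∀ s < H, ∀ ω x, hit s (R s ω x) = x) :
    p.toOuterMeasure {ω | (∀ s < H, bad s ω → hit s ω ≠ i) ∧
      m ≤ ((range H).filter fun s => bad s ω).card} ≤
        ENNReal.ofReal (Real.exp (-(m / n))) := by
  set c : ℝ≥0∞ := ENNReal.ofReal (Real.exp (1 / n)) with hc
  have hc1 : 1 ≤ c := by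
    rw [hc, ENNReal.one_le_ofReal]
    exact Real.one_le_exp (by positivity)
  -- The partial products of `φ` behave like a supermartingale: in a bad slot a hit kills the
  -- product and a miss multiplies it by `c`; other slots leave it alone.
  set φ : ℕ → Ω → ℝ≥0∞ := fun s ω => if bad s ω then (if hit s ω = i then 0 else c) else 1
    with hφ
  have hex : ∀ h ≤ H, p.ex (fun ω => ∏ s ∈ range h, φ s ω) ≤ 1 := by
    intro h
    induction h with
    | zero => intro _; simp [ex_const]
    | succ h ih =>
      intro hh
      refine le_trans ?_ (ih (by omega))
      -- Resampling makes the draw of slot `h` fresh, while the earlier factors and the badness of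
      -- slot `h` itself stay fixed. Invariance of `p` replaces an independence statement.
      conv_lhs => rw [← hinv h hh]
      rw [ex_bind]
      refine ex_mono _ fun ω => ?_
      rw [ex_map]
      have h1 : ∀ x, ∏ s ∈ range (h + 1), φ s (R h ω x) = (∏ s ∈ range h, φ s ω) *
          (if bad h ω then (if x = i then 0 else c) else 1) := by
        intro x
        rw [prod_range_succ]
        congr 1
        · refine prod_congr rfl fun s hs => ?_
          rw [mem_range] at hs
          simp only [hφ, hbad h hh s hs.le, hhit h hh s hs]
        · simp only [hφ, hbad h hh h le_rfl, hhit' h hh]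
      simp only [h1, ex_const_mul]
      refine mul_le_of_le_one_right zero_le ?_
      by_cases hb : bad h ω
      · simp only [hb, if_true]
        exact ex_uniform_le i
      · simp only [hb, if_false, ex_const, le_refl]
  -- Markov's inequality: on the event, the product is at least `c ^ m`.
  have hind : p.ex (fun ω => c ^ m * ({ω | (∀ s < H, bad s ω → hit s ω ≠ i) ∧
      m ≤ ((range H).filter fun s => bad s ω).card} : Set Ω).indicator 1 ω) ≤ 1 := by
    refine (ex_mono p fun ω => ?_).trans (hex H le_rfl)
    by_cases hω : (∀ s < H, bad s ω → hit s ω ≠ i) ∧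
      m ≤ ((range H).filter fun s => bad s ω).card
    · rw [Set.indicator_of_mem (by exact hω), Pi.one_apply, mul_one]
      have h1 : ∏ s ∈ range H, φ s ω = ∏ s ∈ range H, if bad s ω then c else 1 := by
        refine prod_congr rfl fun s hs => ?_
        simp only [hφ]
        split_ifs with h1 h2
        · exact absurd h2 (hω.1 s (mem_range.1 hs) h1)
        · rfl
        · rfl
      rw [h1, prod_ite, prod_const, prod_const_one, mul_one]
      exact pow_le_pow_right₀ hc1 hω.2
    · rw [Set.indicator_of_notMem (by exact hω), mul_zero]
      exact zero_le
  rw [ex_const_mul, ← toOuterMeasure_eq_ex] at hind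
  have hcm : c ^ m * ENNReal.ofReal (Real.exp (-(m / n))) = 1 := by
    rw [hc, ← ENNReal.ofReal_pow (Real.exp_pos _).le, ← Real.exp_nat_mul,
      ← ENNReal.ofReal_mul (Real.exp_pos _).le, ← Real.exp_add]
    rw [mul_one_div, add_neg_cancel, Real.exp_zero, ENNReal.ofReal_one]
  calc _ = ENNReal.ofReal (Real.exp (-(m / n))) * (c ^ m * _) := by
        rw [← mul_assoc, mul_comm _ (c ^ m), hcm, one_mul]
    _ ≤ _ := mul_le_of_le_one_right zero_le hind

end Missed

end PMF

namespace Hierarchy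

variable {n : ℕ} {P : Hierarchy n} {ℓ : ℕ → Fin n → ℤ}

/-- The losses of level `k` only depend on the entrants of the lower levels. -/
theorem loss_congr_lower {ω ω' : ℕ → ℕ → Fin n} {k : ℕ} (h : ∀ t, ∀ j < k, ω t j = ω' t j) :
    P.loss ℓ ω k = P.loss ℓ ω' k := by
  induction k with
  | zero => rfl
  | succ k ih =>
    have h1 : (fun t => ω t k) = fun t => ω' t k := funext fun t => h t k (by omega)
    funext τ
    simp only [loss]
    rw [ih fun t j hj => h t j (by omega), h1]

/-- Badness may look at future losses, which are fixed, and at all draws of lower levels, but on its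
own level only at earlier draws of the run. -/
theorem bad_congr {ω ω' : ℕ → ℕ → Fin n} {k r s : ℕ} {i : Fin n}
    (h : ∀ t, ∀ j < k, ω t j = ω' t j)
    (h' : ∀ x < s, P.newcomer k ω r x = P.newcomer k ω' r x) :
    P.Bad k ℓ ω i r s ↔ P.Bad k ℓ ω' i r s := by
  have h'' : ∀ x < s, P.entrant k (fun t => ω t k) r x = P.entrant k (fun t => ω' t k) r x := h'
  rw [Bad, Bad, loss_congr_lower h, runBench, runBench, bench_congr h'']

/-- The law of the entrants of all levels. -/
noncomputable def seedLaw (i₀ : Fin n) [NeZero n] (K : ℕ) : PMF (ℕ → Fin n) :=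
  PMF.prodSeq i₀ (PMF.uniformOfFintype (Fin n)) K

/-- Redraw the level-`k` entry of the seed at the start of slot `s`: this preserves the law and
affects neither lower levels nor the other newcomers of the run, whose start times are distinct
because `0 < P.D k`. -/
theorem measure_missed_le [NeZero n] {k K T : ℕ} (hk : k < K) (hD : 0 < P.D k) {r : ℕ}
    (hr : (r + 1) * (P.D k * P.B) ≤ T) {H : ℕ} (hH : H ≤ P.B) (i i₀ : Fin n) (m : ℕ) :
    (PMF.prodSeq (fun _ => i₀) (seedLaw i₀ K) T).toOuterMeasure
      {ω | P.Missed k ℓ i r m H ω} ≤ ENNReal.ofReal (Real.exp (-(m / n))) := by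
  have hne : ∀ s s', s' < s → (r * P.B + s') * P.D k ≠ (r * P.B + s) * P.D k := by
    intro s s' h h1
    have := Nat.eq_of_mul_eq_mul_right hD h1
    omega
  have hcoord : ∀ s s' (ω : ℕ → ℕ → Fin n) x, s' < s →
      P.newcomer k (Function.update ω ((r * P.B + s) * P.D k)
        (Function.update (ω ((r * P.B + s) * P.D k)) k x)) r s' = P.newcomer k ω r s' := by
    intro s s' ω x h
    rw [newcomer, Function.update_of_ne (hne s s' h), newcomer]
  refine PMF.measure_missed_le (n := n) _
    (fun s (ω : ℕ → ℕ → Fin n) x => Function.update ω ((r * P.B + s) * P.D k)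
    (Function.update (ω ((r * P.B + s) * P.D k)) k x)) (fun s ω => P.Bad k ℓ ω i r s)
    (fun s ω => P.newcomer k ω r s) i m H (fun s hs => ?_) (fun s hs s' hs' ω x => ?_)
    (fun s hs s' hs' ω x => hcoord s s' ω x hs') (fun s hs ω x => ?_)
  · have h1 : (r * P.B + s) * P.D k < T := by
      refine lt_of_lt_of_le ?_ hr
      rw [mul_comm (P.D k), ← mul_assoc]
      refine Nat.mul_lt_mul_of_pos_right ?_ hD
      rw [add_mul]
      omega
    have := PMF.prodSeq_resample (fun _ => i₀) (seedLaw i₀ K)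
      (fun y => (PMF.uniformOfFintype (Fin n)).map (Function.update y k))
      (PMF.prodSeq_update _ _ hk) h1
    simpa only [PMF.map_comp, Function.comp_def] using this
  · refine bad_congr (fun t j hj => ?_) fun y hy => hcoord s y ω x (by omega)
    by_cases ht : t = (r * P.B + s) * P.D k
    · subst ht
      rw [Function.update_self, Function.update_of_ne hj.ne]
    · rw [Function.update_of_ne ht]
  · rw [newcomer, Function.update_self, Function.update_self]

end Hierarchy

/-! ### Strategies and their implementation with little memory -/

/-- Functions with at most `m` non-default values lie in a small finite set. -/
theorem exists_finset_sparse {α β : Type*} (A : Finset α) (Y : Finset β) (d : β) (m : ℕ) :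
    ∃ F : Finset (α → β), F.card ≤ (A.card * Y.card + 1) ^ m ∧
      ∀ (f : α → β) (s : Finset α), s ⊆ A → s.card ≤ m → (∀ a ∈ s, f a ∈ Y) →
        (∀ a ∉ s, f a = d) → f ∈ F := by
  classical
  -- A sparse function is coded by a list of at most `m` argument-value pairs, padded with `none`.
  let Φ : (Fin m → Option ↥(A ×ˢ Y)) → α → β := fun G a =>
    if h : ∃ y : ↥(A ×ˢ Y), (∃ j, G j = some y) ∧ y.1.1 = a then h.choose.1.2 else d
  refine ⟨univ.image Φ, ?_, fun f s hsA hsm hY hd => ?_⟩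
  · refine card_image_le.trans ?_
    rw [card_univ, Fintype.card_fun, Fintype.card_option, Fintype.card_coe, card_product,
      Fintype.card_fin]
  · let e : Fin s.card ≃ s := s.equivFin.symm
    have hmem : ∀ a : s, ((a : α), f a) ∈ A ×ˢ Y := fun a =>
      mem_product.2 ⟨hsA a.2, hY a a.2⟩
    let G : Fin m → Option ↥(A ×ˢ Y) := fun j => if h : (j : ℕ) < s.card then
      some ⟨((e ⟨j, h⟩ : α), f (e ⟨j, h⟩)), hmem _⟩ else none
    refine mem_image.2 ⟨G, mem_univ _, funext fun a => ?_⟩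
    by_cases h : ∃ y : ↥(A ×ˢ Y), (∃ j, G j = some y) ∧ y.1.1 = a
    · refine (dif_pos h).trans ?_
      obtain ⟨⟨j, hj⟩, h3⟩ := h.choose_spec
      generalize h.choose = y at hj h3
      simp only [G] at hj
      split_ifs at hj with h4
      rw [Option.some.injEq] at hj
      have h5 : y.1.2 = f y.1.1 := by rw [← hj]
      rw [h5, h3]
    · refine (dif_neg h).trans ?_
      by_contra hne
      have ha : a ∈ s := by
        by_contra ha
        exact hne (hd a ha).symm
      refine h ⟨⟨(a, f a), hmem ⟨a, ha⟩⟩,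
        ⟨⟨e.symm ⟨a, ha⟩, (e.symm ⟨a, ha⟩).2.trans_le hsm⟩, ?_⟩, rfl⟩
      simp [G]

/-- The law of independent draws with laws `q 0, …, q (T - 1)`. -/
noncomputable def independentPlays {n : ℕ} (q : ℕ → PMF (Fin n)) : (T : ℕ) → PMF (Fin T → Fin n)
  | 0 => PMF.pure Fin.elim0
  | T + 1 => (independentPlays q T).bind fun d =>
      (q T).map fun i => Fin.snoc (α := fun _ => Fin n) d i

theorem independentPlays_congr {n : ℕ} {q q' : ℕ → PMF (Fin n)} {T : ℕ}
    (h : ∀ t < T, q t = q' t) : independentPlays q T = independentPlays q' T := by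
  induction T with
  | zero => rfl
  | succ T ih => rw [independentPlays, ih fun t ht => h t (by omega), h T (by omega)]; rfl

/-- An integer valued loss sequence with values between `0` and `N`. -/
def GridLoss {n : ℕ} (N : ℕ) (ℓ : ℕ → Fin n → ℤ) : Prop := ∀ t i, 0 ≤ ℓ t i ∧ ℓ t i ≤ N

/-- The loss sequence rounded down to multiples of `1 / N`, and continued by `0`. -/
noncomputable def roundLoss {n T : ℕ} (N : ℕ) (ℓ : Fin T → Fin n → ℝ) (t : ℕ) (i : Fin n) : ℤ :=
  if h : t < T then ⌊(N : ℝ) * ℓ ⟨t, h⟩ i⌋ else 0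

theorem gridLoss_roundLoss {n T : ℕ} (N : ℕ) {ℓ : Fin T → Fin n → ℝ}
    (hℓ : ∀ t i, ℓ t i ∈ Set.Icc (0 : ℝ) 1) : GridLoss N (roundLoss N ℓ) := by
  intro t i
  unfold roundLoss
  split_ifs with h
  · have h1 := hℓ ⟨t, h⟩ i
    refine ⟨Int.floor_nonneg.2 (mul_nonneg (Nat.cast_nonneg _) h1.1), ?_⟩
    have h2 : (N : ℝ) * ℓ ⟨t, h⟩ i ≤ N := mul_le_of_le_one_right (Nat.cast_nonneg _) h1.2
    exact_mod_cast (Int.floor_le _).trans h2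
  · exact ⟨le_rfl, by positivity⟩

/-- A randomized strategy for grid losses, given by its play distributions `play`, which depend on
a sequence of random seeds and on the past losses through a `view` that can be updated by reading
only the losses of the experts in `watch`. -/
structure Strategy (n N : ℕ) (Seed σ : Type) where
  /-- The information which is kept. -/
  view : (ℕ → Seed) → (ℕ → Fin n → ℤ) → ℕ → σ
  /-- The experts whose losses are read. -/
  watch : σ → Finset (Fin n)
  /-- The distribution of the expert that is played. -/
  play : (ℕ → Seed) → (ℕ → Fin n → ℤ) → ℕ → PMF (Fin n)
  view_zero : ∀ ω ω' ℓ ℓ', GridLoss N ℓ → GridLoss N ℓ' → ω 0 = ω' 0 →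
    view ω ℓ 0 = view ω' ℓ' 0
  view_succ : ∀ ω ω' ℓ ℓ', GridLoss N ℓ → GridLoss N ℓ' → ∀ t, view ω ℓ t = view ω' ℓ' t →
    ω (t + 1) = ω' (t + 1) → (∀ i ∈ watch (view ω ℓ t), ℓ t i = ℓ' t i) →
    view ω ℓ (t + 1) = view ω' ℓ' (t + 1)
  play_congr : ∀ ω ω' ℓ ℓ', GridLoss N ℓ → GridLoss N ℓ' → ∀ t, view ω ℓ t = view ω' ℓ' t →
    play ω ℓ t = play ω' ℓ' t

namespace Strategy

variable {n N : ℕ} {Seed σ : Type} (Q : Strategy n N Seed σ)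

theorem view_congr {ω ω' : ℕ → Seed} {ℓ : ℕ → Fin n → ℤ} (hℓ : GridLoss N ℓ) {t : ℕ}
    (h : ∀ s ≤ t, ω s = ω' s) : Q.view ω ℓ t = Q.view ω' ℓ t := by
  induction t with
  | zero => exact Q.view_zero _ _ _ _ hℓ hℓ (h 0 le_rfl)
  | succ t ih =>
    exact Q.view_succ _ _ _ _ hℓ hℓ t (ih fun s hs => h s (by omega)) (h _ le_rfl)
      fun _ _ => rfl

open Classical in
/-- The update of the view. -/
noncomputable def next (t : ℕ) (x : σ) (seed : Seed) (y : Fin n → ℤ) : σ :=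
  -- By `view_succ` any history compatible with these data yields the same next view; the fallback
  -- `x` is not reached on grid losses (`next_eq`).
  if h : ∃ p : (ℕ → Seed) × (ℕ → Fin n → ℤ), GridLoss N p.2 ∧ Q.view p.1 p.2 t = x ∧
      p.1 (t + 1) = seed ∧ ∀ i ∈ Q.watch x, p.2 t i = y i
  then Q.view h.choose.1 h.choose.2 (t + 1) else x

theorem next_eq {ω : ℕ → Seed} {ℓ : ℕ → Fin n → ℤ} (hℓ : GridLoss N ℓ) {t : ℕ}
    {y : Fin n → ℤ} (hy : ∀ i ∈ Q.watch (Q.view ω ℓ t), ℓ t i = y i) :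
    Q.next t (Q.view ω ℓ t) (ω (t + 1)) y = Q.view ω ℓ (t + 1) := by
  have h : ∃ p : (ℕ → Seed) × (ℕ → Fin n → ℤ), GridLoss N p.2 ∧
      Q.view p.1 p.2 t = Q.view ω ℓ t ∧ p.1 (t + 1) = ω (t + 1) ∧
      ∀ i ∈ Q.watch (Q.view ω ℓ t), p.2 t i = y i := ⟨(ω, ℓ), hℓ, rfl, rfl, hy⟩
  rw [next, dif_pos h]
  obtain ⟨h1, h2, h3, h4⟩ := h.choose_spec
  refine Q.view_succ _ _ _ _ h1 hℓ t h2 h3 fun i hi => ?_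
  rw [h2] at hi
  rw [h4 i hi, hy i hi]

open Classical in
/-- The distribution of the play, as a function of the view. -/
noncomputable def playOf [NeZero n] (t : ℕ) (x : σ) : PMF (Fin n) :=
  if h : ∃ p : (ℕ → Seed) × (ℕ → Fin n → ℤ), GridLoss N p.2 ∧ Q.view p.1 p.2 t = x
  then Q.play h.choose.1 h.choose.2 t else PMF.pure 0

theorem playOf_eq [NeZero n] {ω : ℕ → Seed} {ℓ : ℕ → Fin n → ℤ} (hℓ : GridLoss N ℓ) (t : ℕ) :
    Q.playOf t (Q.view ω ℓ t) = Q.play ω ℓ t := by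
  have h : ∃ p : (ℕ → Seed) × (ℕ → Fin n → ℤ), GridLoss N p.2 ∧
      Q.view p.1 p.2 t = Q.view ω ℓ t := ⟨(ω, ℓ), hℓ, rfl⟩
  rw [playOf, dif_pos h]
  exact Q.play_congr _ _ _ _ h.choose_spec.1 hℓ t h.choose_spec.2

section Implementation

variable [NeZero n] {S : ℕ} (d : Seed) (μ : PMF Seed)
  (enc : ℕ × σ × ℕ × (Fin n → ℤ) → Fin S → Bool) (dec : (Fin S → Bool) → ℕ × σ × ℕ × (Fin n → ℤ))

open Classical in
/-- The answers of the queries that have been made, for the experts of `W`. -/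
noncomputable def answers (W : Finset (Fin n)) (p : ℕ) (y : Fin n → ℤ) (i : Fin n) : ℤ :=
  if (i : ℕ) < p ∧ i ∈ W then y i else 0

open Classical in
/-- The online algorithm which plays a strategy. In each round it queries all experts in turn; its
memory consists of the time, the view, the expert that is queried next, and the answers. -/
noncomputable def implementation : OnlineAlgorithm n (Fin S → Bool) where
  init := μ.map fun seed => enc (0, Q.view (fun _ => seed) (fun _ _ => 0) 0, 0, fun _ => 0)
  play M := (Q.playOf (dec M).1 (dec M).2.1).map fun i => (i, M)
  queries := n
  query M := Fin.ofNat n (dec M).2.2.1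
  step M y :=
    if (dec M).2.2.1 + 1 < n then
      PMF.pure (enc ((dec M).1, (dec M).2.1, (dec M).2.2.1 + 1,
        if Fin.ofNat n (dec M).2.2.1 ∈ Q.watch (dec M).2.1
        then Function.update (dec M).2.2.2 (Fin.ofNat n (dec M).2.2.1) ⌊(N : ℝ) * y⌋
        else (dec M).2.2.2))
    else
      -- The last query ends the round: a fresh seed is drawn, the clock advances, and the query
      -- pointer and the answers are reset.
      μ.map fun seed => enc ((dec M).1 + 1, Q.next (dec M).1 (dec M).2.1 seed
        (if Fin.ofNat n (dec M).2.2.1 ∈ Q.watch (dec M).2.1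
        then Function.update (dec M).2.2.2 (Fin.ofNat n (dec M).2.2.1) ⌊(N : ℝ) * y⌋
        else (dec M).2.2.2), 0, fun _ => 0)

variable {enc dec}

theorem answers_succ (W : Finset (Fin n)) {p : ℕ} (hp : p < n) (y : Fin n → ℤ)
    [Decidable (Fin.ofNat n p ∈ W)] :
    (if Fin.ofNat n p ∈ W then Function.update (answers W p y) (Fin.ofNat n p) (y (Fin.ofNat n p))
      else answers W p y) = answers W (p + 1) y := by
  have hval : ((Fin.ofNat n p : Fin n) : ℕ) = p := Nat.mod_eq_of_lt hp
  have hi : ∀ i : Fin n, i ≠ Fin.ofNat n p → (i : ℕ) ≠ p := fun i hne h =>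
    hne (Fin.ext (h.trans hval.symm))
  split_ifs with h
  · funext i
    by_cases hip : i = Fin.ofNat n p
    · subst hip
      rw [Function.update_self, answers, if_pos ⟨by omega, h⟩]
    · have := hi i hip
      have h1 : (i : ℕ) < p ↔ (i : ℕ) < p + 1 := by omega
      simp only [Function.update_of_ne hip, answers, h1]
  · funext i
    by_cases hip : i = Fin.ofNat n p
    · subst hip
      rw [answers, answers, if_neg (fun h1 => h h1.2), if_neg (fun h1 => h h1.2)]
    · have := hi i hip
      have h1 : (i : ℕ) < p ↔ (i : ℕ) < p + 1 := by omega
      simp only [answers, h1]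

/-- Induction on the number `q` of remaining queries; every query but the last only records an
answer if the expert is watched. -/
theorem update_implementation {ω : ℕ → Seed} {ℓ : ℕ → Fin n → ℤ} {t : ℕ} {v : Fin n → ℝ}
    (hv : ∀ i, ⌊(N : ℝ) * v i⌋ = ℓ t i)
    (hdec : ∀ p < n, dec (enc (t, Q.view ω ℓ t, p, answers (Q.watch (Q.view ω ℓ t)) p (ℓ t))) =
      (t, Q.view ω ℓ t, p, answers (Q.watch (Q.view ω ℓ t)) p (ℓ t))) (q p : ℕ)
    (hpq : p + q = n) (hq : 0 < q) :
    (Q.implementation μ enc dec).update v q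
      (enc (t, Q.view ω ℓ t, p, answers (Q.watch (Q.view ω ℓ t)) p (ℓ t))) =
    μ.map fun seed => enc (t + 1, Q.next t (Q.view ω ℓ t) seed
      (answers (Q.watch (Q.view ω ℓ t)) n (ℓ t)), 0, fun _ => 0) := by
  induction q generalizing p with
  | zero => omega
  | succ q ih =>
    rw [OnlineAlgorithm.update]
    simp only [implementation, hdec p (by omega), hv,
      answers_succ (Q.watch (Q.view ω ℓ t)) (show p < n by omega) (ℓ t)]
    by_cases h : p + 1 < n
    · rw [if_pos h, PMF.pure_bind]
      exact ih (p + 1) (by omega) (by omega)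
    · rw [if_neg h]
      obtain rfl : q = 0 := by omega
      obtain rfl : p + 1 = n := by omega
      exact PMF.bind_pure _

/-- The view at time `t` ignores later seeds, so the seed drawn at the end of a round simply extends
the product law. Only codes of states that actually occur have to be decoded correctly. -/
theorem run_implementation {T : ℕ} (ℓ : ℕ → Fin n → ℝ) {ℓ' : ℕ → Fin n → ℤ}
    (hℓ' : GridLoss N ℓ') (hv : ∀ t < T, ∀ i, ⌊(N : ℝ) * ℓ t i⌋ = ℓ' t i)
    (hdec : ∀ ω, ∀ t ≤ T, ∀ p < n,
      dec (enc (t, Q.view ω ℓ' t, p, answers (Q.watch (Q.view ω ℓ' t)) p (ℓ' t))) =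
        (t, Q.view ω ℓ' t, p, answers (Q.watch (Q.view ω ℓ' t)) p (ℓ' t))) :
    ∀ t ≤ T, (Q.implementation μ enc dec).run t (fun s => ℓ s) =
      (PMF.prodSeq d μ (t + 1)).bind fun ω => (independentPlays (Q.play ω ℓ') t).map fun x =>
        (enc (t, Q.view ω ℓ' t, 0, fun _ => 0), x) := by
  have hans : ∀ ω t, answers (Q.watch (Q.view ω ℓ' t)) 0 (ℓ' t) = fun _ => 0 := fun ω t =>
    funext fun i => if_neg fun h => absurd h.1 (Nat.not_lt_zero _)
  intro t
  induction t with
  | zero =>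
    intro _
    have h1 : ∀ seed, Q.view (Function.update (fun _ => d) 0 seed) ℓ' 0 =
        Q.view (fun _ => seed) (fun _ _ => 0) 0 := fun seed =>
      Q.view_zero _ _ _ _ hℓ' (fun _ _ => ⟨le_rfl, by positivity⟩) (by simp)
    simp only [OnlineAlgorithm.run, PMF.prodSeq, PMF.pure_bind, PMF.bind_map,
      independentPlays, PMF.pure_map, Function.comp_def, h1]
    rw [implementation]
    simp only [PMF.map_comp, Function.comp_def]
    rw [← PMF.bind_pure_comp]
    rfl
  | succ t ih =>
    intro ht
    rw [OnlineAlgorithm.run]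
    have h2 := ih (by omega)
    have h3 : (fun s : Fin t => (fun s : Fin (t + 1) => ℓ s) s.castSucc) = fun s : Fin t => ℓ s :=
      rfl
    rw [h3, h2, PMF.bind_bind]
    conv_rhs => rw [PMF.prodSeq, PMF.bind_bind]
    congr 1
    funext ω
    have hview : ∀ seed, ∀ s ≤ t, Q.view (Function.update ω (t + 1) seed) ℓ' s = Q.view ω ℓ' s :=
      fun seed s hs => Q.view_congr hℓ' fun s' hs' => Function.update_of_ne (by omega) _ _
    have hplay : ∀ seed, ∀ s ≤ t,
        Q.play (Function.update ω (t + 1) seed) ℓ' s = Q.play ω ℓ' s := fun seed s hs =>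
      Q.play_congr _ _ _ _ hℓ' hℓ' s (hview seed s hs)
    have hplays : ∀ seed, independentPlays (Q.play (Function.update ω (t + 1) seed) ℓ') t =
        independentPlays (Q.play ω ℓ') t := fun seed =>
      independentPlays_congr fun s hs => hplay seed s hs.le
    have hnext : ∀ seed, Q.view (Function.update ω (t + 1) seed) ℓ' (t + 1) =
        Q.next t (Q.view ω ℓ' t) seed (answers (Q.watch (Q.view ω ℓ' t)) n (ℓ' t)) := by
      intro seed
      have := Q.next_eq (ω := Function.update ω (t + 1) seed) hℓ' (t := t)
        (y := answers (Q.watch (Q.view ω ℓ' t)) n (ℓ' t)) (fun i hi => by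
          rw [hview seed t le_rfl] at hi
          rw [answers, if_pos ⟨i.2, hi⟩])
      rw [← this, hview seed t le_rfl, Function.update_self]
    have hupd := Q.update_implementation μ (ω := ω) (v := ℓ t) (hv t (by omega))
      (hdec ω t (by omega)) n 0 (by omega) (Nat.pos_of_neZero n)
    have hdec0 := hdec ω t (by omega) 0 (Nat.pos_of_neZero n)
    rw [hans] at hupd hdec0
    have hplayM : (Q.implementation μ enc dec).play (enc (t, Q.view ω ℓ' t, 0, fun _ => 0)) =
        (Q.play ω ℓ' t).map fun i => (i, enc (t, Q.view ω ℓ' t, 0, fun _ => 0)) := by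
      simp only [implementation, hdec0, Q.playOf_eq hℓ']
    have hq : (Q.implementation μ enc dec).queries = n := rfl
    simp only [PMF.bind_map, Function.comp_def, hplayM, hnext, Fin.val_last, hq, hupd,
      independentPlays, PMF.map_bind, PMF.map_comp, hplays, hplay _ t le_rfl]
    -- The algorithm plays before it draws the next seed, the product law draws the seed first; the
    -- two draws commute.
    rw [PMF.bind_comm μ]
    refine congrArg _ (funext fun x => ?_)
    simp only [← PMF.bind_pure_comp, Function.comp_def]
    rw [PMF.bind_comm]

end Implementation

/-- A strategy whose view takes few values on the time interval of interest can be implemented with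
little memory. -/
theorem exists_implementation [NeZero n] (d : Seed) (μ : PMF Seed) {T m S : ℕ} (I : Finset σ)
    (hI : ∀ ω ℓ, GridLoss N ℓ → ∀ t ≤ T, Q.view ω ℓ t ∈ I)
    (hm : ∀ ω ℓ, GridLoss N ℓ → ∀ t ≤ T, (Q.watch (Q.view ω ℓ t)).card ≤ m)
    (hS : (T + 1) * (I.card * (n * (n * (N + 1) + 1) ^ m)) ≤ 2 ^ S) :
    ∃ A : OnlineAlgorithm n (Fin S → Bool), ∀ ℓ : Fin T → Fin n → ℝ,
      (∀ t i, ℓ t i ∈ Set.Icc (0 : ℝ) 1) →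
        A.decisions ℓ = (PMF.prodSeq d μ (T + 1)).bind fun ω =>
          independentPlays (Q.play ω (roundLoss N ℓ)) T := by
  classical
  obtain ⟨F, hFcard, hF⟩ := exists_finset_sparse (univ : Finset (Fin n)) (Icc (0 : ℤ) N) 0 m
  let Z : Finset (ℕ × σ × ℕ × (Fin n → ℤ)) := range (T + 1) ×ˢ I ×ˢ range n ×ˢ F
  have hZ : Fintype.card Z ≤ Fintype.card (Fin S → Bool) := by
    rw [Fintype.card_coe, Fintype.card_fun, Fintype.card_bool, Fintype.card_fin]
    simp only [Z, card_product, card_range]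
    refine le_trans ?_ hS
    rw [card_univ, Fintype.card_fin, Int.card_Icc, sub_zero,
      show ((N : ℤ) + 1).toNat = N + 1 by omega] at hFcard
    gcongr
  obtain ⟨emb⟩ := Function.Embedding.nonempty_of_card_le hZ
  let enc : ℕ × σ × ℕ × (Fin n → ℤ) → Fin S → Bool := fun z =>
    if h : z ∈ Z then emb ⟨z, h⟩ else fun _ => false
  let z₀ : ℕ × σ × ℕ × (Fin n → ℤ) :=
    (0, Q.view (fun _ => d) (fun _ _ => 0) 0, 0, fun _ => 0)
  let dec : (Fin S → Bool) → ℕ × σ × ℕ × (Fin n → ℤ) := fun M =>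
    if h : ∃ z : Z, emb z = M then h.choose.1 else z₀
  have hdec : ∀ z ∈ Z, dec (enc z) = z := by
    intro z hz
    have h : ∃ z' : Z, emb z' = enc z := ⟨⟨z, hz⟩, by simp only [enc, dif_pos hz]⟩
    simp only [dec]
    rw [dif_pos h]
    have h1 : emb h.choose = emb ⟨z, hz⟩ := h.choose_spec.trans (dif_pos hz)
    exact congrArg Subtype.val (emb.injective h1)
  refine ⟨Q.implementation μ enc dec, fun ℓ hℓ => ?_⟩
  have hgrid := gridLoss_roundLoss N hℓ
  have hrun := Q.run_implementation d μ (enc := enc) (dec := dec) (T := T)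
    (fun t i => if h : t < T then ℓ ⟨t, h⟩ i else 0) hgrid
    (fun t ht i => by simp only [roundLoss, dif_pos ht])
    (fun ω t ht p hp => hdec _ (by
      simp only [Z, mem_product, mem_range]
      refine ⟨by omega, hI ω _ hgrid t ht, hp, hF _ (Q.watch (Q.view ω (roundLoss N ℓ) t))
        (subset_univ _) (hm ω _ hgrid t ht) (fun i _ => ?_) fun i hi => ?_⟩
      · rw [answers]
        split_ifs
        · exact mem_Icc.2 (hgrid t i)
        · exact mem_Icc.2 ⟨le_rfl, by positivity⟩
      · rw [answers, if_neg fun h => hi h.2])) T le_rfl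
  have hℓ' : (fun s : Fin T => fun i => if h : (s : ℕ) < T then ℓ ⟨s, h⟩ i else 0) = ℓ := by
    funext s i
    rw [dif_pos s.2]
  rw [OnlineAlgorithm.decisions, ← hℓ', hrun, PMF.map_bind, hℓ']
  simp only [PMF.map_comp, Function.comp_def]
  exact congrArg _ (funext fun ω => PMF.map_id _)

end Strategy

/-! ### The information kept by the hierarchy -/

theorem partSum_nonneg {D : ℕ} {f : ℕ → ℤ} (h : ∀ t, 0 ≤ f t) (τ : ℕ) : 0 ≤ partSum D f τ :=
  sum_nonneg fun _ _ => h _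

theorem partSum_le {D N : ℕ} (hD : 0 < D) {f : ℕ → ℤ} (h : ∀ t, f t ≤ N) (τ : ℕ) :
    partSum D f τ ≤ (N * D : ℕ) := by
  refine (sum_le_card_nsmul _ _ (N : ℤ) fun x _ => h _).trans ?_
  rw [card_range, nsmul_eq_mul, mul_comm]
  have := Nat.mul_le_mul_left N (Nat.mod_lt τ hD).le
  exact_mod_cast this

theorem partSum_add_one_of_mod_ne {D : ℕ} (f : ℕ → ℤ) {τ : ℕ} (hdiv : (τ + 1) / D = τ / D)
    (hmod : (τ + 1) % D = τ % D + 1) : partSum D f (τ + 1) = partSum D f τ + f τ := by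
  rw [partSum, partSum, hdiv, hmod, sum_range_succ, Nat.div_add_mod']

theorem partSum_eq_zero {D : ℕ} (f : ℕ → ℤ) {τ : ℕ} (hmod : τ % D = 0) :
    partSum D f τ = 0 := by
  rw [partSum, hmod, range_zero, sum_empty]

theorem slotSum_eq_partSum_add {D : ℕ} (f : ℕ → ℤ) {τ : ℕ} (hmod : τ % D + 1 = D) :
    slotSum D f (τ / D) = partSum D f τ + f τ := by
  rw [slotSum, partSum]
  conv_lhs => rw [← hmod, sum_range_succ]
  rw [hmod, Nat.div_add_mod']

namespace Hierarchy

variable {n : ℕ} (P : Hierarchy n) (k : ℕ) (b : ℕ → ℤ) (ℓ : ℕ → Fin n → ℤ) (ω : ℕ → Fin n)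

/-- The cumulative gain over the benchmark of the expert which entered in slot `s`. -/
noncomputable def gain (r s u : ℕ) : ℤ :=
  ∑ x ∈ Ico s u, (P.runBench k b ℓ ω r s x - P.slotLoss k b ℓ r x (P.entrant k ω r s))

open Classical in
/-- The information that level `k` keeps. -/
noncomputable def levelView (τ : ℕ) : (ℕ → Option (Fin n × ℤ × ℤ)) × ℤ :=
  (fun s => if s ∈ P.runPool k b ℓ ω (P.runOf k τ) (P.slotOf k τ) then
      some (P.entrant k ω (P.runOf k τ) s, P.gain k b ℓ ω (P.runOf k τ) s (P.slotOf k τ),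
        P.past k b ℓ ω τ (some s))
    else none,
  P.past k b ℓ ω τ none)

variable {P k b ℓ ω}

theorem levelView_eq_iff {b' : ℕ → ℤ} {ℓ' : ℕ → Fin n → ℤ} {ω' : ℕ → Fin n} {τ : ℕ} :
    P.levelView k b ℓ ω τ = P.levelView k b' ℓ' ω' τ ↔
      P.past k b ℓ ω τ none = P.past k b' ℓ' ω' τ none ∧ ∀ s,
        (s ∈ P.runPool k b ℓ ω (P.runOf k τ) (P.slotOf k τ) ↔
          s ∈ P.runPool k b' ℓ' ω' (P.runOf k τ) (P.slotOf k τ)) ∧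
        (s ∈ P.runPool k b ℓ ω (P.runOf k τ) (P.slotOf k τ) →
          P.entrant k ω (P.runOf k τ) s = P.entrant k ω' (P.runOf k τ) s ∧
          P.gain k b ℓ ω (P.runOf k τ) s (P.slotOf k τ) =
            P.gain k b' ℓ' ω' (P.runOf k τ) s (P.slotOf k τ) ∧
          P.past k b ℓ ω τ (some s) = P.past k b' ℓ' ω' τ (some s)) := by
  rw [levelView, levelView, Prod.mk.injEq, funext_iff, and_comm]
  refine and_congr_right fun _ => forall_congr' fun s => ?_
  by_cases h1 : s ∈ P.runPool k b ℓ ω (P.runOf k τ) (P.slotOf k τ) <;>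
  by_cases h2 : s ∈ P.runPool k b' ℓ' ω' (P.runOf k τ) (P.slotOf k τ) <;>
  simp [h1, h2]

/-- The weights depend only on the pool and on the partial sums of the current slot, and the view
records both. -/
theorem mix_congr {b' : ℕ → ℤ} {ℓ' : ℕ → Fin n → ℤ} {ω' : ℕ → Fin n} {τ : ℕ} {y y' : ℝ}
    {z z' : Fin n → ℝ} (h : P.levelView k b ℓ ω τ = P.levelView k b' ℓ' ω' τ) (hy : y = y')
    (hz : ∀ s ∈ P.runPool k b ℓ ω (P.runOf k τ) (P.slotOf k τ),
      z (P.entrant k ω (P.runOf k τ) s) = z' (P.entrant k ω (P.runOf k τ) s)) :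
    P.mix k b ℓ ω τ y z = P.mix k b' ℓ' ω' τ y' z' := by
  obtain ⟨h1, h2⟩ := levelView_eq_iff.1 h
  have hpool : P.runPool k b ℓ ω (P.runOf k τ) (P.slotOf k τ) =
      P.runPool k b' ℓ' ω' (P.runOf k τ) (P.slotOf k τ) := Finset.ext fun s => (h2 s).1
  rw [mix, mix, ← hpool]
  refine hedgeMix_congr (fun o ho => ?_) fun o ho => ?_
  · cases o with
    | none => exact congrArg _ h1
    | some s => exact congrArg _ ((h2 s).2 (some_mem_insertNone.1 ho)).2.2
  · cases o with
    | none => exact hy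
    | some s =>
      have h3 := some_mem_insertNone.1 ho
      exact (hz s h3).trans (congrArg z' ((h2 s).2 h3).1)

/-- What level `k` keeps can be updated by means of the losses of its base and its pool. -/
theorem levelView_succ {b' : ℕ → ℤ} {ℓ' : ℕ → Fin n → ℤ} {ω' : ℕ → Fin n} {τ : ℕ}
    (hB : 0 < P.B) (h : P.levelView k b ℓ ω τ = P.levelView k b' ℓ' ω' τ) (hb : b τ = b' τ)
    (hℓ : ∀ s ∈ P.runPool k b ℓ ω (P.runOf k τ) (P.slotOf k τ),
      ℓ τ (P.entrant k ω (P.runOf k τ) s) = ℓ' τ (P.entrant k ω (P.runOf k τ) s))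
    (hω : ω (τ + 1) = ω' (τ + 1)) :
    P.levelView k b ℓ ω (τ + 1) = P.levelView k b' ℓ' ω' (τ + 1) := by
  obtain ⟨h1, h2⟩ := levelView_eq_iff.1 h
  rw [levelView_eq_iff]
  -- The pool changes only when a slot ends; inside a slot only the partial sums grow.
  by_cases hmod : (τ + 1) % P.D k = 0
  · have hdiv : (τ + 1) / P.D k = τ / P.D k + 1 := by
      rw [Nat.succ_div, if_pos (Nat.dvd_of_mod_eq_zero hmod)]
    have hmod' : τ % P.D k + 1 = P.D k := by
      have e1 := Nat.div_add_mod (τ + 1) (P.D k)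
      have e2 := Nat.div_add_mod τ (P.D k)
      rw [hmod, hdiv, Nat.mul_add] at e1
      omega
    have hnew : ((τ + 1) / P.D k) * P.D k = τ + 1 :=
      Nat.div_mul_cancel (Nat.dvd_of_mod_eq_zero hmod)
    refine ⟨?_, ?_⟩
    · simp only [past, partSum_eq_zero _ hmod]
    have hpast : ∀ s, P.past k b ℓ ω (τ + 1) (some s) = P.past k b' ℓ' ω' (τ + 1) (some s) :=
      fun s => by simp only [past, partSum_eq_zero _ hmod]
    have hrs : P.runOf k (τ + 1) * P.B + P.slotOf k (τ + 1) = (τ + 1) / P.D k := by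
      rw [runOf, slotOf, Nat.div_add_mod']
    have hent : P.entrant k ω (P.runOf k (τ + 1)) (P.slotOf k (τ + 1)) =
        P.entrant k ω' (P.runOf k (τ + 1)) (P.slotOf k (τ + 1)) := by
      rw [entrant, entrant, hrs, hnew, hω]
    have hself : ∀ (b : ℕ → ℤ) (ℓ : ℕ → Fin n → ℤ) (ω : ℕ → Fin n),
        P.slotOf k (τ + 1) ∈ P.runPool k b ℓ ω (P.runOf k (τ + 1)) (P.slotOf k (τ + 1)) :=
      fun b ℓ ω => mem_pool.2 ⟨le_rfl, survives_self _ _ _⟩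
    have hgself : ∀ (b : ℕ → ℤ) (ℓ : ℕ → Fin n → ℤ) (ω : ℕ → Fin n),
        P.gain k b ℓ ω (P.runOf k (τ + 1)) (P.slotOf k (τ + 1)) (P.slotOf k (τ + 1)) = 0 :=
      fun b ℓ ω => by rw [gain, Ico_self, sum_empty]
    intro s
    -- The new entrant belongs to the pool whatever happened before, and its gain is an empty sum.
    rcases eq_or_ne s (P.slotOf k (τ + 1)) with rfl | hs
    · exact ⟨iff_of_true (hself ..) (hself ..), fun _ => ⟨hent, by rw [hgself, hgself], hpast _⟩⟩
    by_cases hlast : P.slotOf k τ + 1 < P.B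
    · have hτ : τ / P.D k = P.runOf k τ * P.B + P.slotOf k τ := by
        rw [runOf, slotOf, Nat.div_add_mod']
      have hτ' : (τ + 1) / P.D k = P.runOf k τ * P.B + (P.slotOf k τ + 1) := by
        rw [hdiv, hτ]; ring
      have hrun : P.runOf k (τ + 1) = P.runOf k τ := by
        rw [runOf, hτ', mul_add_div hlast]
      have hslot : P.slotOf k (τ + 1) = P.slotOf k τ + 1 := by
        rw [slotOf, hτ', mul_add_mod hlast]
      rw [hslot] at hs
      rw [hrun, hslot]
      set r := P.runOf k τ with hr
      set u := P.slotOf k τ with hu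
      have hbase : P.slotBase k b r u = P.slotBase k b' r u := by
        rw [slotBase, slotBase, ← hτ, slotSum_eq_partSum_add _ hmod',
          slotSum_eq_partSum_add _ hmod', hb]
        exact congrArg (· + b' τ) h1
      have hloss : ∀ s ∈ P.runPool k b ℓ ω r u,
          P.slotLoss k b ℓ r u (P.entrant k ω r s) =
            P.slotLoss k b' ℓ' r u (P.entrant k ω' r s) := by
        intro s hs
        obtain ⟨h3, -, h4⟩ := (h2 s).2 hs
        simp only [slotLoss, hbase]
        rw [← hτ, slotSum_eq_partSum_add _ hmod', slotSum_eq_partSum_add _ hmod']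
        simp only [past, ← hr] at h4
        rw [h4, hℓ s hs, h3]
      -- The benchmark of the slot just finished is rebuilt in order of entry: only survivors
      -- contribute, and their slot losses are known.
      have hbench : ∀ s ≤ u + 1, P.runBench k b ℓ ω r s u = P.runBench k b' ℓ' ω' r s u := by
        intro s
        induction s with
        | zero => intro _; exact hbase
        | succ s ih =>
          intro hsu
          have h3 := ih (by omega)
          have h4 := (h2 s).1
          simp only [runBench] at h3 ⊢
          rw [bench_succ, bench_succ]
          by_cases hmem : s ∈ P.runPool k b ℓ ω r u
          · rw [if_pos (mem_pool.1 hmem).2, if_pos (mem_pool.1 (h4.1 hmem)).2, h3, hloss s hmem]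
          · have hmem' := mt h4.2 hmem
            rw [runPool, mem_pool, not_and] at hmem hmem'
            rw [if_neg (hmem (by omega)), if_neg (hmem' (by omega)), h3]
      have hgain : ∀ s ∈ P.runPool k b ℓ ω r u,
          P.gain k b ℓ ω r s (u + 1) = P.gain k b' ℓ' ω' r s (u + 1) := by
        intro s hs
        have hsu := (mem_pool.1 hs).1
        have h3 := ((h2 s).2 hs).2.1
        rw [gain, gain, sum_Ico_succ_top hsu, sum_Ico_succ_top hsu, hbench s (by omega),
          hloss s hs]
        exact congrArg (· + _) h3
      -- Membership in the pool already certifies all shorter periods, so survival is decided by the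
      -- one new period, through the updated gain.
      have hiff : ∀ (b : ℕ → ℤ) (ℓ : ℕ → Fin n → ℤ) (ω : ℕ → Fin n),
          s ∈ P.runPool k b ℓ ω r (u + 1) ↔ s ∈ P.runPool k b ℓ ω r u ∧
            P.V k * (((u + 1 : ℕ) : ℤ) - s) ≤ P.g * P.gain k b ℓ ω r s (u + 1) := by
        intro b ℓ ω
        rw [runPool, runPool, mem_pool, mem_pool, gain]
        constructor
        · rintro ⟨h3, h4⟩
          have h5 : s ≤ u := by omega
          exact ⟨⟨h5, ((survives_succ_iff h5).1 h4).1⟩, ((survives_succ_iff h5).1 h4).2⟩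
        · rintro ⟨⟨h3, h4⟩, h5⟩
          exact ⟨by omega, (survives_succ_iff h3).2 ⟨h4, h5⟩⟩
      refine ⟨?_, fun h3 => ?_⟩
      · rw [hiff, hiff]
        constructor
        · rintro ⟨h3, h4⟩
          exact ⟨(h2 s).1.1 h3, by rwa [← hgain s h3]⟩
        · rintro ⟨h3, h4⟩
          have h5 := (h2 s).1.2 h3
          exact ⟨h5, by rwa [hgain s h5]⟩
      · have h5 := ((hiff _ _ _).1 h3).1
        exact ⟨((h2 s).2 h5).1, hgain s h5, hpast s⟩
    -- A new run starts at slot `0`, so no older entrant remains.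
    · have hτ' : (τ + 1) / P.D k = (P.runOf k τ + 1) * P.B := by
        have e1 : τ / P.D k = P.runOf k τ * P.B + P.slotOf k τ := by
          rw [runOf, slotOf, Nat.div_add_mod']
        have e2 : P.slotOf k τ < P.B := Nat.mod_lt _ hB
        rw [hdiv, e1, add_mul]
        omega
      have hslot : P.slotOf k (τ + 1) = 0 := by rw [slotOf, hτ', Nat.mul_mod_left]
      have hno : ∀ (b : ℕ → ℤ) (ℓ : ℕ → Fin n → ℤ) (ω : ℕ → Fin n),
          s ∉ P.runPool k b ℓ ω (P.runOf k (τ + 1)) (P.slotOf k (τ + 1)) := by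
        intro b ℓ ω h3
        have := (mem_pool.1 h3).1
        omega
      exact ⟨iff_of_false (hno _ _ _) (hno _ _ _), fun h3 => absurd h3 (hno _ _ _)⟩
  · have hdiv : (τ + 1) / P.D k = τ / P.D k := by
      rw [Nat.succ_div, if_neg fun h3 => hmod (Nat.mod_eq_zero_of_dvd h3), add_zero]
    have hmod' : (τ + 1) % P.D k = τ % P.D k + 1 := by
      have e1 := Nat.div_add_mod (τ + 1) (P.D k)
      have e2 := Nat.div_add_mod τ (P.D k)
      rw [hdiv] at e1
      omega
    have hrun : P.runOf k (τ + 1) = P.runOf k τ := by rw [runOf, hdiv, runOf]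
    have hslot : P.slotOf k (τ + 1) = P.slotOf k τ := by rw [slotOf, hdiv, slotOf]
    rw [hrun, hslot]
    refine ⟨?_, fun s => ⟨(h2 s).1, fun hs => ⟨((h2 s).2 hs).1, ((h2 s).2 hs).2.1, ?_⟩⟩⟩
    · simp only [past] at h1 ⊢
      rw [partSum_add_one_of_mod_ne _ hdiv hmod', partSum_add_one_of_mod_ne _ hdiv hmod', h1, hb]
    · obtain ⟨h3, -, h4⟩ := (h2 s).2 hs
      simp only [past, hrun] at h4 ⊢
      rw [partSum_add_one_of_mod_ne _ hdiv hmod', partSum_add_one_of_mod_ne _ hdiv hmod', h4,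
        hℓ s hs, h3]

section Strategy

variable (P) (K : ℕ)

/-- The information that is kept on all levels. -/
noncomputable def view (ω : ℕ → ℕ → Fin n) (ℓ : ℕ → Fin n → ℤ) (τ : ℕ) :
    Fin K → (ℕ → Option (Fin n × ℤ × ℤ)) × ℤ :=
  fun k => P.levelView k (P.loss ℓ ω k) ℓ (fun t => ω t k) τ

open Classical in
/-- The experts in the pools. -/
noncomputable def watch (x : Fin K → (ℕ → Option (Fin n × ℤ × ℤ)) × ℤ) : Finset (Fin n) :=
  univ.filter fun i => i = P.i₀ ∨ ∃ k s y, (x k).1 s = some y ∧ y.1 = i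

variable {P K} {ω ω' : ℕ → ℕ → Fin n} {ℓ' : ℕ → Fin n → ℤ} {τ : ℕ}

theorem entrant_mem_watch {k : ℕ} (hk : k < K) {s : ℕ}
    (hs : s ∈ P.runPool k (P.loss ℓ ω k) ℓ (fun t => ω t k) (P.runOf k τ) (P.slotOf k τ)) :
    P.entrant k (fun t => ω t k) (P.runOf k τ) s ∈ P.watch K (P.view K ω ℓ τ) := by
  classical
  rw [watch, mem_filter]
  exact ⟨mem_univ _, Or.inr ⟨⟨k, hk⟩, s, _, if_pos hs, rfl⟩⟩

/-- By induction on the level: the weights come from the view and the current losses from watched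
experts. Level `0` is the reason why `i₀` is watched. -/
theorem loss_congr_view (h : P.view K ω ℓ τ = P.view K ω' ℓ' τ)
    (hℓ : ∀ i ∈ P.watch K (P.view K ω ℓ τ), ℓ τ i = ℓ' τ i) :
    ∀ k ≤ K, P.loss ℓ ω k τ = P.loss ℓ' ω' k τ := by
  classical
  intro k
  induction k with
  | zero =>
    intro _
    exact hℓ _ (by rw [watch, mem_filter]; exact ⟨mem_univ _, Or.inl rfl⟩)
  | succ k ih =>
    intro hk
    simp only [loss]
    rw [mix_congr (congrFun h ⟨k, hk⟩) (by rw [ih (by omega)]) fun s hs => ?_]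
    exact congrArg _ (hℓ _ (entrant_mem_watch hk hs))

/-- The playing probabilities use past losses only; unlike in `loss_congr_view`, no current loss has
to agree. -/
theorem dist_congr_view (h : P.view K ω ℓ τ = P.view K ω' ℓ' τ) :
    ∀ k ≤ K, P.dist ℓ ω k τ = P.dist ℓ' ω' k τ := by
  intro k
  induction k with
  | zero => intro _; rfl
  | succ k ih =>
    intro hk
    funext i
    simp only [dist]
    exact mix_congr (congrFun h ⟨k, hk⟩) (by rw [ih (by omega)]) fun s hs => rfl

theorem levelView_zero {k : ℕ} {b b' : ℕ → ℤ} {ω ω' : ℕ → Fin n} (hω : ω 0 = ω' 0) :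
    P.levelView k b ℓ ω 0 = P.levelView k b' ℓ' ω' 0 := by
  have h1 : P.slotOf k 0 = 0 := by simp [slotOf]
  have h2 : P.runOf k 0 = 0 := by simp [runOf]
  have h3 : ∀ f, partSum (P.D k) f 0 = 0 := fun f => partSum_eq_zero f (Nat.zero_mod _)
  rw [levelView_eq_iff, h1, h2]
  refine ⟨by simp only [past, h3], fun s => ?_⟩
  rcases Nat.eq_zero_or_pos s with rfl | hs
  · refine ⟨iff_of_true ?_ ?_, fun _ => ⟨?_, ?_, ?_⟩⟩
    · exact mem_pool.2 ⟨le_rfl, survives_self _ _ _⟩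
    · exact mem_pool.2 ⟨le_rfl, survives_self _ _ _⟩
    · simpa [entrant] using hω
    · rw [gain, gain, Ico_self, sum_empty, sum_empty]
    · simp only [past, h3]
  · have hno : ∀ (b : ℕ → ℤ) (ℓ : ℕ → Fin n → ℤ) (ω : ℕ → Fin n),
        s ∉ P.runPool k b ℓ ω 0 0 := by
      intro b ℓ ω h4
      have := (mem_pool.1 h4).1
      omega
    exact ⟨iff_of_false (hno _ _ _) (hno _ _ _), fun h4 => absurd h4 (hno _ _ _)⟩

/-- The strategy which plays the distribution of the top level. -/
noncomputable def strategy (P : Hierarchy n) (K N : ℕ) (hB : 0 < P.B) :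
    Strategy n N (ℕ → Fin n) (Fin K → (ℕ → Option (Fin n × ℤ × ℤ)) × ℤ) where
  view := P.view K
  watch := P.watch K
  play ω ℓ τ := PMF.ofFintype (fun i => ENNReal.ofReal (P.dist ℓ ω K τ i)) (by
    rw [← ENNReal.ofReal_sum_of_nonneg fun i _ => dist_nonneg K τ i, sum_dist,
      ENNReal.ofReal_one])
  view_zero ω ω' ℓ ℓ' _ _ h := funext fun k => levelView_zero (congrFun h k)
  view_succ ω ω' ℓ ℓ' _ _ t h h1 h2 := funext fun k =>
    levelView_succ hB (congrFun h k) (loss_congr_view h h2 k k.2.le)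
      (fun s hs => h2 _ (entrant_mem_watch k.2 hs)) (congrFun h1 k)
  play_congr ω ω' ℓ ℓ' _ _ t h := by
    simp only [dist_congr_view h K le_rfl]

theorem card_watch_le {M : ℕ} (hM : ∀ k < K,
    (P.runPool k (P.loss ℓ ω k) ℓ (fun t => ω t k) (P.runOf k τ) (P.slotOf k τ)).card ≤ M) :
    (P.watch K (P.view K ω ℓ τ)).card ≤ K * M + 1 := by
  classical
  have hsub : P.watch K (P.view K ω ℓ τ) ⊆ insert P.i₀ ((univ : Finset (Fin K)).biUnion fun k =>
      (P.runPool k (P.loss ℓ ω k) ℓ (fun t => ω t k) (P.runOf k τ) (P.slotOf k τ)).image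
        (P.entrant k (fun t => ω t k) (P.runOf k τ))) := by
    intro i hi
    rw [watch, mem_filter] at hi
    rcases hi.2 with h | ⟨k, s, y, h1, h2⟩
    · exact mem_insert.2 (Or.inl h)
    · refine mem_insert_of_mem (mem_biUnion.2 ⟨k, mem_univ _, mem_image.2 ⟨s, ?_⟩⟩)
      simp only [view, levelView] at h1
      split_ifs at h1 with h3
      rw [Option.some.injEq] at h1
      exact ⟨h3, by rw [← h2, ← h1]⟩
  refine (card_le_card hsub).trans ((card_insert_le _ _).trans (Nat.add_le_add_right ?_ 1))
  refine (card_biUnion_le_card_mul _ _ M fun (k : Fin K) _ =>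
    card_image_le.trans (hM k k.2)).trans ?_
  rw [card_univ, Fintype.card_fin]

/-- Survival until `u` makes the gain nonnegative. The benchmark never exceeds the base, so clipping
caps the gain at `V k` per slot. -/
theorem gain_mem_Icc {k r s u : ℕ} {b : ℕ → ℤ} {ω : ℕ → Fin n} (hV : 0 ≤ P.V k) (hg : 0 < P.g)
    (hs : s ∈ P.runPool k b ℓ ω r u) :
    P.gain k b ℓ ω r s u ∈ Icc 0 (P.V k * u) := by
  obtain ⟨h1, h2⟩ := mem_pool.1 hs
  rw [mem_Icc]
  constructor
  · rcases h1.eq_or_lt with rfl | h1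
    · rw [gain, Ico_self, sum_empty]
    · have h3 := h2 u h1 le_rfl
      have h4 : 0 ≤ P.V k * ((u : ℤ) - s) := mul_nonneg hV (by omega)
      exact nonneg_of_mul_nonneg_right (h4.trans h3) (by exact_mod_cast hg)
  · have h3 : P.gain k b ℓ ω r s u ≤ ∑ x ∈ Ico s u, P.V k := by
      refine sum_le_sum fun x _ => ?_
      have h4 : P.runBench k b ℓ ω r s x ≤ P.slotBase k b r x := bench_le_base _ _
      have h5 := slotLoss_ge (P := P) (k := k) (b := b) (ℓ := ℓ) r x (P.entrant k ω r s)
      linarith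
    refine h3.trans ?_
    rw [sum_const, Nat.card_Ico, nsmul_eq_mul, mul_comm]
    exact mul_le_mul_of_nonneg_left (by omega) hV

/-- The views take few values. -/
theorem exists_finset_view {N M R : ℕ} (hD : ∀ k < K, 0 < P.D k) (hB : 0 < P.B) (hg : 0 < P.g)
    (hV : ∀ k < K, 0 < P.V k) (hM : 1 + 2 * P.g * (Nat.log 2 P.B + 1) ≤ M)
    (hND : ∀ k < K, N * P.D k ≤ R) (hVB : ∀ k < K, P.V k * P.B ≤ R) :
    ∃ I : Finset (Fin K → (ℕ → Option (Fin n × ℤ × ℤ)) × ℤ),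
      I.card ≤ ((P.B * (n * (R + 1) ^ 2) + 1) ^ M * (R + 1)) ^ K ∧
      ∀ ω ℓ, GridLoss N ℓ → ∀ τ, P.view K ω ℓ τ ∈ I := by
  classical
  obtain ⟨F, hFcard, hF⟩ := exists_finset_sparse (range P.B)
    (((univ : Finset (Fin n)) ×ˢ Icc (0 : ℤ) R ×ˢ Icc (0 : ℤ) R).map Function.Embedding.some)
    none M
  have hIcc : (Icc (0 : ℤ) R).card = R + 1 := by rw [Int.card_Icc]; omega
  refine ⟨Fintype.piFinset fun _ => F ×ˢ Icc (0 : ℤ) R, ?_, fun ω ℓ hℓ τ => ?_⟩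
  · rw [Fintype.card_piFinset_const, card_product, hIcc]
    refine Nat.pow_le_pow_left (Nat.mul_le_mul_right _ (hFcard.trans (le_of_eq ?_))) _
    rw [card_range, card_map, card_product, card_product, hIcc, card_univ, Fintype.card_fin]
    ring
  · rw [Fintype.mem_piFinset]
    intro k
    have hu : P.slotOf k τ < P.B := Nat.mod_lt _ hB
    have hpart : ∀ f : ℕ → ℤ, (∀ t, 0 ≤ f t ∧ f t ≤ N) →
        partSum (P.D k) f τ ∈ Icc (0 : ℤ) R := fun f hf =>
      mem_Icc.2 ⟨partSum_nonneg (fun t => (hf t).1) _,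
        (partSum_le (hD k k.2) (fun t => (hf t).2) _).trans (by exact_mod_cast hND k k.2)⟩
    refine mem_product.2 ⟨hF _ (P.runPool k (P.loss ℓ ω k) ℓ (fun t => ω t k) (P.runOf k τ)
      (P.slotOf k τ)) (fun s hs => ?_) ((card_runPool_le (hV k k.2) hu).trans hM)
      (fun s hs => ?_) fun s hs => if_neg hs, ?_⟩
    · exact mem_range.2 ((mem_pool.1 hs).1.trans_lt hu)
    · refine mem_map.2 ⟨_, ?_, (if_pos hs).symm⟩
      rw [mem_product, mem_product]
      refine ⟨mem_univ _, ?_, hpart _ fun t => hℓ t _⟩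
      have h1 := mem_Icc.1 (gain_mem_Icc (hV k k.2).le hg hs)
      refine mem_Icc.2 ⟨h1.1, h1.2.trans (le_trans ?_ (hVB k k.2))⟩
      exact mul_le_mul_of_nonneg_left (by exact_mod_cast hu.le) (hV k k.2).le
    · exact hpart _ fun t => ⟨loss_nonneg (fun t i => (hℓ t i).1) _ _,
        loss_le (fun t i => (hℓ t i).2) _ _⟩

end Strategy

end Hierarchy

/-! ### Concentration of the plays -/

namespace PMF

variable {α β : Type*}

theorem toOuterMeasure_bind_le (p : PMF α) (q : α → PMF β) (G : Set α) (E : Set β) (c : ℝ≥0∞)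
    (h : ∀ a ∈ G, (q a).toOuterMeasure E ≤ c) :
    (p.bind q).toOuterMeasure E ≤ p.toOuterMeasure Gᶜ + c := by
  classical
  rw [toOuterMeasure_eq_ex, ex_bind, toOuterMeasure_eq_ex, ← p.ex_const c, ← ex_add]
  refine ex_mono _ fun a => ?_
  by_cases ha : a ∈ G
  · rw [← toOuterMeasure_eq_ex]
    exact (h a ha).trans le_add_self
  · rw [Set.indicator_of_mem (by exact ha), Pi.one_apply]
    refine le_trans ?_ le_self_add
    calc (q a).ex (E.indicator 1) ≤ (q a).ex fun _ => 1 :=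
          ex_mono _ fun b => Set.indicator_le_self' (fun _ _ => zero_le_one) b
      _ = 1 := ex_const _ _

theorem ofReal_one_sub_le_toOuterMeasure (p : PMF α) {E : Set α} {ε : ℝ} (hε : 0 ≤ ε)
    (h : p.toOuterMeasure Eᶜ ≤ ENNReal.ofReal ε) :
    ENNReal.ofReal (1 - ε) ≤ p.toOuterMeasure E := by
  rw [ENNReal.ofReal_sub _ hε, ENNReal.ofReal_one, tsub_le_iff_right]
  refine le_trans ?_ (add_le_add_right h _)
  rw [toOuterMeasure_eq_ex, toOuterMeasure_eq_ex, ← ex_add]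
  conv_lhs => rw [← p.ex_const 1]
  refine ex_mono _ fun a => ?_
  by_cases ha : a ∈ E <;> simp [ha]

end PMF

section Plays

variable {n : ℕ}

theorem exp_le_of_abs_le_one {x : ℝ} (h : |x| ≤ 1) : Real.exp x ≤ 1 + x + x ^ 2 := by
  have := (abs_le.1 (Real.abs_exp_sub_one_sub_id_le h)).2
  linarith

/-- The centred loss has mean zero and modulus at most `1`, so `exp x ≤ 1 + x + x ^ 2` leaves only
the second-order term. -/
theorem ex_exp_le {q : PMF (Fin n)} {w f : Fin n → ℝ} (hq : ∀ i, q i = ENNReal.ofReal (w i))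
    (hw : ∀ i, 0 ≤ w i) (hw1 : ∑ i, w i = 1) (hf : ∀ i, f i ∈ Set.Icc (0 : ℝ) 1) {η : ℝ}
    (hη : 0 ≤ η) (hη1 : η ≤ 1) :
    (q.ex fun i => ENNReal.ofReal (Real.exp (η * (f i - ∑ j, w j * f j)))) ≤
      ENNReal.ofReal (Real.exp (η ^ 2)) := by
  set M := ∑ j, w j * f j with hM
  have hM0 : 0 ≤ M := sum_nonneg fun j _ => mul_nonneg (hw j) (hf j).1
  have hM1 : M ≤ 1 := by
    rw [← hw1]
    exact sum_le_sum fun j _ => mul_le_of_le_one_right (hw j) (hf j).2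
  rw [PMF.ex_fintype]
  simp only [hq, ← ENNReal.ofReal_mul (hw _)]
  rw [← ENNReal.ofReal_sum_of_nonneg fun i _ => mul_nonneg (hw i) (Real.exp_pos _).le]
  refine ENNReal.ofReal_le_ofReal ?_
  have h1 : ∀ i, w i * Real.exp (η * (f i - M)) ≤ w i * (1 + η * (f i - M) + η ^ 2) := by
    intro i
    refine mul_le_mul_of_nonneg_left ?_ (hw i)
    have h2 : |f i - M| ≤ 1 := abs_le.2 ⟨by linarith [(hf i).1], by linarith [(hf i).2]⟩
    have h3 : |η * (f i - M)| ≤ η := by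
      rw [abs_mul, abs_of_nonneg hη]
      exact mul_le_of_le_one_right hη h2
    have h4 := exp_le_of_abs_le_one (h3.trans hη1)
    have h5 : (η * (f i - M)) ^ 2 ≤ η ^ 2 := sq_le_sq' (abs_le.1 h3).1 (abs_le.1 h3).2
    linarith
  refine (sum_le_sum fun i _ => h1 i).trans (le_trans (le_of_eq ?_) (Real.add_one_le_exp _))
  have h6 : ∀ i, w i * (1 + η * (f i - M) + η ^ 2) =
      w i * (1 + η ^ 2 - η * M) + η * (w i * f i) := fun i => by ring
  simp only [h6]
  rw [sum_add_distrib, ← sum_mul, ← mul_sum, ← hM, hw1]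
  ring

/-- The losses of independent plays are concentrated around their expectation. -/
theorem measure_independentPlays_le {q : ℕ → PMF (Fin n)} {w f : ℕ → Fin n → ℝ} {T : ℕ}
    (hq : ∀ t i, q t i = ENNReal.ofReal (w t i))
    (hw : ∀ t i, 0 ≤ w t i) (hw1 : ∀ t, ∑ i, w t i = 1)
    (hf : ∀ t < T, ∀ i, f t i ∈ Set.Icc (0 : ℝ) 1)
    {η : ℝ} (hη : 0 ≤ η) (hη1 : η ≤ 1) (x : ℝ) :
    (independentPlays q T).toOuterMeasure
      {d | ∑ t ∈ range T, ∑ i, w t i * f t i + x < ∑ t : Fin T, f t (d t)} ≤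
        ENNReal.ofReal (Real.exp (η ^ 2 * T - η * x)) := by
  -- Exponential moments multiply over independent rounds; Markov's inequality then gives the tail
  -- bound.
  have hmgf : ∀ t ≤ T, (independentPlays q t).ex (fun d => ENNReal.ofReal (Real.exp
      (η * (∑ s : Fin t, f s (d s) - ∑ s ∈ range t, ∑ i, w s i * f s i)))) ≤
        ENNReal.ofReal (Real.exp (η ^ 2 * t)) := by
    intro t
    induction t with
    | zero => intro _; simp [independentPlays, PMF.ex_pure]
    | succ t ih =>
      intro ht
      simp only [independentPlays, PMF.ex_bind, PMF.ex_map]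
      have h1 : ∀ (d : Fin t → Fin n) (i : Fin n), ENNReal.ofReal (Real.exp
          (η * (∑ s : Fin (t + 1), f s (Fin.snoc (α := fun _ => Fin n) d i s) -
            ∑ s ∈ range (t + 1), ∑ i, w s i * f s i))) =
          ENNReal.ofReal (Real.exp
            (η * (∑ s : Fin t, f s (d s) - ∑ s ∈ range t, ∑ i, w s i * f s i))) *
          ENNReal.ofReal (Real.exp (η * (f t i - ∑ i, w t i * f t i))) := by
        intro d i
        rw [← ENNReal.ofReal_mul (Real.exp_pos _).le, ← Real.exp_add, Fin.sum_univ_castSucc,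
          sum_range_succ]
        simp only [Fin.snoc_castSucc, Fin.snoc_last, Fin.val_castSucc, Fin.val_last]
        congr 2
        ring
      simp only [h1, PMF.ex_const_mul]
      refine (PMF.ex_mono _ fun d => mul_le_mul_right
        (ex_exp_le (hq t) (hw t) (hw1 t) (hf t ht) hη hη1) _).trans ?_
      simp only [mul_comm _ (ENNReal.ofReal (Real.exp (η ^ 2)))]
      rw [PMF.ex_const_mul]
      refine (mul_le_mul_right (ih (by omega)) _).trans (le_of_eq ?_)
      rw [← ENNReal.ofReal_mul (Real.exp_pos _).le, ← Real.exp_add]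
      congr 2
      push_cast
      ring
  rw [PMF.toOuterMeasure_eq_ex]
  set E : Set (Fin T → Fin n) :=
    {d | ∑ t ∈ range T, ∑ i, w t i * f t i + x < ∑ t : Fin T, f t (d t)} with hE
  have h1 : ∀ d, E.indicator 1 d ≤ ENNReal.ofReal (Real.exp (-(η * x))) * ENNReal.ofReal (Real.exp
      (η * (∑ s : Fin T, f s (d s) - ∑ s ∈ range T, ∑ i, w s i * f s i))) := by
    intro d
    by_cases hd : d ∈ E
    · rw [Set.indicator_of_mem hd, Pi.one_apply, ← ENNReal.ofReal_mul (Real.exp_pos _).le,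
        ← Real.exp_add, ENNReal.one_le_ofReal]
      refine Real.one_le_exp ?_
      have h2 : x ≤ ∑ s : Fin T, f s (d s) - ∑ s ∈ range T, ∑ i, w s i * f s i := by
        have : ∑ t ∈ range T, ∑ i, w t i * f t i + x < ∑ t : Fin T, f t (d t) := hd
        linarith
      have h3 := mul_le_mul_of_nonneg_left h2 hη
      linarith
    · rw [Set.indicator_of_notMem hd]
      exact zero_le
  refine (PMF.ex_mono _ h1).trans ?_
  rw [PMF.ex_const_mul]
  refine (mul_le_mul_right (hmgf T le_rfl) _).trans (le_of_eq ?_)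
  rw [← ENNReal.ofReal_mul (Real.exp_pos _).le, ← Real.exp_add]
  congr 2
  ring

end Plays

/-! ### Performance of a hierarchy with valid parameters -/

namespace Hierarchy

variable {n : ℕ} (P : Hierarchy n)

theorem sum_range_mul_eq_slotSum (D R : ℕ) (f : ℕ → ℤ) :
    ∑ t ∈ range (R * D), f t = ∑ r ∈ range R, slotSum D f r := by
  have := slotSum_slots D R f 0
  simpa [slotSum, mul_comm D R] using this

/-- The requirements on the parameters of the hierarchy. -/
structure Valid (K N m : ℕ) : Prop where
  hD : ∀ k, 0 < P.D k
  hB : 0 < P.B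
  hg : 0 < P.g
  hV : ∀ k, 0 < P.V k
  hη : ∀ k < K, 0 < P.η k
  hηN : ∀ k < K, P.η k * N ≤ 1
  hDB : ∀ k, P.D (k + 1) = P.D k * P.B
  hV0 : (N : ℤ) * P.D 0 ≤ P.V 0
  hVV : ∀ k < K,
    P.V k * P.B / P.g + P.V k * m + P.B * P.slotError N k ≤ (P.V (k + 1) : ℝ)

variable {P} {K N m : ℕ}

/-- It is unlikely that some expert is missed too often in some run. -/
theorem measure_exists_missed_le [NeZero n] (hP : P.Valid K N m) (ℓ : ℕ → Fin n → ℤ) (T : ℕ) :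
    (PMF.prodSeq (fun _ => P.i₀) (seedLaw P.i₀ K) T).toOuterMeasure
      {ω | ∀ k < K, ∀ r, (r + 1) * P.D (k + 1) ≤ T → ∀ H ≤ P.B, ∀ i,
        ¬ P.Missed k ℓ i r (m + 1) H ω}ᶜ ≤
      ENNReal.ofReal (K * (T * ((P.B + 1) * n)) * Real.exp (-(((m + 1 : ℕ) : ℝ) / n))) := by
  set p := PMF.prodSeq (fun _ => P.i₀) (seedLaw P.i₀ K) T
  -- Union bound over the level, the run, the prefix length `H` and the expert.
  set J : Finset (ℕ × ℕ × ℕ × Fin n) := range K ×ˢ range T ×ˢ range (P.B + 1) ×ˢ univ with hJ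
  set E : ℕ × ℕ × ℕ × Fin n → Set (ℕ → ℕ → Fin n) := fun j =>
    {ω | (j.2.1 + 1) * P.D (j.1 + 1) ≤ T ∧ P.Missed j.1 ℓ j.2.2.2 j.2.1 (m + 1) j.2.2.1 ω}
    with hE
  have hsub : {ω | ∀ k < K, ∀ r, (r + 1) * P.D (k + 1) ≤ T → ∀ H ≤ P.B, ∀ i,
      ¬ P.Missed k ℓ i r (m + 1) H ω}ᶜ ⊆ ⋃ j ∈ J, E j := by
    intro ω hω
    simp only [Set.mem_compl_iff, Set.mem_ofPred_eq, not_forall, not_not] at hω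
    obtain ⟨k, hk, r, hr, H, hH, i, hi⟩ := hω
    refine Set.mem_iUnion₂.2 ⟨(k, r, H, i), ?_, hr, hi⟩
    simp only [hJ, mem_product, mem_range, mem_univ, and_true]
    refine ⟨hk, ?_, by omega⟩
    have := Nat.mul_le_mul_left (r + 1) (hP.hD (k + 1))
    omega
  have hEj : ∀ j ∈ J, p.toOuterMeasure (E j) ≤
      ENNReal.ofReal (Real.exp (-(((m + 1 : ℕ) : ℝ) / n))) := by
    rintro ⟨k, r, H, i⟩ hj
    simp only [hJ, mem_product, mem_range, mem_univ, and_true] at hj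
    by_cases hr : (r + 1) * P.D (k + 1) ≤ T
    · refine (p.toOuterMeasure.mono fun ω hω => hω.2).trans
        (measure_missed_le hj.1 (hP.hD k) (by rwa [← hP.hDB])
          (Nat.le_of_lt_succ hj.2.2) i P.i₀ (m + 1))
    · have : E (k, r, H, i) = ∅ := Set.eq_empty_of_forall_notMem fun ω hω => hr hω.1
      rw [this, MeasureTheory.measure_empty]
      exact zero_le
  refine (p.toOuterMeasure.mono hsub).trans ((MeasureTheory.measure_biUnion_finset_le J E).trans
    ((sum_le_card_nsmul _ _ _ hEj).trans (le_of_eq ?_)))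
  rw [nsmul_eq_mul, ENNReal.ofReal_mul (by positivity), hJ, card_product, card_product,
    card_product, card_range, card_range, card_range, card_univ, Fintype.card_fin]
  congr 1
  rw [← ENNReal.ofReal_natCast]
  push_cast
  rfl

/-- The expected regret when no expert is missed too often. -/
theorem sum_dist_mul_sub_le (hP : P.Valid K N m) (hN : 0 < N) {T : ℕ} {ℓ : Fin T → Fin n → ℝ}
    (hℓ : ∀ t i, ℓ t i ∈ Set.Icc (0 : ℝ) 1) {ω : ℕ → ℕ → Fin n} (i : Fin n)
    (hω : ∀ k < K, ∀ r, (r + 1) * P.D (k + 1) ≤ (T / P.D K + 1) * P.D K → ∀ H ≤ P.B,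
      ¬ P.Missed k (roundLoss N ℓ) i r (m + 1) H ω) :
    ∑ t : Fin T, ∑ j, P.dist (roundLoss N ℓ) ω K t j * ℓ t j ≤
      ∑ t, ℓ t i + (((T / P.D K + 1 : ℕ) : ℝ) * P.V K + T) / N := by
  have hgrid := gridLoss_roundLoss N hℓ
  set ℓ' := roundLoss N ℓ with hℓ'
  have h0 : ∀ t i, 0 ≤ ℓ' t i := fun t i => (hgrid t i).1
  have h1 : ∀ t i, ℓ' t i ≤ (N : ℤ) := fun t i => (hgrid t i).2
  have hreg := regret_slot_le (N := (N : ℤ)) h0 h1 hP.hη (by exact_mod_cast hP.hηN)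
    (fun k _ => (hP.hV k).le) hP.hg hP.hDB hP.hV0 hP.hVV hω K le_rfl
  have hNR : (0 : ℝ) < N := by exact_mod_cast hN
  -- The horizon is padded to whole slots of the top level. Beyond `T` the rounded losses vanish, so
  -- the comparator pays nothing extra.
  have hT : T ≤ (T / P.D K + 1) * P.D K := (Nat.lt_div_mul_add (hP.hD K)).le.trans
    (by rw [add_mul, one_mul])
  have hsum : ∑ t ∈ range T, P.loss ℓ' ω K t ≤
      ∑ t ∈ range T, ℓ' t i + (T / P.D K + 1 : ℕ) * P.V K := by
    have h2 : ∑ t ∈ range T, P.loss ℓ' ω K t ≤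
        ∑ t ∈ range ((T / P.D K + 1) * P.D K), P.loss ℓ' ω K t :=
      sum_le_sum_of_subset_of_nonneg (range_subset_range.2 hT) fun t _ _ => loss_nonneg h0 _ _
    have h3 : ∑ t ∈ range ((T / P.D K + 1) * P.D K), ℓ' t i = ∑ t ∈ range T, ℓ' t i := by
      refine (sum_subset (range_subset_range.2 hT) fun t _ ht => ?_).symm
      rw [hℓ', roundLoss, dif_neg (by simpa using ht)]
    rw [sum_range_mul_eq_slotSum] at h2 h3
    refine h2.trans ?_
    rw [← h3]
    refine (sum_le_sum fun r hr => hreg r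
      (Nat.mul_le_mul_right _ (Nat.succ_le_of_lt (mem_range.1 hr)))).trans (le_of_eq ?_)
    rw [sum_add_distrib, sum_const, card_range, nsmul_eq_mul]
  have hle : ∀ t : Fin T, ∑ j, P.dist ℓ' ω K t j * ℓ t j ≤ ((P.loss ℓ' ω K t : ℝ) + 1) / N := by
    intro t
    -- Rounding down costs at most `1 / N` per round, which is the source of the summand `T / N`.
    have h4 : ∀ j, ℓ t j ≤ ((ℓ' t j : ℝ) + 1) / N := by
      intro j
      rw [le_div_iff₀ hNR, hℓ', roundLoss, dif_pos t.2, mul_comm]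
      exact (Int.lt_floor_add_one _).le
    calc ∑ j, P.dist ℓ' ω K t j * ℓ t j
        ≤ ∑ j, P.dist ℓ' ω K t j * (((ℓ' t j : ℝ) + 1) / N) :=
          sum_le_sum fun j _ => mul_le_mul_of_nonneg_left (h4 j) (dist_nonneg _ _ _)
      _ = (∑ j, P.dist ℓ' ω K t j * (ℓ' t j : ℝ) + ∑ j, P.dist ℓ' ω K t j) / N := by
          rw [← sum_add_distrib, sum_div]
          exact sum_congr rfl fun j _ => by ring
      _ ≤ _ := by
          rw [sum_dist]
          gcongr
          exact sum_dist_mul_le _ _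
  have hge : ∀ t : Fin T, (ℓ' t i : ℝ) / N ≤ ℓ t i := by
    intro t
    rw [div_le_iff₀ hNR, hℓ', roundLoss, dif_pos t.2, mul_comm]
    exact Int.floor_le _
  have hsumR : ∑ t : Fin T, (P.loss ℓ' ω K t : ℝ) ≤
      ∑ t : Fin T, (ℓ' t i : ℝ) + (T / P.D K + 1 : ℕ) * P.V K := by
    rw [Fin.sum_univ_eq_sum_range fun t => (P.loss ℓ' ω K t : ℝ),
      Fin.sum_univ_eq_sum_range fun t => (ℓ' t i : ℝ)]
    have := (Int.cast_le (R := ℝ)).2 hsum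
    push_cast at this ⊢
    exact this
  calc ∑ t : Fin T, ∑ j, P.dist ℓ' ω K t j * ℓ t j
      ≤ ∑ t : Fin T, ((P.loss ℓ' ω K t : ℝ) + 1) / N := sum_le_sum fun t _ => hle t
    _ = (∑ t : Fin T, (P.loss ℓ' ω K t : ℝ) + T) / N := by
        rw [← sum_div, sum_add_distrib, sum_const, card_univ, Fintype.card_fin, nsmul_eq_mul,
          mul_one]
    _ ≤ (∑ t : Fin T, (ℓ' t i : ℝ) + (T / P.D K + 1 : ℕ) * P.V K + T) / N := by gcongr
    _ = ∑ t : Fin T, (ℓ' t i : ℝ) / N + ((T / P.D K + 1 : ℕ) * P.V K + T) / N := by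
        rw [← sum_div]; ring
    _ ≤ _ := by
        gcongr with t
        exact hge t

/-- The performance of the hierarchy when it is implemented with `S` bits of memory. -/
theorem exists_algorithm [NeZero n] (hP : P.Valid K N m) (hN : 0 < N) {T M R S : ℕ}
    (hM : 1 + 2 * P.g * (Nat.log 2 P.B + 1) ≤ M)
    (hND : ∀ k < K, N * P.D k ≤ R) (hVB : ∀ k < K, P.V k * P.B ≤ R)
    (hS : (T + 1) * (((P.B * (n * (R + 1) ^ 2) + 1) ^ M * (R + 1)) ^ K *
      (n * (n * (N + 1) + 1) ^ (K * M + 1))) ≤ 2 ^ S) :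
    ∃ A : OnlineAlgorithm n (Fin S → Bool), ∀ ℓ : Fin T → Fin n → ℝ,
      (∀ t i, ℓ t i ∈ Set.Icc (0 : ℝ) 1) → ∀ η x : ℝ, 0 ≤ η → η ≤ 1 →
        (A.decisions ℓ).toOuterMeasure
          {d | (((T / P.D K + 1 : ℕ) : ℝ) * P.V K + T) / N + x < totalRegret ℓ d} ≤
        ENNReal.ofReal (K * (((T / P.D K + 1) * P.D K : ℕ) * ((P.B + 1) * n)) *
            Real.exp (-(((m + 1 : ℕ) : ℝ) / n))) +
          ENNReal.ofReal (Real.exp (η ^ 2 * T - η * x)) := by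
  obtain ⟨I, hIcard, hI⟩ := exists_finset_view (n := n) (P := P) (K := K) (N := N) (M := M)
    (R := R) (fun k _ => hP.hD k) hP.hB hP.hg (fun k _ => hP.hV k) hM hND hVB
  obtain ⟨A, hA⟩ := (P.strategy K N hP.hB).exists_implementation (fun _ => P.i₀)
    (seedLaw P.i₀ K) (T := T) (m := K * M + 1) (S := S) I (fun ω ℓ hℓ t _ => hI ω ℓ hℓ t)
    (fun ω ℓ _ t _ => card_watch_le fun k _ =>
      (card_runPool_le (hP.hV k) (Nat.mod_lt _ hP.hB)).trans hM)
    (le_trans (by gcongr) hS)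
  refine ⟨A, fun ℓ hℓ η x hη hη1 => ?_⟩
  have hgrid := gridLoss_roundLoss N hℓ
  set T₀ := (T / P.D K + 1) * P.D K with hT₀
  have hT : T + 1 ≤ T₀ := (Nat.lt_div_mul_add (hP.hD K)).trans_le (by rw [hT₀, add_mul, one_mul])
  -- Seeds for the padded horizon are needed to control misses; the plays before `T` do not depend
  -- on the additional ones.
  rw [hA ℓ hℓ, ← PMF.prodSeq_bind_eq _ _ hT _ fun ω t y ht => independentPlays_congr fun s hs =>
    (P.strategy K N hP.hB).play_congr _ _ _ _ hgrid hgrid s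
      ((P.strategy K N hP.hB).view_congr hgrid fun s' hs' =>
        Function.update_of_ne (by omega) _ _)]
  refine (PMF.toOuterMeasure_bind_le _ _ {ω | ∀ k < K, ∀ r, (r + 1) * P.D (k + 1) ≤ T₀ →
    ∀ H ≤ P.B, ∀ i, ¬ P.Missed k (roundLoss N ℓ) i r (m + 1) H ω} _
    (ENNReal.ofReal (Real.exp (η ^ 2 * T - η * x))) fun ω hω => ?_).trans
    (add_le_add_left (measure_exists_missed_le hP _ _) _)
  let f : ℕ → Fin n → ℝ := fun t i => if h : t < T then ℓ ⟨t, h⟩ i else 0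
  have hfℓ : ∀ (t : Fin T) i, f t i = ℓ t i := fun t i => dif_pos t.2
  refine le_trans (MeasureTheory.OuterMeasure.mono _ fun d hd => ?_)
    (measure_independentPlays_le (q := (P.strategy K N hP.hB).play ω (roundLoss N ℓ))
      (w := fun t i => P.dist (roundLoss N ℓ) ω K t i) (f := f)
      (fun t i => rfl) (fun t i => dist_nonneg _ _ _) (fun t => sum_dist _ _)
      (fun t ht i => by simp only [f, dif_pos ht]; exact hℓ _ _) hη hη1 x)
  simp only [Set.mem_ofPred_eq, totalRegret] at hd ⊢
  have h1 : ∑ t ∈ range T, ∑ i, P.dist (roundLoss N ℓ) ω K t i * f t i ≤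
      (⨅ i, ∑ t, ℓ t i) + (((T / P.D K + 1 : ℕ) : ℝ) * P.V K + T) / N := by
    rw [← sub_le_iff_le_add]
    refine le_ciInf fun i => ?_
    rw [sub_le_iff_le_add, ← Fin.sum_univ_eq_sum_range fun t =>
      ∑ i, P.dist (roundLoss N ℓ) ω K t i * f t i]
    simp only [hfℓ]
    exact sum_dist_mul_sub_le hP hN hℓ i fun k hk r hr H hH => hω k hk r hr H hH i
  simp only [hfℓ]
  linarith

end Hierarchy

/-! ### The choice of the parameters -/

namespace Hierarchy

variable {n : ℕ}

/-- The hierarchy in which the accuracy improves by a factor `Γ` on each level, while the slot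
length grows by a factor `3 m Γ`. -/
noncomputable def geometric (i₀ : Fin n) (m Γ Δ N : ℕ) : Hierarchy n where
  i₀ := i₀
  B := Γ * (3 * m)
  D k := Δ * (Γ * (3 * m)) ^ k
  V k := N * Δ * (3 * m) ^ k
  g := 3 * Γ
  η k := 1 / (N * √((Δ * (Γ * (3 * m)) ^ k : ℕ) : ℝ))

/-- In `hVV` the first two terms equal `m * V k` and the third is at most that, in total `3 m * V k
= V (k + 1)`. In the third term, half of the allowance covers the exponential weights, by the size
of `Δ`, and half covers rounding, by the size of `N`. -/
theorem geometric_valid (i₀ : Fin n) {m Γ Δ N K : ℕ} (hm : 0 < m) (hΓ : 0 < Γ) (hΓm : Γ ≤ 3 * m)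
    (hΔ0 : 0 < Δ)
    (hΔ : 36 * (Γ : ℝ) ^ 2 * (Real.log ((Γ * (3 * m) : ℕ) + 1) + 1) ^ 2 ≤ Δ) (hN : 0 < N)
    (hΓN : ∀ k < K, 6 * Γ ^ (k + 1) ≤ N) : (geometric i₀ m Γ Δ N).Valid K N m := by
  have hB : 0 < Γ * (3 * m) := by positivity
  have hDpos : ∀ k, 0 < Δ * (Γ * (3 * m)) ^ k := fun k => by positivity
  have hNR : (0 : ℝ) < N := by exact_mod_cast hN
  have hsqrt : ∀ k, 1 ≤ √((Δ * (Γ * (3 * m)) ^ k : ℕ) : ℝ) := fun k => by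
    rw [Real.one_le_sqrt]
    exact_mod_cast hDpos k
  refine ⟨hDpos, hB, Nat.mul_pos (by norm_num) hΓ, fun k => ?_, fun k _ => ?_, fun k _ => ?_,
    fun k => ?_, ?_, fun k hk => ?_⟩
  · simp only [geometric]; positivity
  · simp only [geometric]
    have := hsqrt k
    positivity
  · simp only [geometric]
    rw [one_div, mul_inv, mul_comm, ← mul_assoc, mul_inv_cancel₀ hNR.ne', one_mul]
    exact inv_le_one_of_one_le₀ (hsqrt k)
  · simp only [geometric, pow_succ, mul_assoc]
  · simp [geometric]
  · set D : ℝ := ((Δ * (Γ * (3 * m)) ^ k : ℕ) : ℝ) with hD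
    set L : ℝ := Real.log ((Γ * (3 * m) : ℕ) + 1) with hL
    set W : ℝ := Δ * (3 * m) ^ k with hW
    have hL0 : 0 ≤ L := Real.log_nonneg (by
      have : (0 : ℝ) ≤ ((Γ * (3 * m) : ℕ) : ℝ) := Nat.cast_nonneg _
      linarith)
    have hΓR : (0 : ℝ) < Γ := by exact_mod_cast hΓ
    have hmR : (0 : ℝ) < m := by exact_mod_cast hm
    have hΔR : (0 : ℝ) < Δ := by exact_mod_cast hΔ0
    have hWpos : 0 < W := by positivity
    have hDW : D = Γ ^ k * W := by
      rw [hD, hW]; push_cast; ring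
    have hD1 : 1 ≤ √D := hsqrt k
    have hDpos' : 0 < D := by rw [hDW]; positivity
    have herr : (geometric i₀ m Γ Δ N).slotError N k = N * √D * (L + 1) + D := by
      have h1 : √D ^ 2 = D := Real.sq_sqrt hDpos'.le
      simp only [slotError, geometric, Int.cast_natCast]
      rw [← hD, ← hL, div_div_eq_mul_div, div_one]
      have h2 : 1 / (N * √D) * (N : ℝ) ^ 2 * D = N * √D := by
        field_simp
        rw [h1]
      rw [h2]
      ring
    have hΓβ : (Γ : ℝ) ^ k ≤ (3 * m) ^ k :=
      pow_le_pow_left₀ hΓR.le (by exact_mod_cast hΓm) k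
    -- Because `Γ ≤ 3 * m`, the factor `Γ ^ k` is absorbed by `(3 * m) ^ k`, so one condition on `Δ`
    -- serves all levels.
    have hsq : 6 * Γ * (L + 1) * √D ≤ W := by
      refine le_of_sq_le_sq ?_ hWpos.le
      rw [mul_pow, Real.sq_sqrt hDpos'.le, hDW]
      have h1 : 36 * (Γ : ℝ) ^ 2 * (L + 1) ^ 2 * Γ ^ k ≤ W :=
        mul_le_mul hΔ hΓβ (by positivity) hΔR.le
      nlinarith
    have hND : 6 * Γ * D ≤ N * W := by
      rw [hDW]
      have h1 : 6 * (Γ : ℝ) ^ (k + 1) ≤ N := by exact_mod_cast hΓN k hk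
      have h2 := mul_le_mul_of_nonneg_right h1 hWpos.le
      calc 6 * Γ * (Γ ^ k * W) = 6 * (Γ : ℝ) ^ (k + 1) * W := by ring
        _ ≤ _ := h2
    rw [herr]
    simp only [geometric]
    push_cast
    have e1 : (N : ℝ) * Δ * (3 * m) ^ k * (Γ * (3 * m)) / (3 * Γ) = N * W * m := by
      rw [hW]; field_simp
    have e2 : (N : ℝ) * Δ * (3 * m) ^ k * m = N * W * m := by rw [hW]; ring
    have e3 : (N : ℝ) * Δ * (3 * m) ^ (k + 1) = 3 * (N * W * m) := by rw [hW]; ring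
    rw [e1, e2, e3]
    have h3 : (N : ℝ) * (6 * Γ * (L + 1) * √D) ≤ N * W := mul_le_mul_of_nonneg_left hsq hNR.le
    have h4 : 6 * Γ * (N * √D * (L + 1) + D) ≤ 2 * (N * W) := by linarith
    have h5 := mul_le_mul_of_nonneg_right h4 hmR.le
    linarith

end Hierarchy

/-! ### Numerical estimates -/

section Numerics

/-- Each factor is at most a power of `n * T`, so the bits needed are the exponent times a
logarithm. For `K = 0` the factor containing `B` disappears, so `B` may then exceed `T`. -/
theorem memory_prod_le {n T B R N K M : ℕ} (hn : 2 ≤ n) (hT : 2 ≤ T) (hB : K = 0 ∨ B ≤ T)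
    (hR : R = 6 * T * T) (hN : N = 6 * T) :
    (T + 1) * (((B * (n * (R + 1) ^ 2) + 1) ^ M * (R + 1)) ^ K *
      (n * (n * (N + 1) + 1) ^ (K * M + 1))) ≤ (n * T) ^ (16 * (K * M) + 3 * K + 7) := by
  set Y := n * T with hY
  have h2T : 2 * T ≤ Y := Nat.mul_le_mul_right T hn
  have h2n : n * 2 ≤ Y := Nat.mul_le_mul_left n hT
  have hY4 : 4 ≤ Y := by omega
  have hYpos : 0 < Y := by omega
  have h1 : T + 1 ≤ Y := by omega
  have h2 : R + 1 ≤ Y ^ 3 := by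
    have : (2 * T) ^ 2 * 4 ≤ Y ^ 2 * Y := Nat.mul_le_mul (Nat.pow_le_pow_left h2T 2) hY4
    rw [hR]
    nlinarith
  have h3 : N + 1 ≤ Y ^ 3 := by
    refine le_trans ?_ h2
    rw [hN, hR]
    nlinarith
  have hsucc : ∀ j, Y ^ j + 1 ≤ Y ^ (j + 1) := fun j => by
    have : 1 ≤ Y ^ j := Nat.one_le_pow _ _ hYpos
    rw [pow_succ]
    nlinarith
  have h4 : n * (N + 1) + 1 ≤ Y ^ 5 := by
    refine le_trans ?_ (hsucc 4)
    have : n * (N + 1) ≤ Y * Y ^ 3 := Nat.mul_le_mul (by omega) h3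
    calc n * (N + 1) + 1 ≤ Y * Y ^ 3 + 1 := by omega
      _ = _ := by ring
  have h5 : ((B * (n * (R + 1) ^ 2) + 1) ^ M * (R + 1)) ^ K ≤ ((Y ^ 8) ^ M * Y ^ 3) ^ K := by
    rcases hB with rfl | hB
    · simp
    · have h6 : B * (n * (R + 1) ^ 2) + 1 ≤ Y ^ 8 := by
        refine le_trans ?_ (hsucc 7)
        have : B * (n * (R + 1) ^ 2) ≤ T * (n * (Y ^ 3) ^ 2) := by gcongr
        calc B * (n * (R + 1) ^ 2) + 1 ≤ T * (n * (Y ^ 3) ^ 2) + 1 := by omega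
          _ = Y ^ 7 + 1 := by rw [hY]; ring
      gcongr
  calc _ ≤ Y * (((Y ^ 8) ^ M * Y ^ 3) ^ K * (Y * (Y ^ 5) ^ (K * M + 1))) := by
        gcongr
        omega
    _ = Y ^ (13 * (K * M) + 3 * K + 7) := by
        rw [← pow_mul, ← pow_mul, ← pow_add, ← pow_mul, ← pow_succ', ← pow_add, ← pow_succ']
        congr 1
        ring
    _ ≤ _ := Nat.pow_le_pow_right hYpos (by omega)

theorem one_le_log {n T : ℕ} (hn : 2 ≤ n) (hT : 2 ≤ T) : 1 ≤ Real.log ((n : ℝ) * T) := by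
  have h4 : (4 : ℝ) ≤ n * T := by
    have := Nat.mul_le_mul hn hT
    exact_mod_cast this
  rw [Real.le_log_iff_exp_le (by linarith)]
  linarith [Real.exp_one_lt_d9]

/-- The failure probability of the sampling. -/
theorem failure_le {a n T B T₀ K : ℕ} {q : ℝ} (hn : 2 ≤ n) (hT : 2 ≤ T) (hK : K ≤ T) (hB : B ≤ T)
    (hT₀ : T₀ ≤ 2 * T) (hq : ((a : ℝ) + 7) * Real.log ((n : ℝ) * T) ≤ q) :
    (K : ℝ) * (T₀ * (((B : ℝ) + 1) * n)) * Real.exp (-q) ≤ 1 / (T : ℝ) ^ a / 2 := by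
  have hn' : (2 : ℝ) ≤ n := by exact_mod_cast hn
  have hT' : (2 : ℝ) ≤ T := by exact_mod_cast hT
  have hY : (0 : ℝ) < n * T := by positivity
  have hexp : Real.exp (-q) ≤ (((n : ℝ) * T) ^ (a + 7))⁻¹ := by
    have h1 : Real.exp (-q) ≤ Real.exp (-(((a + 7 : ℕ) : ℝ) * Real.log ((n : ℝ) * T))) := by
      refine Real.exp_le_exp.2 ?_
      push_cast
      linarith
    rwa [Real.exp_neg (((a + 7 : ℕ) : ℝ) * _), Real.exp_nat_mul, Real.exp_log hY] at h1
  have h1 : (K : ℝ) * (T₀ * (((B : ℝ) + 1) * n)) ≤ T * (2 * T * (2 * T * n)) := by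
    have hK' : (K : ℝ) ≤ T := by exact_mod_cast hK
    have hB' : (B : ℝ) ≤ T := by exact_mod_cast hB
    have hT₀' : (T₀ : ℝ) ≤ 2 * T := by exact_mod_cast hT₀
    have : (B : ℝ) + 1 ≤ 2 * T := by linarith
    gcongr
  have h2 : (T : ℝ) * (2 * T * (2 * T * n)) * 2 * (T : ℝ) ^ a ≤ ((n : ℝ) * T) ^ (a + 7) := by
    have e1 : ((n : ℝ) * T) ^ (a + 7) = (n : ℝ) ^ a * T ^ a * (n ^ 3 * n ^ 4 * T ^ 4 * T ^ 3) := by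
      ring
    have e2 : (T : ℝ) * (2 * T * (2 * T * n)) * 2 * (T : ℝ) ^ a =
        1 * (T : ℝ) ^ a * (2 ^ 3 * n * 1 * T ^ 3) := by ring
    rw [e1, e2]
    have hn1 : (1 : ℝ) ≤ n := by linarith
    have hT1 : (1 : ℝ) ≤ T := by linarith
    have h3 : (1 : ℝ) ≤ n ^ a := one_le_pow₀ hn1
    have h4 : (n : ℝ) ≤ n ^ 4 := le_self_pow₀ hn1 (by norm_num)
    have h5 : (1 : ℝ) ≤ T ^ 4 := one_le_pow₀ hT1
    have h6 : (2 : ℝ) ^ 3 ≤ n ^ 3 := pow_le_pow_left₀ (by norm_num) hn' 3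
    gcongr
  calc _ ≤ (T : ℝ) * (2 * T * (2 * T * n)) * (((n : ℝ) * T) ^ (a + 7))⁻¹ := by gcongr
    _ ≤ _ := by
      rw [← div_eq_mul_inv, div_div, div_le_div_iff₀ (by positivity) (by positivity)]
      linarith

/-- The failure probability of the plays. -/
theorem plays_failure_le {a n T : ℕ} (hn : 2 ≤ n) (hT : 2 ≤ T) :
    Real.exp (-(((a : ℝ) + 1) * Real.log ((n : ℝ) * T))) ≤ 1 / (T : ℝ) ^ a / 2 := by
  have hn' : (2 : ℝ) ≤ n := by exact_mod_cast hn
  have hT' : (2 : ℝ) ≤ T := by exact_mod_cast hT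
  have hY : (0 : ℝ) < n * T := by positivity
  have h1 : ((a : ℝ) + 1) * Real.log ((n : ℝ) * T) = ((a + 1 : ℕ) : ℝ) * Real.log ((n : ℝ) * T) := by
    push_cast; ring
  rw [h1, Real.exp_neg, Real.exp_nat_mul, Real.exp_log hY, div_div, inv_eq_one_div]
  refine one_div_le_one_div_of_le (by positivity) ?_
  have e1 : ((n : ℝ) * T) ^ (a + 1) = T ^ a * (n ^ a * n * T) := by ring
  rw [e1]
  have h3 : (1 : ℝ) ≤ n ^ a := one_le_pow₀ (by linarith)
  have : (2 : ℝ) ≤ n ^ a * n * T := by nlinarith [mul_nonneg (by linarith : (0:ℝ) ≤ n) (by linarith : (0:ℝ) ≤ T)]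
  gcongr

/-- The time horizon in terms of the accuracy of the top level. -/
theorem horizon_le {T Δ Γ X K : ℕ} {δ : ℝ} (hδ : 0 < δ) (hT : 1 ≤ T) (hΔ : 1 ≤ Δ)
    (hΓ : 1 ≤ Γ) (hX : (X : ℝ) ^ (δ / 2) ≤ Γ) (hTK : T ≤ Δ * (Γ * X) ^ (K + 1)) :
    (T : ℝ) ≤ Δ * (Γ : ℝ) ^ (K + 1) * (T : ℝ) ^ (2 / (2 + δ)) := by
  have hT0 : (0 : ℝ) < T := by exact_mod_cast hT
  have hΔ1 : (1 : ℝ) ≤ Δ := by exact_mod_cast hΔ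
  have hΓ1 : (1 : ℝ) ≤ Γ := by exact_mod_cast hΓ
  have hX0 : (0 : ℝ) ≤ X := Nat.cast_nonneg _
  set ρ : ℝ := δ / (2 + δ) with hρ
  have hρ0 : 0 < ρ := by positivity
  have hρ1 : ρ ≤ 1 := by
    rw [hρ, div_le_one (by linarith)]; linarith
  have hsplit : (T : ℝ) = (T : ℝ) ^ ρ * (T : ℝ) ^ (2 / (2 + δ)) := by
    rw [← Real.rpow_add hT0, hρ, ← add_div, add_comm δ, div_self (by linarith), Real.rpow_one]
  -- From `X ≤ Γ ^ (2 / δ)` follows `Γ * X ≤ Γ ^ ((2 + δ) / δ)`, and `ρ` is the reciprocal of this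
  -- exponent.
  have hΓX : ((Γ : ℝ) * X) ^ ρ ≤ Γ := by
    have h1 : (X : ℝ) ≤ (Γ : ℝ) ^ (2 / δ) := by
      have := Real.rpow_le_rpow (by positivity) hX (by positivity : 0 ≤ 2 / δ)
      rwa [← Real.rpow_mul hX0, div_mul_div_comm, mul_comm δ, div_self (by positivity),
        Real.rpow_one] at this
    have h2 : (Γ : ℝ) * X ≤ (Γ : ℝ) ^ ((2 + δ) / δ) := by
      have h3 : (2 + δ) / δ = 1 + 2 / δ := by field_simp; ring
      rw [h3, Real.rpow_add (by linarith), Real.rpow_one]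
      gcongr
    refine (Real.rpow_le_rpow (by positivity) h2 hρ0.le).trans (le_of_eq ?_)
    rw [← Real.rpow_mul (by linarith), hρ, div_mul_div_cancel₀ (by positivity),
      div_self (by positivity), Real.rpow_one]
  have hTρ : (T : ℝ) ^ ρ ≤ Δ * (Γ : ℝ) ^ (K + 1) := by
    have h1 : (T : ℝ) ≤ Δ * ((Γ : ℝ) * X) ^ (K + 1) := by exact_mod_cast hTK
    refine (Real.rpow_le_rpow hT0.le h1 hρ0.le).trans ?_
    rw [Real.mul_rpow (by positivity) (by positivity)]
    refine mul_le_mul ?_ ?_ (by positivity) (by positivity)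
    · calc (Δ : ℝ) ^ ρ ≤ (Δ : ℝ) ^ (1 : ℝ) := Real.rpow_le_rpow_of_exponent_le hΔ1 hρ1
        _ = Δ := Real.rpow_one _
    · rw [← Real.rpow_natCast, ← Real.rpow_mul (by positivity), mul_comm ((K + 1 : ℕ) : ℝ) ρ,
        Real.rpow_mul (by positivity), Real.rpow_natCast]
      exact pow_le_pow_left₀ (by positivity) hΓX _
  calc (T : ℝ) = (T : ℝ) ^ ρ * (T : ℝ) ^ (2 / (2 + δ)) := hsplit
    _ ≤ _ := mul_le_mul_of_nonneg_right hTρ (by positivity)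

end Numerics

section Numerics

theorem natLog_le_two_mul_log {k : ℕ} {Y : ℝ} (hk : (k : ℝ) ≤ Y) (hY : 1 ≤ Y) :
    (Nat.log 2 k : ℝ) ≤ 2 * Real.log Y := by
  rcases Nat.eq_zero_or_pos k with rfl | hk0
  · simpa using Real.log_nonneg hY
  · have h1 : ((2 : ℝ) ^ Nat.log 2 k) ≤ Y := by
      refine le_trans ?_ hk
      exact_mod_cast Nat.pow_log_le_self 2 hk0.ne'
    have h2 := Real.log_le_log (by positivity) h1
    rw [Real.log_pow] at h2
    nlinarith [Real.log_two_gt_d9, Nat.cast_nonneg (α := ℝ) (Nat.log 2 k)]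

theorem mul_ceil_le {n a T : ℕ} (hn : 2 ≤ n) (hT : 2 ≤ T) :
    ((3 * ⌈(n : ℝ) * (a + 7) * Real.log ((n : ℝ) * T)⌉₊ : ℕ) : ℝ) ≤
      3 * ((a : ℝ) + 8) * (n * Real.log ((n : ℝ) * T)) := by
  have hΛ := one_le_log hn hT
  have hn' : (2 : ℝ) ≤ n := by exact_mod_cast hn
  have h1 := (Nat.ceil_lt_add_one (a := (n : ℝ) * (a + 7) * Real.log ((n : ℝ) * T))
    (by positivity)).le
  have h2 : (1 : ℝ) ≤ n * Real.log ((n : ℝ) * T) := by nlinarith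
  push_cast
  linarith

theorem rpow_ceil_le {X : ℝ} {δ : ℝ} (hX : 1 ≤ X) (hδ : 0 < δ) :
    ((⌈X ^ (δ / 2)⌉₊ : ℕ) : ℝ) ≤ 2 * X ^ (δ / 2) := by
  have h1 : 1 ≤ X ^ (δ / 2) := Real.one_le_rpow hX (by positivity)
  have h2 := (Nat.ceil_lt_add_one (a := X ^ (δ / 2)) (by positivity)).le
  linarith

theorem log_add_one_le {n T B X : ℕ} {c : ℝ} (hn : 2 ≤ n) (hT : 2 ≤ T) (hc : 1 ≤ c)
    (hX : 3 ≤ X) (hXc : (X : ℝ) ≤ c * (n * Real.log ((n : ℝ) * T))) (hB : B ≤ X * X) :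
    Real.log ((B : ℝ) + 1) + 1 ≤ (3 * c + 7) * Real.log ((n : ℝ) * T) := by
  have hΛ := one_le_log hn hT
  set Λ := Real.log ((n : ℝ) * T)
  have hn' : (2 : ℝ) ≤ n := by exact_mod_cast hn
  have hT' : (2 : ℝ) ≤ T := by exact_mod_cast hT
  have hX' : (3 : ℝ) ≤ X := by exact_mod_cast hX
  have hB' : (B : ℝ) ≤ X * X := by exact_mod_cast hB
  have h1 : (B : ℝ) + 1 ≤ (X : ℝ) ^ 3 := by nlinarith
  have h2 := Real.log_le_log (by positivity) h1
  rw [Real.log_pow] at h2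
  have h3 := Real.log_le_log (by positivity) hXc
  rw [Real.log_mul (by positivity) (by positivity), Real.log_mul (by positivity)
    (by positivity)] at h3
  have h4 := Real.log_le_self (by linarith : 0 ≤ c)
  have h5 := Real.log_le_self (by linarith : 0 ≤ Λ)
  have h6 : Real.log n ≤ Λ := Real.log_le_log (by positivity) (by nlinarith)
  push_cast at h2
  have h7 : c ≤ c * Λ := by nlinarith
  linarith

/-- The ratio of slot length to scaled regret on level `K` is `Γ ^ K`, so the slots contribute about
`T / Γ ^ K`, which `horizon_le` bounds. For `K = 0` the slot length `Δ` may exceed `T`, but it is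
itself below the bound. -/
theorem top_level_le {T Δ Γ X K : ℕ} {δ : ℝ} (hδ : 0 < δ) (hT : 1 ≤ T) (hΔ : 1 ≤ Δ)
    (hΓ : 1 ≤ Γ) (hX : (X : ℝ) ^ (δ / 2) ≤ Γ) (hTK : T ≤ Δ * (Γ * X) ^ (K + 1))
    (hK : K = 0 ∨ Δ * (Γ * X) ^ K ≤ T) :
    ((T / (Δ * (Γ * X) ^ K) + 1 : ℕ) : ℝ) * (Δ * X ^ K) ≤
      2 * (Δ * Γ) * (T : ℝ) ^ (2 / (2 + δ)) := by
  have hmain := horizon_le hδ hT hΔ hΓ hX hTK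
  have hT1 : (1 : ℝ) ≤ T := by exact_mod_cast hT
  have hΓ1 : (1 : ℝ) ≤ Γ := by exact_mod_cast hΓ
  have hθ : 1 ≤ (T : ℝ) ^ (2 / (2 + δ)) := Real.one_le_rpow hT1 (by positivity)
  set D := Δ * (Γ * X) ^ K with hD
  have h1 : (T / D + 1) * D ≤ T + D := by
    have := Nat.div_mul_le_self T D
    rw [add_mul, one_mul]; omega
  have h2 : ((T / D + 1 : ℕ) : ℝ) * (Δ * X ^ K) * Γ ^ K ≤ T + D := by
    have : (((T / D + 1) * D : ℕ) : ℝ) ≤ ((T + D : ℕ) : ℝ) := by exact_mod_cast h1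
    rw [Nat.cast_mul] at this
    nth_rw 2 [hD] at this
    calc _ = ((T / D + 1 : ℕ) : ℝ) * ((Δ * (Γ * X) ^ K : ℕ) : ℝ) := by push_cast; ring
      _ ≤ _ := by simpa using this
  have h3 : ((T : ℝ) + D) ≤ 2 * (Δ * Γ) * (T : ℝ) ^ (2 / (2 + δ)) * Γ ^ K := by
    rcases hK with rfl | hK
    · have h5 : (Δ : ℝ) * 1 * 1 ≤ Δ * Γ * (T : ℝ) ^ (2 / (2 + δ)) := by gcongr
      have h6 : (D : ℝ) = Δ := by simp [hD]
      rw [h6]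
      simp only [zero_add, pow_one, pow_zero] at hmain ⊢
      linarith
    · have h4 : (D : ℝ) ≤ T := by exact_mod_cast hK
      calc (T : ℝ) + D ≤ 2 * T := by linarith
        _ ≤ 2 * (Δ * (Γ : ℝ) ^ (K + 1) * (T : ℝ) ^ (2 / (2 + δ))) := by linarith
        _ = _ := by ring
  exact le_of_mul_le_mul_right (h2.trans h3) (by positivity)

/-- The contribution of the geometric parameters to the regret. -/
theorem accuracy_le {n X : ℕ} {c c' Λ L G D δ : ℝ} (hδ1 : δ ≤ 1) (hX : 1 ≤ X)
    (hXc : (X : ℝ) ≤ c * (n * Λ)) (hG0 : 1 ≤ G) (hG : G ≤ 2 * (X : ℝ) ^ (δ / 2)) (hL0 : 1 ≤ L)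
    (hL : L ≤ c' * Λ) (hD : D ≤ 36 * G ^ 2 * L ^ 2 + 1) :
    D * G ≤ 296 * c ^ 2 * c' ^ 2 * (n ^ 2 * Λ ^ 4) := by
  have hX1 : (1 : ℝ) ≤ X := by exact_mod_cast hX
  have h1 : D ≤ 37 * G ^ 2 * L ^ 2 := by
    have : 1 * 1 ≤ G ^ 2 * L ^ 2 :=
      mul_le_mul (one_le_pow₀ hG0) (one_le_pow₀ hL0) (by norm_num) (by positivity)
    linarith
  -- Two powers of `G` come from `Δ`, one from the last level; since `3 * δ / 2 ≤ 2`, they cost at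
  -- most `X ^ 2`, whence the factor `n ^ 2`.
  have h2 : G ^ 3 ≤ 8 * (X : ℝ) ^ 2 := by
    have h3 : ((X : ℝ) ^ (δ / 2)) ^ 3 ≤ (X : ℝ) ^ 2 := by
      rw [← Real.rpow_natCast, ← Real.rpow_mul (by positivity), ← Real.rpow_natCast _ 2]
      refine Real.rpow_le_rpow_of_exponent_le hX1 ?_
      push_cast
      linarith
    calc G ^ 3 ≤ (2 * (X : ℝ) ^ (δ / 2)) ^ 3 := by gcongr
      _ = 8 * ((X : ℝ) ^ (δ / 2)) ^ 3 := by ring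
      _ ≤ _ := by linarith
  calc D * G ≤ 37 * G ^ 2 * L ^ 2 * G := by gcongr
    _ = 37 * G ^ 3 * L ^ 2 := by ring
    _ ≤ 37 * (8 * (c * (n * Λ)) ^ 2) * (c' * Λ) ^ 2 := by
      have : 8 * (X : ℝ) ^ 2 ≤ 8 * (c * (n * Λ)) ^ 2 := by gcongr
      have := h2.trans this
      gcongr
    _ = _ := by ring

theorem regret_total_le {p Λ θ s E F A b : ℝ} (hΛ : 1 ≤ Λ) (hp : 1 ≤ p) (hb : 0 ≤ b) (hs : 1 ≤ s)
    (hθ : s ≤ θ) (hE : E ≤ 2 * F * θ) (hF : F ≤ A * (p ^ 2 * Λ ^ 4)) :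
    E + 1 / 6 + s * (1 + (b + 1) * Λ) ≤ (2 * A + b + 3) * p ^ 2 * θ * Λ ^ 4 := by
  have hp2 : 1 ≤ p ^ 2 := one_le_pow₀ hp
  have hΛ4 : Λ ≤ Λ ^ 4 := le_self_pow₀ hΛ (by norm_num)
  have hΛQ : Λ ≤ p ^ 2 * Λ ^ 4 := hΛ4.trans (le_mul_of_one_le_left (by positivity) hp2)
  set Q := p ^ 2 * Λ ^ 4 with hQ
  have hθ1 : 1 ≤ θ := hs.trans hθ
  have h1 : 2 * F * θ ≤ 2 * (A * Q) * θ := by gcongr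
  have h2 : s * (1 + (b + 1) * Λ) ≤ θ * ((b + 2) * Q) := by
    have h3 : (b + 1) * Λ ≤ (b + 1) * Q := by gcongr
    refine mul_le_mul hθ (by linarith) (by positivity) (by linarith)
  have h4 : 1 ≤ θ * Q := one_le_mul_of_one_le_of_one_le hθ1 (hΛ.trans hΛQ)
  calc E + 1 / 6 + s * (1 + (b + 1) * Λ) ≤ 2 * (A * Q) * θ + θ * Q + θ * ((b + 2) * Q) := by
        linarith
    _ = _ := by rw [hQ]; ring

/-- The four logarithms come from the number of levels, the age classes of a pool, the bits per
entry, and the logarithm inside `X ^ (δ / 2)`. -/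
theorem memory_le {K M e G s : ℕ} {Λ c p X δ : ℝ} (hΛ : 1 ≤ Λ) (hc : 1 ≤ c) (hp : 1 ≤ p)
    (hδ : 0 < δ) (hδ1 : δ ≤ 1)
    (hX : 0 ≤ X) (hXc : X ≤ c * (p * Λ)) (hG1 : 1 ≤ G) (hG : (G : ℝ) ≤ 2 * X ^ (δ / 2))
    (hK : (K : ℝ) ≤ 2 * Λ) (hM : K = 0 ∨ (M : ℝ) ≤ 19 * G * Λ)
    (he : e = 16 * (K * M) + 3 * K + 7) (hs : (s : ℝ) ≤ 2 * Λ) :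
    ((e * (s + 1) : ℕ) : ℝ) ≤ 3726 * c * p ^ δ * Λ ^ 4 := by
  have hG1' : (1 : ℝ) ≤ G := by exact_mod_cast hG1
  have hKM : (K : ℝ) * M ≤ 38 * (G * Λ ^ 2) := by
    rcases hM with rfl | hM
    · simp only [Nat.cast_zero, zero_mul]; positivity
    · calc (K : ℝ) * M ≤ 2 * Λ * (19 * G * Λ) := by gcongr
        _ = _ := by ring
  have h1 : 1 * 1 ≤ (G : ℝ) * Λ ^ 2 :=
    mul_le_mul hG1' (one_le_pow₀ hΛ) (by norm_num) (by positivity)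
  have h2 : 1 * Λ ≤ (G : ℝ) * Λ ^ 2 :=
    mul_le_mul hG1' (le_self_pow₀ hΛ (by norm_num)) (by positivity) (by positivity)
  have h3 : (e : ℝ) ≤ 621 * (G * Λ ^ 2) := by
    rw [he]; push_cast; linarith
  have h4 : (s : ℝ) + 1 ≤ 3 * Λ := by linarith
  have h5 : (G : ℝ) ≤ 2 * (c * Λ * p ^ δ) := by
    refine hG.trans ?_
    have h6 : 1 ≤ c * Λ := by nlinarith
    have h7 : X ^ (δ / 2) ≤ (c * Λ * p) ^ (δ / 2) :=
      Real.rpow_le_rpow hX (hXc.trans (le_of_eq (by ring))) (by positivity)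
    rw [Real.mul_rpow (by positivity) (by positivity)] at h7
    have h8 : (c * Λ) ^ (δ / 2) ≤ c * Λ := by
      calc (c * Λ) ^ (δ / 2) ≤ (c * Λ) ^ (1 : ℝ) :=
            Real.rpow_le_rpow_of_exponent_le h6 (by linarith)
        _ = _ := Real.rpow_one _
    have h9 : p ^ (δ / 2) ≤ p ^ δ := Real.rpow_le_rpow_of_exponent_le hp (by linarith)
    have h10 : (c * Λ) ^ (δ / 2) * p ^ (δ / 2) ≤ c * Λ * p ^ δ := by gcongr
    linarith
  push_cast
  calc (e : ℝ) * (s + 1) ≤ 621 * (2 * (c * Λ * p ^ δ) * Λ ^ 2) * (3 * Λ) := by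
        refine mul_le_mul (h3.trans ?_) h4 (by positivity) (by positivity)
        gcongr
    _ = _ := by ring

end Numerics

/-! ### Conclusion -/

/-- The conclusion for a single expert or a single round. -/
theorem exists_trivial_algorithm {a n T : ℕ} {W : ℝ} (hn : 1 ≤ n) (h : n = 1 ∨ T = 1)
    (hW : 0 ≤ W) :
    ∃ A : OnlineAlgorithm n (Fin 0 → Bool), ∀ ℓ : Fin T → Fin n → ℝ,
      ENNReal.ofReal (1 - 1 / (T : ℝ) ^ a) ≤
        (A.decisions ℓ).toOuterMeasure {d | totalRegret ℓ d ≤ W} := by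
  have i₀ : Fin n := ⟨0, hn⟩
  refine ⟨⟨PMF.pure default, fun s => PMF.pure (i₀, s), 0, fun _ => i₀, fun s _ => PMF.pure s⟩,
    fun ℓ => ?_⟩
  -- With one expert the regret is zero; with one round the required probability is `1 - 1 = 0`.
  rcases h with rfl | rfl
  · have : {d | totalRegret ℓ d ≤ W} = Set.univ := by
      refine Set.eq_univ_of_forall fun d => ?_
      have h1 : ∀ t, d t = 0 := fun t => Subsingleton.elim _ _
      simp [totalRegret, h1, hW]
    rw [this]
    refine (PMF.ofReal_one_sub_le_toOuterMeasure _ (by positivity) ?_)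
    simp
  · simp

theorem exists_algorithm_of_two_le {a n T : ℕ} {δ : ℝ} (hn : 2 ≤ n) (hT : 2 ≤ T) (hδ : 0 < δ)
    (hδ1 : δ ≤ 1) :
    ∃ (S : ℕ) (A : OnlineAlgorithm n (Fin S → Bool)),
      (S : ℝ) ≤ 3726 * (3 * ((a : ℝ) + 8)) * (n : ℝ) ^ δ * Real.log ((n : ℝ) * T) ^ 4 ∧
      ∀ ℓ : Fin T → Fin n → ℝ, (∀ t i, ℓ t i ∈ Set.Icc (0 : ℝ) 1) →
        ENNReal.ofReal (1 - 1 / (T : ℝ) ^ a) ≤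
          (A.decisions ℓ).toOuterMeasure
            {d | totalRegret ℓ d ≤
              (592 * (3 * ((a : ℝ) + 8)) ^ 2 * (3 * (3 * ((a : ℝ) + 8)) + 7) ^ 2 + a + 3) *
                (n : ℝ) ^ 2 * (T : ℝ) ^ (2 / (2 + δ)) * Real.log ((n : ℝ) * T) ^ 4} := by
  have : NeZero n := ⟨by omega⟩
  have hΛ := one_le_log hn hT
  have hn' : (2 : ℝ) ≤ n := by exact_mod_cast hn
  have hT' : (2 : ℝ) ≤ T := by exact_mod_cast hT
  have hXc := mul_ceil_le (a := a) hn hT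
  have hm_ge := Nat.le_ceil ((n : ℝ) * (a + 7) * Real.log ((n : ℝ) * T))
  have hm : 0 < ⌈(n : ℝ) * (a + 7) * Real.log ((n : ℝ) * T)⌉₊ := Nat.ceil_pos.2 (by positivity)
  generalize ⌈(n : ℝ) * (a + 7) * Real.log ((n : ℝ) * T)⌉₊ = m at hXc hm_ge hm
  set c : ℝ := 3 * ((a : ℝ) + 8) with hc
  have hc1 : 1 ≤ c := by rw [hc]; linarith [Nat.cast_nonneg (α := ℝ) a]
  set X := 3 * m with hX
  have hX3 : 3 ≤ X := by omega
  have hXR : (1 : ℝ) ≤ X := by exact_mod_cast (by omega : 1 ≤ X)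
  have hΓge := Nat.le_ceil ((X : ℝ) ^ (δ / 2))
  have hΓle := rpow_ceil_le hXR hδ
  have hΓX : ⌈(X : ℝ) ^ (δ / 2)⌉₊ ≤ X := by
    refine Nat.ceil_le.2 ?_
    calc (X : ℝ) ^ (δ / 2) ≤ (X : ℝ) ^ (1 : ℝ) :=
          Real.rpow_le_rpow_of_exponent_le hXR (by linarith)
      _ = _ := Real.rpow_one _
  have hΓ : 0 < ⌈(X : ℝ) ^ (δ / 2)⌉₊ := Nat.ceil_pos.2 (by positivity)
  generalize ⌈(X : ℝ) ^ (δ / 2)⌉₊ = Γ at hΓge hΓle hΓX hΓ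
  have hΓR : (1 : ℝ) ≤ Γ := by exact_mod_cast hΓ
  set B := Γ * X with hB
  have hBX : B ≤ X * X := Nat.mul_le_mul_right X hΓX
  have hB2 : 2 ≤ B := by
    have := Nat.mul_le_mul hΓ hX3
    omega
  have hB0 : 0 < B := by omega
  have hLle := log_add_one_le hn hT hc1 hX3 hXc hBX
  have hL0 : 0 ≤ Real.log ((B : ℝ) + 1) :=
    Real.log_nonneg (by linarith [Nat.cast_nonneg (α := ℝ) B])
  have hΔge := Nat.le_ceil (36 * (Γ : ℝ) ^ 2 * (Real.log ((B : ℝ) + 1) + 1) ^ 2)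
  have hΔle := (Nat.ceil_lt_add_one
    (a := 36 * (Γ : ℝ) ^ 2 * (Real.log ((B : ℝ) + 1) + 1) ^ 2) (by positivity)).le
  have hΔ : 0 < ⌈36 * (Γ : ℝ) ^ 2 * (Real.log ((B : ℝ) + 1) + 1) ^ 2⌉₊ :=
    Nat.ceil_pos.2 (by positivity)
  generalize ⌈36 * (Γ : ℝ) ^ 2 * (Real.log ((B : ℝ) + 1) + 1) ^ 2⌉₊ = Δ at hΔge hΔle hΔ
  have hacc := accuracy_le hδ1 (by omega) hXc hΓR hΓle (by linarith) hLle hΔle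
  -- As many levels as fit: `K` is maximal with `Δ * B ^ K ≤ T`, or `0` if even `Δ` exceeds `T`.
  obtain ⟨K, hKlt, hK⟩ : ∃ K, T ≤ Δ * B ^ (K + 1) ∧ (K = 0 ∨ Δ * B ^ K ≤ T) := by
    refine ⟨Nat.log B (T / Δ), ?_, ?_⟩
    · have h1 := Nat.lt_pow_succ_log_self (by omega : 1 < B) (T / Δ)
      rw [Nat.div_lt_iff_lt_mul hΔ, mul_comm] at h1
      exact h1.le
    · refine or_iff_not_imp_left.2 fun h0 => ?_
      have h1 := Nat.pow_log_le_self B (x := T / Δ) (by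
        rintro h
        exact h0 (by rw [h, Nat.log_zero_right]))
      rw [Nat.le_div_iff_mul_le hΔ] at h1
      rwa [mul_comm]
  have hpow : ∀ k < K, Δ * B ^ (k + 1) ≤ T := fun k hk => by
    refine le_trans ?_ (hK.resolve_left (by omega))
    exact Nat.mul_le_mul_left _ (Nat.pow_le_pow_right (by omega) hk)
  have hBpow : ∀ k, B ^ k ≤ Δ * B ^ k := fun k => Nat.le_mul_of_pos_left _ hΔ
  have hBT : K = 0 ∨ B ≤ T := by
    rcases Nat.eq_zero_or_pos K with h | h
    · exact .inl h
    · have := (hBpow 1).trans (hpow 0 h)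
      exact .inr (by simpa using this)
  have h2K : K = 0 ∨ 2 ^ K ≤ T := hK.imp_right fun h =>
    (Nat.pow_le_pow_left hB2 K).trans ((hBpow K).trans h)
  have hKT : K ≤ T := by
    rcases h2K with h | h
    · omega
    · exact (Nat.lt_two_pow_self).le.trans h
  have hTY : (T : ℝ) ≤ n * T := by nlinarith
  have hKΛ : (K : ℝ) ≤ 2 * Real.log ((n : ℝ) * T) := by
    have h1 : K ≤ Nat.log 2 T := by
      rcases h2K with h | h
      · omega
      · exact Nat.le_log_of_pow_le (by norm_num) h
    have h2 := natLog_le_two_mul_log hTY (by nlinarith)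
    have h3 : (K : ℝ) ≤ Nat.log 2 T := by exact_mod_cast h1
    linarith
  have hMle : K = 0 ∨ ((1 + 2 * (3 * Γ) * (Nat.log 2 B + 1) : ℕ) : ℝ) ≤
      19 * Γ * Real.log ((n : ℝ) * T) := hBT.imp_right fun h => by
    have h1 : (B : ℝ) ≤ n * T := by
      have : (B : ℝ) ≤ T := by exact_mod_cast h
      linarith
    have h2 := natLog_le_two_mul_log h1 (by nlinarith)
    have h3 : (Nat.log 2 B : ℝ) + 1 ≤ 3 * Real.log ((n : ℝ) * T) := by linarith
    have h4 : 1 * 1 ≤ (Γ : ℝ) * Real.log ((n : ℝ) * T) := by gcongr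
    have h5 := mul_le_mul_of_nonneg_left h3 (by positivity : 0 ≤ 6 * (Γ : ℝ))
    push_cast
    linarith
  -- The grid size `6 * T` meets the requirement `6 * Γ ^ (k + 1) ≤ N` and keeps the total rounding
  -- loss at `1 / 6`.
  have hN : 0 < 6 * T := by omega
  have hvalid := Hierarchy.geometric_valid (0 : Fin n) (N := 6 * T) (K := K) hm hΓ hΓX hΔ hΔge hN
    fun k hk => Nat.mul_le_mul_left 6 (by
      refine le_trans ?_ ((hBpow _).trans (hpow k hk))
      exact Nat.pow_le_pow_left (show Γ ≤ Γ * X from Nat.le_mul_of_pos_right _ (by omega)) _)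
  have hmem := memory_prod_le (M := 1 + 2 * (3 * Γ) * (Nat.log 2 B + 1)) hn hT hBT rfl rfl
  obtain ⟨A, hA⟩ := Hierarchy.exists_algorithm hvalid hN (T := T) (R := 6 * T * T)
    (M := 1 + 2 * (3 * Γ) * (Nat.log 2 B + 1))
    (S := (16 * (K * (1 + 2 * (3 * Γ) * (Nat.log 2 B + 1))) + 3 * K + 7) *
      (Nat.log 2 (n * T) + 1)) le_rfl
    (fun k hk => Nat.mul_le_mul_left _ (by
      refine le_trans ?_ (hpow k hk)
      exact Nat.mul_le_mul_left _ (Nat.pow_le_pow_right hB0 (Nat.le_succ k))))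
    (fun k hk => by
      have h1 : 6 * T * Δ * X ^ k * B ≤ 6 * T * T := by
        have h2 : X ^ k * B ≤ B ^ (k + 1) := by
          rw [pow_succ]
          exact Nat.mul_le_mul_right _ (Nat.pow_le_pow_left (Nat.le_mul_of_pos_left _ hΓ) k)
        calc 6 * T * Δ * X ^ k * B = 6 * T * (Δ * (X ^ k * B)) := by ring
          _ ≤ 6 * T * (Δ * B ^ (k + 1)) := by gcongr
          _ ≤ _ := Nat.mul_le_mul_left _ (hpow k hk)
      simp only [Hierarchy.geometric]
      exact_mod_cast h1)
    (by
      refine le_trans hmem ?_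
      rw [mul_comm _ (Nat.log 2 (n * T) + 1), pow_mul]
      exact Nat.pow_le_pow_left (Nat.lt_pow_succ_log_self (by norm_num) _).le _)
  refine ⟨_, A, ?_, fun ℓ hℓ => ?_⟩
  · exact memory_le hΛ hc1 (by linarith) hδ hδ1 (by linarith) hXc hΓ hΓle hKΛ hMle rfl
      (natLog_le_two_mul_log (by push_cast; exact le_rfl) (by nlinarith))
  set Λ := Real.log ((n : ℝ) * T) with hΛdef
  have hsqrt : 1 ≤ √(T : ℝ) := by rw [Real.one_le_sqrt]; linarith
  have hsq : √(T : ℝ) ^ 2 = T := Real.sq_sqrt (by linarith)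
  -- With this `η` and `x` the exponent `η ^ 2 * T - η * x` equals `-(a + 1) * Λ`.
  have key := hA ℓ hℓ (1 / √(T : ℝ)) (√(T : ℝ) * (1 + (a + 1) * Λ)) (by positivity)
    (by rw [div_le_one (by linarith)]; exact hsqrt)
  refine PMF.ofReal_one_sub_le_toOuterMeasure _ (by positivity) ?_
  refine le_trans (MeasureTheory.measure_mono ?_) (key.trans ?_)
  · intro d hd
    simp only [Set.mem_compl_iff, Set.mem_ofPred_eq, not_le] at hd ⊢
    refine lt_of_le_of_lt ?_ hd
    have htop := top_level_le hδ (by omega) hΔ hΓ hΓge hKlt hK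
    have hθ : √(T : ℝ) ≤ (T : ℝ) ^ (2 / (2 + δ)) := by
      rw [Real.sqrt_eq_rpow]
      refine Real.rpow_le_rpow_of_exponent_le (by linarith) ?_
      rw [div_le_div_iff₀ (by norm_num) (by linarith)]
      linarith
    set θ := (T : ℝ) ^ (2 / (2 + δ))
    have e1 : (((T / (Hierarchy.geometric (0 : Fin n) m Γ Δ (6 * T)).D K + 1 : ℕ) : ℝ) *
        (Hierarchy.geometric (0 : Fin n) m Γ Δ (6 * T)).V K + T) / (6 * T : ℕ) =
        ((T / (Δ * (Γ * X) ^ K) + 1 : ℕ) : ℝ) * (Δ * X ^ K) + 1 / 6 := by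
      simp only [Hierarchy.geometric]
      rw [← hX]
      push_cast
      rw [hX]
      push_cast
      field_simp
    rw [e1]
    have h1 := regret_total_le hΛ (by linarith) (Nat.cast_nonneg a) hsqrt hθ htop hacc
    refine h1.trans (le_of_eq ?_)
    ring
  · have hhalf : 1 / (T : ℝ) ^ a = 1 / (T : ℝ) ^ a / 2 + 1 / (T : ℝ) ^ a / 2 := by ring
    rw [hhalf, ENNReal.ofReal_add (by positivity) (by positivity)]
    refine add_le_add (ENNReal.ofReal_le_ofReal ?_) (ENNReal.ofReal_le_ofReal ?_)
    · rcases Nat.eq_zero_or_pos K with h0 | h0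
      · rw [h0]
        simp only [Nat.cast_zero, zero_mul]
        positivity
      · refine failure_le hn hT hKT (hBT.resolve_left h0.ne') ?_ ?_
        · have h1 : Δ * B ^ K ≤ T := hK.resolve_left h0.ne'
          have h2 := Nat.div_mul_le_self T (Δ * B ^ K)
          change (T / (Δ * B ^ K) + 1) * (Δ * B ^ K) ≤ 2 * T
          rw [add_mul, one_mul]
          omega
        · rw [le_div_iff₀ (by linarith)]
          push_cast
          linarith
    · refine le_trans (le_of_eq ?_) (plays_failure_le hn hT)
      congr 1
      have h0 : √(T : ℝ) ≠ 0 := by positivity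
      rw [div_pow, hsq, ← hΛdef]
      field_simp
      ring

theorem theorem4p1 (a : ℕ) :
    ∃ (C : ℝ) (c : ℕ), ∀ (n T : ℕ) (δ : ℝ), 1 ≤ n → 1 ≤ T → 0 < δ → δ ≤ 1 →
      ∃ (S : ℕ) (A : OnlineAlgorithm n (Fin S → Bool)),
        (S : ℝ) ≤ C * (n : ℝ) ^ δ * Real.log ((n : ℝ) * T) ^ 4 ∧
        ∀ ℓ : Fin T → Fin n → ℝ, (∀ t i, ℓ t i ∈ Set.Icc (0 : ℝ) 1) →
          ENNReal.ofReal (1 - 1 / (T : ℝ) ^ a) ≤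
            (A.decisions ℓ).toOuterMeasure
              {d | totalRegret ℓ d ≤
                C * (n : ℝ) ^ 2 * (T : ℝ) ^ (2 / (2 + δ)) * Real.log ((n : ℝ) * T) ^ c} := by
  set C₁ : ℝ := 3726 * (3 * ((a : ℝ) + 8)) with hC₁
  set C₂ : ℝ := 592 * (3 * ((a : ℝ) + 8)) ^ 2 * (3 * (3 * ((a : ℝ) + 8)) + 7) ^ 2 + a + 3 with hC₂
  have h₁ : 0 ≤ C₁ := by positivity
  have h₂ : 0 ≤ C₂ := by positivity
  refine ⟨C₁ + C₂, 4, fun n T δ hn hT hδ hδ1 => ?_⟩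
  have hn' : (1 : ℝ) ≤ n := by exact_mod_cast hn
  have hT' : (1 : ℝ) ≤ T := by exact_mod_cast hT
  have hΛ : 0 ≤ Real.log ((n : ℝ) * T) := Real.log_nonneg (by nlinarith)
  by_cases h : n = 1 ∨ T = 1
  · obtain ⟨A, hA⟩ := exists_trivial_algorithm (a := a) hn h (W := (C₁ + C₂) * (n : ℝ) ^ 2 *
      (T : ℝ) ^ (2 / (2 + δ)) * Real.log ((n : ℝ) * T) ^ 4) (by positivity)
    refine ⟨0, A, ?_, fun ℓ _ => hA ℓ⟩
    rw [Nat.cast_zero]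
    positivity
  · obtain ⟨S, A, hS, hA⟩ := exists_algorithm_of_two_le (a := a) (n := n) (T := T) (by omega)
      (by omega) hδ hδ1
    refine ⟨S, A, hS.trans ?_, fun ℓ hℓ => (hA ℓ hℓ).trans (MeasureTheory.measure_mono ?_)⟩
    · have : C₁ ≤ C₁ + C₂ := le_add_of_nonneg_right h₂
      gcongr
    · intro d hd
      refine le_trans (Set.mem_ofPred.1 hd) ?_
      have : C₂ ≤ C₁ + C₂ := le_add_of_nonneg_left h₁
      gcongr
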